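/- **Conventions.** All functions are real-valued functions on $\mathbb R$, identified when equal a.e.; derivatives are weak derivatives; $\|f\|_{W^{k,p}}=\sum_{j\le k}\|\partial_x^jf\|_{L^p}$ and $H^k=W^{k,2}$. Let $C_{\lim}$ be the set of continuous $f$ having finite limits $f(\pm\infty)$. Let $\bar h\in\mathbb R$ and let $h$ satisfy $h-\bar h\in H^1(\mathbb R)$, $h>0$, $h^{-1}\in L^\infty(\mathbb R)$ (so that $\bar h>0$ and $h\in L^\infty$), and let $$\mathcal L_h u=h\,u-\tfrac13\,\partial_x\big(h^3\,\partial_x u\big).$$ We write $\mathcal L_h^{-1}\psi$ and $\mathcal L_h^{-1}\partial_x\varphi$ for the bounded weakly differentiable function $u$ that solves $\mathcal L_hu=\psi$, respectively $\mathcal L_hu=\partial_x\varphi$, in the sense of distributions, i.e. $\int \big(h\,u\,\theta+\tfrac13h^3u_x\theta_x\big)\,dx=\int\psi\,\theta\,dx$, respectively $=-\int\varphi\,\theta_x\,dx$, for all $\theta\in C_c^\infty(\mathbb R)$. Likewise $(g-\gamma\partial_x^2)^{-1}\psi$ is the bounded weakly differentiable solution $w$ of $g\,w-\gamma\,w_{xx}=\psi$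 in the sense of distributions. **Lemma 5.2.** **(i)** $\mathcal L_h$ is an isomorphism (linear, bounded, bijective, with bounded inverse) from $H^2(\mathbb R)$ onto $L^2(\mathbb R)$, and its inverse is $\mathcal L_h^{-1}$ as defined above. Moreover $\mathcal L_h^{-1}\psi$ is well defined (the solution exists and is unique) for every $\psi$ in $C_{\lim}$, in $L^1$ or in $L^2$, and so is $\mathcal L_h^{-1}\partial_x\varphi$ for every $\varphi$ in $L^1$ or in $L^2$. If $\psi\in C_{\lim}$, then $\mathcal L_h^{-1}\psi\in C_{\lim}$, with limits $\psi(\pm\infty)/\bar h$ at $\pm\infty$. **(ii)** For all $A,B\ge0$ there is a constant $C>0$, depending only on $A$ and $B$, such that for all $\bar h,h$ as above with $\|h^{-1}\|_{L^\infty}\le A$ and $\|h\|_{L^\infty}\le B$ the following holds. If $\psi\in C_{\lim}$, then $\mathcal L_h^{-1}\psi$ is twice weakly differentiable and $$\|\mathcal L_h^{-1}\psi\|_{W^{1,\infty}}\le C\|\psi\|_{L^\infty},\qquad |\partial_x^2\mathcal L_h^{-1}\psi|(x)\le C\,(1+|h_x(x)|)\,\|\psi\|_{L^\infty}\ \text{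 for a.e. }x.$$ If $\psi\in L^1$, then $$\|\mathcal L_h^{-1}\psi\|_{H^1}\le C\|\psi\|_{L^1},\qquad \|\mathcal L_h^{-1}\partial_x\psi\|_{L^\infty}\le C\|\psi\|_{L^1},$$ $$\|\partial_x\mathcal L_h^{-1}\partial_x\psi\|_{L^\infty}\le C\big[\|\psi\|_{L^1}+\|\psi\|_{L^\infty}\big],\qquad \|\mathcal L_h^{-1}\partial_x\psi\|_{L^2}\le C\|\psi\|_{L^1}\big(\|h_x\|_{L^2}+1\big)$$ (the third bound being void if $\psi\notin L^\infty$). If $\psi\in L^2$, then $$\|\mathcal L_h^{-1}\partial_x\psi\|_{H^1}+\|\mathcal L_h^{-1}\psi\|_{H^1}\le C\|\psi\|_{L^2},$$ $$\|\mathcal L_h^{-1}\psi\|_{W^{1,\infty}}\le\|\mathcal L_h^{-1}\psi\|_{H^2}\le C\big[1+\|h_x\|_{L^2}^2\big]\|\psi\|_{L^2},$$ $$|\partial_x^2\mathcal L_h^{-1}\psi|(x)\le C\big[(1+\|h_x\|_{L^2})(1+|h_x|(x))\|\psi\|_{L^2}+|\psi|(x)\big]\ \text{ for a.e. }x.$$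 If moreover $h-\bar h\in H^2$, then for all $\varphi,\psi\in H^2$ $$\|\mathcal L_h^{-1}\partial_x\varphi\|_{H^3}\le C\big[(1+\|h_x\|_{L^\infty}^2)\|\varphi\|_{H^2}+\|h-\bar h\|_{H^2}\|\mathcal L_h^{-1}\partial_x\varphi\|_{W^{1,\infty}}\big],$$ $$\|\mathcal L_h^{-1}\psi\|_{H^3}\le C\big[(1+\|h_x\|_{L^\infty}^2)\|\psi\|_{H^2}+\|h-\bar h\|_{H^2}\|\mathcal L_h^{-1}\psi\|_{W^{1,\infty}}\big].$$ **(iii)** For all $g,\gamma>0$ there is a constant $\tilde C>0$, depending only on $g$ and $\gamma$, such that $(g-\gamma\partial_x^2)^{-1}\psi$ is well defined (the solution exists and is unique) for $\psi\in H^1$, and $$\|(g-\gamma\partial_x^2)^{-1}\psi\|_{H^3}\le\tilde C\|\psi\|_{H^1}\ (\psi\in H^1),\qquad \|\partial_x(g-\gamma\partial_x^2)^{-1}\psi\|_{H^3}\le\tilde C\|\psi\|_{H^2}\ (\psi\in H^2).$$ -/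

import Mathlib

open MeasureTheory Filter Topology
open scoped NNReal ENNReal

/-- Test functions on the line: smooth with compact support. -/
def IsTestFun (θ : ℝ → ℝ) : Prop :=
  ContDiff ℝ ((⊤ : ℕ∞) : WithTop ℕ∞) θ ∧ HasCompactSupport θ

/-- `g` is a weak (distributional) derivative of `f` on the line. -/
def HasWeakDeriv (f g : ℝ → ℝ) : Prop :=
  LocallyIntegrable f ∧ LocallyIntegrable g ∧
    ∀ θ : ℝ → ℝ, IsTestFun θ → ∫ x, f x * deriv θ x = - ∫ x, g x * θ x

open Classical in
/-- The weak derivative `∂ₓ f`; it is determined almost everywhere when it exists.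
The value is `0` when there is none. -/
noncomputable def wderiv (f : ℝ → ℝ) : ℝ → ℝ :=
  if hf : ∃ g, HasWeakDeriv f g then Classical.choose hf else 0

/-- `f` is `k` times weakly differentiable. -/
def WeakDiff (k : ℕ) (f : ℝ → ℝ) : Prop :=
  ∀ j < k, HasWeakDeriv (wderiv^[j] f) (wderiv^[j + 1] f)

open Classical in
/-- The `W^{k,p}` norm `∑_{j ≤ k} ‖∂ₓʲ f‖_{L^p}`, infinite if a weak derivative is missing.
The case `p = 2` is the `H^k` norm. -/
noncomputable def sobNorm (k : ℕ) (p : ℝ≥0∞) (f : ℝ → ℝ) : ℝ≥0∞ :=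
  if WeakDiff k f then ∑ j ∈ Finset.range (k + 1), eLpNorm (wderiv^[j] f) p volume else ⊤

/-- Membership in `W^{k,p}(ℝ)`. -/
def MemSob (k : ℕ) (p : ℝ≥0∞) (f : ℝ → ℝ) : Prop :=
  AEStronglyMeasurable f volume ∧ sobNorm k p f < ⊤

/-- `C_lim`: continuous functions with finite limits at `-∞` and at `+∞`. -/
def MemClim (f : ℝ → ℝ) : Prop :=
  Continuous f ∧ (∃ l : ℝ, Tendsto f atBot (𝓝 l)) ∧ ∃ l : ℝ, Tendsto f atTop (𝓝 l)

/-- The standing assumption on `h`: `h - hbar ∈ H¹`, `h > 0` and `h⁻¹ ∈ L^∞`. -/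
structure IsDepth (hbar : ℝ) (h : ℝ → ℝ) : Prop where
  sub_mem : MemSob 1 2 (fun x => h x - hbar)
  pos : ∀ᵐ x, 0 < h x
  inv_mem : MemLp (fun x => (h x)⁻¹) ⊤ volume

/-- The operator `𝓛_h u = h u - (1/3) ∂ₓ (h³ ∂ₓ u)`. -/
noncomputable def Lop (h u : ℝ → ℝ) : ℝ → ℝ :=
  fun x => h x * u x - (1 / 3) * wderiv (fun y => h y ^ 3 * wderiv u y) x

/-- `u` is a bounded, weakly differentiable function which solves
`a u - ∂ₓ (b ∂ₓ u) = ψ + ∂ₓ φ` in the sense of distributions. -/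
def IsWeakSol (a b ψ φ u : ℝ → ℝ) : Prop :=
  MemLp u ⊤ volume ∧ HasWeakDeriv u (wderiv u) ∧
    ∀ θ : ℝ → ℝ, IsTestFun θ →
      ∫ x, (a x * u x * θ x + b x * wderiv u x * deriv θ x)
        = ∫ x, (ψ x * θ x - φ x * deriv θ x)

open Classical in
/-- `(a - ∂ₓ b ∂ₓ)⁻¹ (ψ + ∂ₓ φ)`: the bounded weak solution (`0` if there is none). -/
noncomputable def slInv (a b ψ φ : ℝ → ℝ) : ℝ → ℝ :=
  if hu : ∃ u, IsWeakSol a b ψ φ u then Classical.choose hu else 0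

/-- `(a - ∂ₓ b ∂ₓ)⁻¹ (ψ + ∂ₓ φ)` is well defined: the data are locally integrable, the bounded weak
solution exists, and it is unique as a class modulo equality almost everywhere. -/
def WellDefined (a b ψ φ : ℝ → ℝ) : Prop :=
  LocallyIntegrable ψ ∧ LocallyIntegrable φ ∧
    IsWeakSol a b ψ φ (slInv a b ψ φ) ∧
    ∀ v, IsWeakSol a b ψ φ v → v =ᵐ[volume] slInv a b ψ φ

/-- The coefficient `h³ / 3`. -/
noncomputable def cube3 (h : ℝ → ℝ) : ℝ → ℝ := fun x => (1 / 3) * h x ^ 3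

/-- `𝓛_h⁻¹ ψ`. -/
noncomputable def Linv (h ψ : ℝ → ℝ) : ℝ → ℝ := slInv h (cube3 h) ψ 0

/-- `𝓛_h⁻¹ ∂ₓ φ`. -/
noncomputable def LinvD (h φ : ℝ → ℝ) : ℝ → ℝ := slInv h (cube3 h) 0 φ

/-- `(g - γ ∂ₓ²)⁻¹ ψ`. -/
noncomputable def helmInv (g γ : ℝ) (ψ : ℝ → ℝ) : ℝ → ℝ :=
  slInv (fun _ => g) (fun _ => γ) ψ 0

/-- `T` induces an isomorphism of normed spaces from `H²(ℝ)` onto `L²(ℝ)`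
(functions modulo equality almost everywhere). -/
structure IsIsoH2L2 (T : (ℝ → ℝ) → ℝ → ℝ) : Prop where
  congr : ∀ u v, MemSob 2 2 u → u =ᵐ[volume] v → T u =ᵐ[volume] T v
  map_add : ∀ u v, MemSob 2 2 u → MemSob 2 2 v → T (u + v) =ᵐ[volume] T u + T v
  map_smul : ∀ (c : ℝ) (u), MemSob 2 2 u → T (c • u) =ᵐ[volume] c • T u
  mem : ∀ u, MemSob 2 2 u → MemLp (T u) 2 volume
  bound : ∃ K : ℝ≥0, ∀ u, MemSob 2 2 u → eLpNorm (T u) 2 volume ≤ K * sobNorm 2 2 u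
  injective : ∀ u, MemSob 2 2 u → T u =ᵐ[volume] 0 → u =ᵐ[volume] 0
  surjective : ∀ f, MemLp f 2 volume → ∃ u, MemSob 2 2 u ∧ T u =ᵐ[volume] f
  inv_bound : ∃ K : ℝ≥0, ∀ u, MemSob 2 2 u → sobNorm 2 2 u ≤ K * eLpNorm (T u) 2 volume

/-!
# Boundedness properties of the inverse of `𝓛_h u = h u - (h³ u')' / 3`

With `V = b u' + φ` the equation `a u - (b u')' = ψ + φ'` becomes the first order system
`u' = α V - α φ`, `V' = β u - ψ`, where `α = 1 / b` and `β = a`. For the coefficients at hand `α` and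
`β` are continuous with values in an interval `[l, L]`, `0 < l`, which depends only on the bounds for
`h` and `h⁻¹`. The system is symmetric under the exchange of `u` and `V`, so that every statement
about data in the second equation also treats data in the first one, that is data in divergence form.

*Existence.* In `H¹(ℝ)`, Lax–Milgram solves the system, and still does after the substitution
`(u, V) = E (p, q)` with the weight `E = 1 + ε² (x - x₀)²`, `ε ≤ l / 2`, since the logarithmic
derivative of `E` is bounded by `ε` (`exists_weighted_solution`). With `ε = 0` this gives solutions
for data in `L²` and, by `H¹ ⊆ L^∞`, in `L¹`, with `L²` and `L^∞` bounds for `u` and `V`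
(`IsSystemSol.exists_of_memLp`). With `ε = l / 2` it gives a bound for `u x₀` and `V x₀` by a weighted
norm of bounded data centred at `x₀`; the solution does not depend on `x₀` by uniqueness
(`IsSystemSol.exists_of_bounded`).

*Uniqueness.* If the data vanish, then `(e^{cx} u V)' = e^{cx} (α V² + β u² + c u V) ≥ 0` for
`|c| ≤ 2 l`. For solutions of polynomial growth, `c = -2 l` and `c = 2 l` give `u V ≤ 0` and `u V ≥ 0`,
hence `u V = 0` and `u = V = 0` (`IsSystemSol.unique`). In particular the bounded weak solution is the
one just constructed (`SystemCoeff.wellDefined`).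

*Estimates.* The derivatives of `u` are read off from the system: `u' = α (V - φ)`, and
`u'' = -3 (h' / h) u' + 3 h⁻³ (h u - ψ)` when `φ = 0`. This gives the bounds for data in `C_lim`, `L¹`
and `L²` (`DepthRep.clim_estimates`, `DepthRep.L1_estimates`, `DepthRep.L2_estimates`), and one more
differentiation those in `H³` (`DepthRep.sobNorm_three_le`). The limits at infinity follow by
comparison with the constant `l / hbar`: the difference solves the equation with data
`ψ - h l / hbar`, which tend to `0`, and the weighted bound tends to `0` by dominated convergence
(`DepthRep.linv_limits`).

All functions are handled through continuous representatives: `IsPrimitive F f` says that `F` is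
locally absolutely continuous with derivative `f`.
-/

/-! ### Primitives of locally integrable functions -/

/-- `F` is a primitive of the locally integrable function `f`: equivalently, `F` is locally
absolutely continuous with derivative `f` almost everywhere. -/
structure IsPrimitive (F f : ℝ → ℝ) : Prop where
  locInt : LocallyIntegrable f
  integral_eq : ∀ x y, ∫ t in x..y, f t = F y - F x

theorem locallyIntegrable_iff_intervalIntegrable {f : ℝ → ℝ} :
    LocallyIntegrable f ↔ ∀ a b, IntervalIntegrable f volume a b := by
  constructor
  · intro hf a b
    exact (hf.integrableOn_isCompact isCompact_uIcc).intervalIntegrable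
  · intro h x
    refine ⟨Set.Icc (x - 1) (x + 1), Icc_mem_nhds (by linarith) (by linarith), ?_⟩
    exact (intervalIntegrable_iff_integrableOn_Icc_of_le (by linarith)).1 (h (x - 1) (x + 1))

theorem MeasureTheory.LocallyIntegrable.interval {f : ℝ → ℝ} (hf : LocallyIntegrable f)
    (a b : ℝ) : IntervalIntegrable f volume a b :=
  locallyIntegrable_iff_intervalIntegrable.1 hf a b

namespace IsPrimitive

variable {F f G g : ℝ → ℝ}

theorem of_locallyIntegrable (hf : LocallyIntegrable f) (c a : ℝ) :
    IsPrimitive (fun x => c + ∫ t in a..x, f t) f := by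
  refine ⟨hf, fun x y => ?_⟩
  rw [← intervalIntegral.integral_interval_sub_left (hf.interval a y) (hf.interval a x)]
  ring

theorem eq_add (h : IsPrimitive F f) (a x : ℝ) : F x = F a + ∫ t in a..x, f t := by
  rw [h.integral_eq]; ring

theorem congr_right (h : IsPrimitive F f) (hg : f =ᵐ[volume] g) : IsPrimitive F g := by
  refine ⟨h.locInt.congr hg, fun x y => ?_⟩
  rw [← h.integral_eq x y]
  refine intervalIntegral.integral_congr_ae ?_
  filter_upwards [hg] with t ht _ using ht.symm

theorem add (hF : IsPrimitive F f) (hG : IsPrimitive G g) :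
    IsPrimitive (fun x => F x + G x) (fun x => f x + g x) := by
  refine ⟨hF.locInt.add hG.locInt, fun x y => ?_⟩
  rw [intervalIntegral.integral_add (hF.locInt.interval x y) (hG.locInt.interval x y),
    hF.integral_eq, hG.integral_eq]
  ring

theorem const_mul (c : ℝ) (hF : IsPrimitive F f) :
    IsPrimitive (fun x => c * F x) (fun x => c * f x) := by
  refine ⟨hF.locInt.smul c, fun x y => ?_⟩
  rw [intervalIntegral.integral_const_mul, hF.integral_eq]
  ring

theorem sub (hF : IsPrimitive F f) (hG : IsPrimitive G g) :
    IsPrimitive (fun x => F x - G x) (fun x => f x - g x) := by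
  refine ⟨hF.locInt.sub hG.locInt, fun x y => ?_⟩
  rw [intervalIntegral.integral_sub (hF.locInt.interval x y) (hG.locInt.interval x y),
    hF.integral_eq, hG.integral_eq]
  ring

theorem const (c : ℝ) : IsPrimitive (fun _ => c) (fun _ => 0) :=
  ⟨locallyIntegrable_const 0, fun x y => by simp⟩

theorem absolutelyContinuous (h : IsPrimitive F f) (a b : ℝ) :
    AbsolutelyContinuousOnInterval F a b := by
  have h1 := (h.locInt.interval a b).absolutelyContinuousOnInterval_intervalIntegral
    (c := a) (by simp)
  have h2 : AbsolutelyContinuousOnInterval (fun _ : ℝ => F a) a b :=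
    (contDiff_const.contDiffOn).absolutelyContinuousOnInterval
  have h3 := h2.add h1
  have : F = (fun _ => F a) + fun x => ∫ t in a..x, f t := by
    funext x; exact h.eq_add a x
  rwa [this]

theorem ae_hasDerivAt (h : IsPrimitive F f) : ∀ᵐ x, HasDerivAt F (f x) x := by
  filter_upwards [LocallyIntegrable.ae_hasDerivAt_integral h.locInt] with x hx
  have : F = fun x => F 0 + ∫ t in (0 : ℝ)..x, f t := by
    funext x; exact h.eq_add 0 x
  rw [this]
  exact (hx 0).const_add _

theorem of_absolutelyContinuous (hF : ∀ a b, AbsolutelyContinuousOnInterval F a b)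
    (hd : ∀ᵐ x, HasDerivAt F (f x) x) : IsPrimitive F f := by
  have hae : deriv F =ᵐ[volume] f := by filter_upwards [hd] with x hx using hx.deriv
  have hloc : LocallyIntegrable (deriv F) := locallyIntegrable_iff_intervalIntegrable.2
    fun a b => (hF a b).intervalIntegrable_deriv
  exact (IsPrimitive.mk hloc fun x y => (hF x y).integral_deriv_eq_sub).congr_right hae

theorem of_contDiff (h : ContDiff ℝ 1 F) : IsPrimitive F (deriv F) :=
  of_absolutelyContinuous (fun _ _ => h.contDiffOn.absolutelyContinuousOnInterval)
    (Eventually.of_forall fun x => (h.differentiable one_ne_zero x).hasDerivAt)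

theorem continuous (h : IsPrimitive F f) : Continuous F := by
  rw [continuous_iff_continuousAt]
  intro x
  have := (h.absolutelyContinuous (x - 1) (x + 1)).continuousOn
  rw [Set.uIcc_of_le (by linarith)] at this
  exact this.continuousAt (Icc_mem_nhds (by linarith) (by linarith))

theorem mul (hF : IsPrimitive F f) (hG : IsPrimitive G g) :
    IsPrimitive (fun x => F x * G x) (fun x => f x * G x + F x * g x) := by
  refine of_absolutelyContinuous
    (fun a b => (hF.absolutelyContinuous a b).mul (hG.absolutelyContinuous a b)) ?_
  filter_upwards [hF.ae_hasDerivAt, hG.ae_hasDerivAt] with x h1 h2 using h1.mul h2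

theorem inv {m : ℝ} (hm : 0 < m) (hF : IsPrimitive F f) (hFm : ∀ x, m ≤ F x) :
    IsPrimitive (fun x => (F x)⁻¹) (fun x => -f x / F x ^ 2) := by
  have hpos : ∀ x, 0 < F x := fun x => hm.trans_le (hFm x)
  refine of_absolutelyContinuous (fun a b => ?_) ?_
  · have hac := hF.absolutelyContinuous a b
    rw [absolutelyContinuousOnInterval_iff] at hac ⊢
    intro ε hε
    obtain ⟨δ, hδ, H⟩ := hac (m ^ 2 * ε) (by positivity)
    refine ⟨δ, hδ, fun E hE hEδ => ?_⟩
    have h1 := H E hE hEδ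
    -- inversion is Lipschitz with constant `m⁻²` on `[m, ∞)`
    have h2 : ∀ x y, dist (F x)⁻¹ (F y)⁻¹ ≤ (m ^ 2)⁻¹ * dist (F x) (F y) := by
      intro x y
      rw [dist_inv_inv₀ (hpos x).ne' (hpos y).ne', Real.norm_of_nonneg (hpos x).le,
        Real.norm_of_nonneg (hpos y).le, div_eq_inv_mul]
      have : m ^ 2 ≤ F x * F y := by nlinarith [hFm x, hFm y]
      gcongr
    calc _ ≤ ∑ i ∈ Finset.range E.1, (m ^ 2)⁻¹ * dist (F (E.2 i).1) (F (E.2 i).2) :=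
          Finset.sum_le_sum fun i _ => h2 _ _
      _ = (m ^ 2)⁻¹ * ∑ i ∈ Finset.range E.1, dist (F (E.2 i).1) (F (E.2 i).2) := by
          rw [Finset.mul_sum]
      _ < (m ^ 2)⁻¹ * (m ^ 2 * ε) := by gcongr
      _ = ε := by field_simp
  · filter_upwards [hF.ae_hasDerivAt] with x hx using hx.inv (hpos x).ne'

theorem pow (hF : IsPrimitive F f) (n : ℕ) :
    IsPrimitive (fun x => F x ^ n) (fun x => n * F x ^ (n - 1) * f x) := by
  refine of_absolutelyContinuous (fun a b => ?_) ?_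
  · induction n with
    | zero => simpa using (IsPrimitive.const 1).absolutelyContinuous a b
    | succ n ih =>
      have := ih.mul (hF.absolutelyContinuous a b)
      simp only [pow_succ]
      exact this
  · filter_upwards [hF.ae_hasDerivAt] with x hx using hx.pow n

theorem ae_unique (hF : IsPrimitive F f) (hG : IsPrimitive F g) : f =ᵐ[volume] g := by
  filter_upwards [hF.ae_hasDerivAt, hG.ae_hasDerivAt] with x h1 h2 using h1.unique h2

theorem monotone (h : IsPrimitive F f) (hf : ∀ᵐ x, 0 ≤ f x) : Monotone F := by
  intro x y hxy
  have : 0 ≤ ∫ t in x..y, f t := intervalIntegral.integral_nonneg_of_ae hxy hf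
  rw [h.integral_eq] at this
  linarith

end IsPrimitive

/-! ### Weak derivatives on the line -/

namespace IsTestFun

variable {θ η : ℝ → ℝ}

theorem contDiff_one (h : IsTestFun θ) : ContDiff ℝ 1 θ := h.1.of_le (by exact_mod_cast le_top)

theorem deriv (h : IsTestFun θ) : IsTestFun (deriv θ) :=
  ⟨(contDiff_infty_iff_deriv.1 h.1).2, h.2.deriv⟩

theorem continuous (h : IsTestFun θ) : Continuous θ := h.1.continuous

theorem integrable_mul (h : IsTestFun θ) {f : ℝ → ℝ} (hf : LocallyIntegrable f) :
    Integrable (fun x => f x * θ x) := by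
  simpa using hf.integrable_smul_right_of_hasCompactSupport h.continuous h.2

theorem memLp (h : IsTestFun θ) (p : ℝ≥0∞) : MemLp θ p volume :=
  h.continuous.memLp_of_hasCompactSupport h.2

theorem exists_bound_support (h : IsTestFun θ) : ∃ R > 0, ∀ x, R ≤ |x| → θ x = 0 := by
  obtain ⟨R, hR⟩ := h.2.isCompact.isBounded.subset_ball (0 : ℝ)
  refine ⟨max R 1, by positivity, fun x hx => ?_⟩
  by_contra hne
  have := hR (subset_tsupport _ hne)
  simp only [Metric.mem_ball, dist_zero_right, Real.norm_eq_abs] at this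
  exact absurd (le_max_left R 1) (by linarith)

theorem integral_eq_interval {f : ℝ → ℝ} {R : ℝ} (hR : 0 < R) (hf : ∀ x, R ≤ |x| → f x = 0) :
    ∫ x, f x = ∫ x in (-R)..R, f x := by
  rw [intervalIntegral.integral_of_le (by linarith), setIntegral_eq_integral_of_forall_compl_eq_zero]
  intro x hx
  apply hf
  by_contra hlt
  rw [not_le, abs_lt] at hlt
  exact hx ⟨hlt.1, hlt.2.le⟩

/-- A test function with vanishing integral is the derivative of a test function. -/
theorem exists_deriv_eq (h : IsTestFun η) (h0 : ∫ x, η x = 0) :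
    ∃ θ, IsTestFun θ ∧ _root_.deriv θ = η := by
  obtain ⟨R, hR, hη⟩ := h.exists_bound_support
  let θ : ℝ → ℝ := fun x => ∫ t in (-R)..x, η t
  have hd : ∀ x, HasDerivAt θ (η x) x := fun x =>
    intervalIntegral.integral_hasDerivAt_right (h.continuous.intervalIntegrable _ _)
      (h.continuous.stronglyMeasurableAtFilter _ _) h.continuous.continuousAt
  have hdθ : _root_.deriv θ = η := funext fun x => (hd x).deriv
  refine ⟨θ, ⟨?_, ?_⟩, hdθ⟩
  · rw [contDiff_infty_iff_deriv]
    exact ⟨fun x => (hd x).differentiableAt, hdθ ▸ h.1⟩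
  · refine HasCompactSupport.intro (isCompact_Icc (a := -R) (b := R)) fun x hx => ?_
    rw [Set.mem_Icc, not_and_or, not_le, not_le] at hx
    rcases hx with hx | hx
    · have : ∀ t ∈ Set.uIcc (-R) x, η t = 0 := fun t ht => by
        rw [Set.uIcc_of_ge hx.le] at ht
        exact hη t (by rw [abs_of_nonpos (by linarith [ht.2])]; linarith [ht.2])
      simp only [θ]
      rw [intervalIntegral.integral_congr (g := fun _ => (0 : ℝ)) this]
      simp
    · have h1 : ∫ t in R..x, η t = 0 := by
        have : ∀ t ∈ Set.uIcc R x, η t = 0 := fun t ht => by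
          rw [Set.uIcc_of_le hx.le] at ht
          exact hη t (by rw [abs_of_nonneg (by linarith [ht.1])]; exact ht.1)
        rw [intervalIntegral.integral_congr (g := fun _ => (0 : ℝ)) this]
        simp
      have h2 := intervalIntegral.integral_add_adjacent_intervals (μ := volume)
        (h.continuous.intervalIntegrable (-R) R) (h.continuous.intervalIntegrable R x)
      rw [h1, ← integral_eq_interval hR hη, h0] at h2
      simp only [θ]
      linarith

end IsTestFun

/-- The du Bois-Reymond lemma on the line. -/
theorem ae_eq_const_of_integral_mul_deriv_eq_zero {f : ℝ → ℝ} (hf : LocallyIntegrable f)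
    (h : ∀ θ, IsTestFun θ → ∫ x, f x * deriv θ x = 0) : ∃ c : ℝ, f =ᵐ[volume] fun _ => c := by
  let b : ContDiffBump (0 : ℝ) := ⟨1, 2, one_pos, one_lt_two⟩
  set θ₀ : ℝ → ℝ := b.normed volume with hθ₀
  have ht₀ : IsTestFun θ₀ := ⟨b.contDiff_normed, b.hasCompactSupport_normed⟩
  have hi₀ : ∫ x, θ₀ x = 1 := b.integral_normed
  refine ⟨∫ x, f x * θ₀ x, ?_⟩
  refine ae_eq_of_integral_contDiff_smul_eq hf (locallyIntegrable_const _) fun η h1 h2 => ?_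
  have hη : IsTestFun η := ⟨h1, h2⟩
  set I := ∫ x, η x with hI
  -- `η - (∫ η) θ₀` has vanishing integral, hence is a derivative
  have hζ : IsTestFun (fun x => η x - I * θ₀ x) :=
    ⟨h1.sub (contDiff_const.mul ht₀.1), h2.sub (ht₀.2.mul_left)⟩
  have hζ0 : ∫ x, (η x - I * θ₀ x) = 0 := by
    rw [integral_sub ((memLp_one_iff_integrable).1 (hη.memLp 1))
      (((memLp_one_iff_integrable).1 (ht₀.memLp 1)).const_mul _), integral_const_mul, hi₀]
    simp [hI]
  obtain ⟨θ, hθ, hdθ⟩ := hζ.exists_deriv_eq hζ0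
  have h3 := h θ hθ
  rw [hdθ] at h3
  have h4 : ∫ x, f x * (η x - I * θ₀ x) = (∫ x, f x * η x) - I * ∫ x, f x * θ₀ x := by
    rw [← integral_const_mul, ← integral_sub (hη.integrable_mul hf)
      ((ht₀.integrable_mul hf).const_mul _)]
    congr 1; funext x; ring
  have h5 : ∫ x, η x • f x = ∫ x, f x * η x := by
    congr 1; funext x; simp [mul_comm]
  have h6 : ∫ x, η x • (∫ x, f x * θ₀ x) = I * ∫ x, f x * θ₀ x := by
    simp only [smul_eq_mul]; rw [integral_mul_const]
  rw [h5, h6]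
  linarith

theorem IsPrimitive.hasWeakDeriv {F f : ℝ → ℝ} (h : IsPrimitive F f) : HasWeakDeriv F f := by
  refine ⟨h.continuous.locallyIntegrable, h.locInt, fun θ hθ => ?_⟩
  obtain ⟨R, hR, hθR⟩ := hθ.exists_bound_support
  obtain ⟨R', hR', hθR'⟩ := hθ.deriv.exists_bound_support
  have hM : 0 < max R R' := by positivity
  have h1 := (h.mul (IsPrimitive.of_contDiff hθ.contDiff_one)).integral_eq (-max R R') (max R R')
  rw [hθR _ (by rw [abs_of_pos hM]; exact le_max_left _ _),
    hθR _ (by rw [abs_neg, abs_of_pos hM]; exact le_max_left _ _),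
    ← IsTestFun.integral_eq_interval hM, integral_add] at h1
  · linarith
  · exact hθ.integrable_mul h.locInt
  · exact hθ.deriv.integrable_mul h.continuous.locallyIntegrable
  · intro x hx
    rw [hθR x ((le_max_left _ _).trans hx), hθR' x ((le_max_right _ _).trans hx)]
    ring

namespace HasWeakDeriv

variable {f g F G : ℝ → ℝ}

theorem congr (h : HasWeakDeriv f g) (hf : f =ᵐ[volume] F) (hg : g =ᵐ[volume] G) :
    HasWeakDeriv F G := by
  refine ⟨h.1.congr hf, h.2.1.congr hg, fun θ hθ => ?_⟩
  have h1 : ∫ x, F x * deriv θ x = ∫ x, f x * deriv θ x :=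
    integral_congr_ae (by filter_upwards [hf] with x hx; rw [hx])
  have h2 : ∫ x, G x * θ x = ∫ x, g x * θ x :=
    integral_congr_ae (by filter_upwards [hg] with x hx; rw [hx])
  rw [h1, h2, h.2.2 θ hθ]

theorem exists_isPrimitive (h : HasWeakDeriv f g) : ∃ F, F =ᵐ[volume] f ∧ IsPrimitive F g := by
  have hP := IsPrimitive.of_locallyIntegrable h.2.1 0 0
  set P : ℝ → ℝ := fun x => 0 + ∫ t in (0 : ℝ)..x, g t with hPdef
  obtain ⟨c, hc⟩ := ae_eq_const_of_integral_mul_deriv_eq_zero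
    (h.1.sub hP.continuous.locallyIntegrable) fun θ hθ => by
      have e : ∀ x, (f - P) x * deriv θ x = f x * deriv θ x - P x * deriv θ x := fun x => by
        simp [sub_mul]
      simp only [e]
      rw [integral_sub (hθ.deriv.integrable_mul h.1)
        (hθ.deriv.integrable_mul hP.continuous.locallyIntegrable), h.2.2 θ hθ,
        hP.hasWeakDeriv.2.2 θ hθ]
      simp
  refine ⟨fun x => c + P x, ?_, ?_⟩
  · filter_upwards [hc] with x hx
    simp only [Pi.sub_apply] at hx
    linarith
  · simpa using (IsPrimitive.const c).add hP

theorem ae_unique (hf : HasWeakDeriv f g) (hG : HasWeakDeriv f G) : g =ᵐ[volume] G := by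
  refine ae_eq_of_integral_contDiff_smul_eq hf.2.1 hG.2.1 fun η h1 h2 => ?_
  have e1 := hf.2.2 η ⟨h1, h2⟩
  have e2 := hG.2.2 η ⟨h1, h2⟩
  simp only [smul_eq_mul, mul_comm (η _)]
  linarith

theorem wderiv (h : HasWeakDeriv f g) : HasWeakDeriv f (wderiv f) := by
  have hex : ∃ g, HasWeakDeriv f g := ⟨g, h⟩
  rw [_root_.wderiv, dif_pos hex]
  exact Classical.choose_spec hex

theorem wderiv_ae (h : HasWeakDeriv f g) : _root_.wderiv f =ᵐ[volume] g :=
  h.wderiv.ae_unique h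

end HasWeakDeriv

theorem IsPrimitive.hasWeakDeriv_congr {F f u : ℝ → ℝ} (h : IsPrimitive F f)
    (hu : F =ᵐ[volume] u) : HasWeakDeriv u f := h.hasWeakDeriv.congr hu .rfl

theorem IsPrimitive.wderiv_ae {F f u : ℝ → ℝ} (h : IsPrimitive F f) (hu : F =ᵐ[volume] u) :
    wderiv u =ᵐ[volume] f := (h.hasWeakDeriv_congr hu).wderiv_ae

theorem hasWeakDeriv_congr_iff {f F : ℝ → ℝ} (h : f =ᵐ[volume] F) (g : ℝ → ℝ) :
    HasWeakDeriv f g ↔ HasWeakDeriv F g :=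
  ⟨fun H => H.congr h .rfl, fun H => H.congr h.symm .rfl⟩

/-- The weak derivative depends only on the class of the function modulo equality a.e., so that
the functions chosen by `wderiv` are the same. -/
theorem wderiv_congr {f F : ℝ → ℝ} (h : f =ᵐ[volume] F) : wderiv f = wderiv F := by
  have : HasWeakDeriv f = HasWeakDeriv F := funext fun g => propext (hasWeakDeriv_congr_iff h g)
  unfold wderiv
  rw [this]

/-! ### The space `H¹(ℝ)` and the Lax–Milgram theorem -/

/-- Multiplication by a bounded function as an operator on `L²(ℝ)`. -/
noncomputable def mulL2 (c : ℝ → ℝ) (hc : MemLp c ⊤ volume) :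
    Lp ℝ 2 (volume : Measure ℝ) →L[ℝ] Lp ℝ 2 (volume : Measure ℝ) :=
  (ContinuousLinearMap.mul ℝ ℝ).holderL volume ⊤ 2 2 (hc.toLp c)

theorem coeFn_mulL2 {c : ℝ → ℝ} (hc : MemLp c ⊤ volume) (f : Lp ℝ 2 (volume : Measure ℝ)) :
    mulL2 c hc f =ᵐ[volume] fun x => c x * f x := by
  have h1 := (ContinuousLinearMap.mul ℝ ℝ).coeFn_holder (r := 2) (hc.toLp c) f
  filter_upwards [h1, hc.coeFn_toLp] with x hx hc'
  rw [mulL2, ContinuousLinearMap.holderL_apply_apply, hx, hc']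
  rfl

theorem norm_mulL2_le {c : ℝ → ℝ} (hc : MemLp c ⊤ volume) {M : ℝ} (hM : ∀ x, |c x| ≤ M)
    (f : Lp ℝ 2 (volume : Measure ℝ)) : ‖mulL2 c hc f‖ ≤ M * ‖f‖ := by
  refine Lp.norm_le_mul_norm_of_ae_le_mul ?_
  filter_upwards [coeFn_mulL2 hc f] with x hx
  rw [hx, norm_mul]
  gcongr
  exact hM x

/-- The pairs `(f, f')` with `f, f' ∈ L²(ℝ)`, a model of `H¹(ℝ)`: the orthogonal complement in
`L² × L²` of the pairs `(θ', θ)` with `θ` a test function. -/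
noncomputable def sobolevH1 :
    Submodule ℝ (WithLp 2 (Lp ℝ 2 (volume : Measure ℝ) × Lp ℝ 2 (volume : Measure ℝ))) :=
  (Submodule.span ℝ {z | ∃ (θ : ℝ → ℝ) (h : IsTestFun θ),
    z = WithLp.toLp 2 ((h.deriv.memLp 2).toLp (deriv θ), (h.memLp 2).toLp θ)})ᗮ

theorem inner_L2 (f g : Lp ℝ 2 (volume : Measure ℝ)) : inner ℝ f g = ∫ x, f x * g x := by
  rw [L2.inner_def]
  congr 1; funext x
  simp [mul_comm]

theorem integrable_mul_L2 (f g : Lp ℝ 2 (volume : Measure ℝ)) :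
    Integrable (fun x => f x * g x) :=
  (Lp.memLp f).integrable_mul (Lp.memLp g)

theorem mem_sobolevH1_iff
    {x : WithLp 2 (Lp ℝ 2 (volume : Measure ℝ) × Lp ℝ 2 (volume : Measure ℝ))} :
    x ∈ sobolevH1 ↔ HasWeakDeriv x.fst x.snd := by
  have hl : ∀ f : Lp ℝ 2 (volume : Measure ℝ), LocallyIntegrable f := fun f =>
    (Lp.memLp f).locallyIntegrable (by norm_num)
  have key : ∀ (θ : ℝ → ℝ) (h : IsTestFun θ),
      inner ℝ (WithLp.toLp 2 ((h.deriv.memLp 2).toLp (deriv θ), (h.memLp 2).toLp θ)) x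
        = (∫ t, x.fst t * deriv θ t) + ∫ t, x.snd t * θ t := by
    intro θ h
    rw [WithLp.prod_inner_apply, inner_L2, inner_L2]
    congr 1
    · refine integral_congr_ae ?_
      filter_upwards [(h.deriv.memLp 2).coeFn_toLp] with t ht
      rw [ht]; exact mul_comm _ _
    · refine integral_congr_ae ?_
      filter_upwards [(h.memLp 2).coeFn_toLp] with t ht
      rw [ht]; exact mul_comm _ _
  constructor
  · intro hx
    refine ⟨hl _, hl _, fun θ h => ?_⟩
    have := (Submodule.mem_orthogonal _ _).1 hx _ (Submodule.subset_span ⟨θ, h, rfl⟩)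
    rw [key θ h] at this
    linarith
  · intro hx
    rw [sobolevH1, Submodule.mem_orthogonal]
    intro u hu
    induction hu using Submodule.span_induction with
    | mem z hz =>
      obtain ⟨θ, h, rfl⟩ := hz
      rw [key θ h, hx.2.2 θ h]; ring
    | zero => simp
    | add a b _ _ ha hb => rw [inner_add_left, ha, hb, add_zero]
    | smul c a _ ha => rw [inner_smul_left, ha, mul_zero]

instance : CompleteSpace sobolevH1 := by
  unfold sobolevH1; infer_instance

theorem memLp_top_of_continuous {c : ℝ → ℝ} (hc : Continuous c) {M : ℝ} (hM : ∀ x, |c x| ≤ M) :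
    MemLp c ⊤ volume :=
  memLp_top_of_bound hc.aestronglyMeasurable M (Eventually.of_forall hM)

/-- The space `H¹(ℝ)` as an abstract Hilbert space, with its two coordinates in `L²(ℝ)`. -/
theorem exists_hilbert_sobolevH1 :
    ∃ (V : Type) (_ : NormedAddCommGroup V) (_ : InnerProductSpace ℝ V) (_ : CompleteSpace V)
      (X1 X2 : V →L[ℝ] Lp ℝ 2 (volume : Measure ℝ)),
      (∀ v, ‖v‖ ^ 2 = ‖X1 v‖ ^ 2 + ‖X2 v‖ ^ 2) ∧ (∀ v, HasWeakDeriv (X1 v) (X2 v)) ∧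
      ∀ f g : Lp ℝ 2 (volume : Measure ℝ), HasWeakDeriv f g → ∃ w, X1 w = f ∧ X2 w = g := by
  refine ⟨sobolevH1, inferInstance, inferInstance, inferInstance,
    (WithLp.fstL 2 ℝ _ _).comp sobolevH1.subtypeL, (WithLp.sndL 2 ℝ _ _).comp sobolevH1.subtypeL,
    ?_, ?_, ?_⟩
  · intro v
    rw [Submodule.coe_norm, WithLp.prod_norm_sq_eq_of_L2]
    rfl
  · intro v
    exact mem_sobolevH1_iff.1 v.2
  · intro f g h
    exact ⟨⟨WithLp.toLp 2 (f, g), mem_sobolevH1_iff.2 h⟩, rfl, rfl⟩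

/-- Lax–Milgram for the first order system `p' = α q - σ p`, `q' = β p - σ q - g`, where `g` is a
bounded functional on `H¹(ℝ)`. For `σ = 0` it is the system of `β p - (α⁻¹ p')' = g`. If `E' = σ E`,
then `(E p, E q)` solves the system with `σ = 0` and data `E g`. -/
theorem exists_weighted_solution {l L : ℝ} (hl : 0 < l) (hlL : l ≤ L) :
    ∃ C > 0, ∀ α β σ g : ℝ → ℝ, Continuous α → Continuous β → Continuous σ →
      (∀ x, l ≤ α x) → (∀ x, α x ≤ L) → (∀ x, l ≤ β x) → (∀ x, β x ≤ L) →
      (∀ x, |σ x| ≤ l / 2) → LocallyIntegrable g →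
      ∀ N : ℝ, 0 ≤ N → (∀ P r, IsPrimitive P r → MemLp P 2 volume → MemLp r 2 volume →
        Integrable (fun x => g x * P x) ∧
        |∫ x, g x * P x| ≤ N * ((eLpNorm P 2 volume).toReal + (eLpNorm r 2 volume).toReal)) →
      ∃ p q, IsPrimitive p (fun x => α x * q x - σ x * p x) ∧
        IsPrimitive q (fun x => β x * p x - σ x * q x - g x) ∧
        MemLp p 2 volume ∧ MemLp q 2 volume ∧
        (eLpNorm p 2 volume).toReal ≤ C * N ∧ (eLpNorm q 2 volume).toReal ≤ C * N := by
  have hL : 0 < L := hl.trans_le hlL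
  set κ := min (l / 2) L⁻¹ with hκ
  have hκ0 : 0 < κ := by positivity
  refine ⟨2 / κ * (1 + l⁻¹ * (1 + l / 2)), by positivity, ?_⟩
  intro α β σ g cα cβ cσ hα1 hα2 hβ1 hβ2 hσ hg N hN hdual
  have hαp : ∀ x, 0 < α x := fun x => hl.trans_le (hα1 x)
  have hβt : MemLp β ⊤ volume := memLp_top_of_continuous cβ (M := L) fun x => by
    rw [abs_of_pos (hl.trans_le (hβ1 x))]; exact hβ2 x
  have hσt : MemLp σ ⊤ volume := memLp_top_of_continuous cσ hσ
  have cα' : Continuous fun x => (α x)⁻¹ := cα.inv₀ fun x => (hαp x).ne'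
  have hα' : ∀ x, |(α x)⁻¹| ≤ l⁻¹ := fun x => by
    rw [abs_of_pos (inv_pos.2 (hαp x))]
    exact inv_anti₀ hl (hα1 x)
  have hαt : MemLp (fun x => (α x)⁻¹) ⊤ volume := memLp_top_of_continuous cα' hα'
  obtain ⟨V, _, _, _, X1, X2, hnorm, hX, hmk⟩ := exists_hilbert_sobolevH1
  obtain ⟨Q, hQdef⟩ : ∃ Q : V →L[ℝ] Lp ℝ 2 (volume : Measure ℝ),
      ∀ v, Q v = mulL2 _ hαt (X2 v + mulL2 σ hσt (X1 v)) :=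
    ⟨(mulL2 _ hαt).comp (X2 + (mulL2 σ hσt).comp X1), fun _ => rfl⟩
  obtain ⟨B, hB⟩ : ∃ B : V →L[ℝ] V →L[ℝ] ℝ,
      ∀ v w, B v w = inner ℝ (mulL2 β hβt (X1 v)) (X1 w)
        + inner ℝ (Q v) (X2 w - mulL2 σ hσt (X1 w)) :=
    ⟨(innerSL ℝ).bilinearComp ((mulL2 β hβt).comp X1) X1
      + (innerSL ℝ).bilinearComp Q (X2 - (mulL2 σ hσt).comp X1), fun _ _ => rfl⟩
  have hQ : ∀ v, Q v =ᵐ[volume] fun x => (α x)⁻¹ * (X2 v x + σ x * X1 v x) := by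
    intro v
    filter_upwards [coeFn_mulL2 hαt (X2 v + mulL2 σ hσt (X1 v)), coeFn_mulL2 hσt (X1 v),
      Lp.coeFn_add (X2 v) (mulL2 σ hσt (X1 v))] with x h1 h2 h3
    rw [hQdef, h1, h3, Pi.add_apply, h2]
  have hBint : ∀ v w, B v w = ∫ x, (β x * X1 v x * X1 w x
      + Q v x * (X2 w x - σ x * X1 w x)) := by
    intro v w
    rw [hB, inner_L2, inner_L2, ← integral_add (integrable_mul_L2 _ _) (integrable_mul_L2 _ _)]
    refine integral_congr_ae ?_
    filter_upwards [coeFn_mulL2 hβt (X1 v), coeFn_mulL2 hσt (X1 w),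
      Lp.coeFn_sub (X2 w) (mulL2 σ hσt (X1 w))] with x h1 h2 h3
    rw [h1, h3, Pi.sub_apply, h2]
  have hsq : ∀ f : Lp ℝ 2 (volume : Measure ℝ), ‖f‖ ^ 2 = ∫ x, f x * f x := fun f => by
    rw [← inner_L2, real_inner_self_eq_norm_sq]
  have hcoer : ∀ v, κ * ‖v‖ * ‖v‖ ≤ B v v := by
    intro v
    have e : κ * ‖v‖ * ‖v‖ = ∫ x, κ * (X1 v x * X1 v x + X2 v x * X2 v x) := by
      rw [integral_const_mul, integral_add (integrable_mul_L2 _ _) (integrable_mul_L2 _ _),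
        ← hsq, ← hsq, ← hnorm]
      ring
    rw [e, hB, inner_L2, inner_L2, ← integral_add (integrable_mul_L2 _ _) (integrable_mul_L2 _ _)]
    refine integral_mono_ae (((integrable_mul_L2 _ _).add (integrable_mul_L2 _ _)).const_mul _)
      ((integrable_mul_L2 _ _).add (integrable_mul_L2 _ _)) ?_
    filter_upwards [coeFn_mulL2 hβt (X1 v), coeFn_mulL2 hσt (X1 v), hQ v,
      Lp.coeFn_sub (X2 v) (mulL2 σ hσt (X1 v))] with x h1 h2 h3 h4
    rw [h1, h3, h4, Pi.sub_apply, h2]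
    set a := X1 v x
    set b := X2 v x
    -- the cross terms in `σ` cancel on the diagonal
    have e1 : β x * a * a + (α x)⁻¹ * (b + σ x * a) * (b - σ x * a)
        = (β x - (α x)⁻¹ * σ x ^ 2) * a ^ 2 + (α x)⁻¹ * b ^ 2 := by ring
    have k1 : L⁻¹ ≤ (α x)⁻¹ := inv_anti₀ (hαp x) (hα2 x)
    have k2 : (α x)⁻¹ * σ x ^ 2 ≤ l / 2 := by
      have s2 : σ x ^ 2 ≤ (l / 2) ^ 2 := sq_le_sq' (by linarith [abs_le.1 (hσ x)])
        (abs_le.1 (hσ x)).2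
      calc (α x)⁻¹ * σ x ^ 2 ≤ l⁻¹ * (l / 2) ^ 2 := by
            gcongr
            exact hα1 x
        _ = l / 4 := by field_simp; norm_num
        _ ≤ l / 2 := by linarith
    have k3 : κ ≤ β x - (α x)⁻¹ * σ x ^ 2 := by
      have := hβ1 x
      have : κ ≤ l / 2 := min_le_left _ _
      linarith
    have k4 : κ ≤ (α x)⁻¹ := (min_le_right _ _).trans k1
    rw [e1]
    nlinarith [mul_le_mul_of_nonneg_right k3 (sq_nonneg a),
      mul_le_mul_of_nonneg_right k4 (sq_nonneg b)]
  have hBc : IsCoercive B := ⟨κ, hκ0, hcoer⟩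
  -- the right-hand side as a functional
  have hfun : ∀ w : V, Integrable (fun x => g x * X1 w x) ∧
      |∫ x, g x * X1 w x| ≤ N * (‖X1 w‖ + ‖X2 w‖) := by
    intro w
    obtain ⟨P, hP1, hP2⟩ := (hX w).exists_isPrimitive
    have d := hdual P (X2 w) hP2 ((memLp_congr_ae hP1).2 (Lp.memLp _)) (Lp.memLp _)
    have hae : (fun x => g x * P x) =ᵐ[volume] fun x => g x * X1 w x := by
      filter_upwards [hP1] with x hx; rw [hx]
    rw [integral_congr_ae hae, integrable_congr hae, eLpNorm_congr_ae hP1] at d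
    rwa [Lp.norm_def, Lp.norm_def]
  have hle : ∀ v : V, ‖X1 v‖ ≤ ‖v‖ ∧ ‖X2 v‖ ≤ ‖v‖ := by
    intro v
    have := hnorm v
    constructor
    · refine (sq_le_sq₀ (norm_nonneg _) (norm_nonneg v)).1 ?_
      rw [this]
      exact le_add_of_nonneg_right (sq_nonneg _)
    · refine (sq_le_sq₀ (norm_nonneg _) (norm_nonneg v)).1 ?_
      rw [this]
      exact le_add_of_nonneg_left (sq_nonneg _)
  let ℓ₀ : V →ₗ[ℝ] ℝ :=
    { toFun := fun w => ∫ x, g x * X1 w x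
      map_add' := fun v w => by
        rw [← integral_add (hfun v).1 (hfun w).1]
        refine integral_congr_ae ?_
        filter_upwards [Lp.coeFn_add (X1 v) (X1 w)] with x hx
        rw [map_add, hx, Pi.add_apply]; ring
      map_smul' := fun c w => by
        rw [RingHom.id_apply, smul_eq_mul, ← integral_const_mul]
        refine integral_congr_ae ?_
        filter_upwards [Lp.coeFn_smul c (X1 w)] with x hx
        rw [map_smul, hx, Pi.smul_apply, smul_eq_mul]; ring }
  have hℓ₀ : ∀ w, ‖ℓ₀ w‖ ≤ (2 * N) * ‖w‖ := fun w => by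
    refine (hfun w).2.trans ?_
    nlinarith [(hle w).1, (hle w).2]
  let ℓ : V →L[ℝ] ℝ := ℓ₀.mkContinuous (2 * N) hℓ₀
  let z := (InnerProductSpace.toDual ℝ V).symm ℓ
  let v := hBc.continuousLinearEquivOfBilin.symm z
  have hv : ∀ w, B v w = ∫ x, g x * X1 w x := fun w => by
    rw [← hBc.continuousLinearEquivOfBilin_apply, ContinuousLinearEquiv.apply_symm_apply,
      InnerProductSpace.toDual_symm_apply]
    rfl
  have hvn : ‖v‖ ≤ 2 / κ * N := by
    have h1 := hcoer v
    have h2 : B v v ≤ 2 * N * ‖v‖ := by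
      rw [hv]; exact (le_abs_self _).trans (hℓ₀ v)
    rcases (norm_nonneg v).eq_or_lt with h0 | h0
    · rw [← h0]; positivity
    · have : κ * ‖v‖ ≤ 2 * N := le_of_mul_le_mul_right (h1.trans h2) h0
      rw [div_mul_eq_mul_div, le_div_iff₀ hκ0]; linarith
  obtain ⟨p, hp1, hp2⟩ := (hX v).exists_isPrimitive
  have hli : ∀ f : Lp ℝ 2 (volume : Measure ℝ), LocallyIntegrable f := fun f =>
    (Lp.memLp f).locallyIntegrable (by norm_num)
  have hloc : LocallyIntegrable (fun x => β x * X1 v x - σ x * Q v x - g x) :=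
    (((hli _).continuous_mul cβ).sub ((hli _).continuous_mul cσ)).sub hg
  have hqw : HasWeakDeriv (Q v) (fun x => β x * X1 v x - σ x * Q v x - g x) := by
    refine ⟨hli _, hloc, fun θ hθ => ?_⟩
    obtain ⟨w, hw1, hw2⟩ := hmk ((hθ.memLp 2).toLp θ) ((hθ.deriv.memLp 2).toLp (deriv θ))
      ((IsPrimitive.of_contDiff hθ.contDiff_one).hasWeakDeriv.congr
        (hθ.memLp 2).coeFn_toLp.symm (hθ.deriv.memLp 2).coeFn_toLp.symm)
    replace hw1 : X1 w =ᵐ[volume] θ := hw1 ▸ (hθ.memLp 2).coeFn_toLp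
    replace hw2 : X2 w =ᵐ[volume] deriv θ := hw2 ▸ (hθ.deriv.memLp 2).coeFn_toLp
    have h1 := hv w
    have e1 : B v w = ∫ x, (β x * X1 v x * θ x + Q v x * (deriv θ x - σ x * θ x)) := by
      rw [hBint]
      refine integral_congr_ae ?_
      filter_upwards [hw1, hw2] with x h1 h2
      rw [h1, h2]
    have e2 : ∫ x, g x * X1 w x = ∫ x, g x * θ x := integral_congr_ae (by
      filter_upwards [hw1] with x h1; rw [h1])
    rw [e1, e2] at h1
    have i1 := hθ.deriv.integrable_mul (hli (Q v))
    have i2 := hθ.integrable_mul hloc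
    have i3 := hθ.integrable_mul hg
    have e3 : ∀ x, β x * X1 v x * θ x + Q v x * (deriv θ x - σ x * θ x)
        = (Q v x * deriv θ x + (β x * X1 v x - σ x * Q v x - g x) * θ x) + g x * θ x := by
      intro x; ring
    simp only [e3] at h1
    have i4 := integral_add (i1.add i2) i3
    have i5 := integral_add i1 i2
    simp only [Pi.add_apply] at i4
    rw [i4, i5] at h1
    linarith
  obtain ⟨q, hq1, hq2⟩ := hqw.exists_isPrimitive
  have hn1 : (eLpNorm p 2 volume).toReal ≤ 2 / κ * N := by
    rw [eLpNorm_congr_ae hp1, ← Lp.norm_def]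
    exact (hle v).1.trans hvn
  have hn2 : (eLpNorm q 2 volume).toReal ≤ l⁻¹ * (1 + l / 2) * (2 / κ * N) := by
    rw [eLpNorm_congr_ae hq1, ← Lp.norm_def]
    have h1 : ‖Q v‖ ≤ l⁻¹ * ‖X2 v + mulL2 σ hσt (X1 v)‖ := hQdef v ▸ norm_mulL2_le hαt hα' _
    have h2 : ‖mulL2 σ hσt (X1 v)‖ ≤ l / 2 * ‖X1 v‖ := norm_mulL2_le hσt hσ _
    calc ‖Q v‖ ≤ l⁻¹ * ‖X2 v + mulL2 σ hσt (X1 v)‖ := h1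
      _ ≤ l⁻¹ * (‖X2 v‖ + l / 2 * ‖X1 v‖) := by
          gcongr
          exact (norm_add_le _ _).trans (by gcongr)
      _ ≤ l⁻¹ * (2 / κ * N + l / 2 * (2 / κ * N)) := by
          gcongr
          · exact (hle v).2.trans hvn
          · exact (hle v).1.trans hvn
      _ = _ := by ring
  refine ⟨p, q, hp2.congr_right ?_, hq2.congr_right ?_, (memLp_congr_ae hp1).2 (Lp.memLp _),
    (memLp_congr_ae hq1).2 (Lp.memLp _), ?_, ?_⟩
  · filter_upwards [hq1, hQ v, hp1] with x h1 h2 h3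
    rw [h1, h2, h3, mul_inv_cancel_left₀ (hαp x).ne']
    ring
  · filter_upwards [hq1, hp1] with x h1 h3
    rw [h1, h3]
  · refine hn1.trans ?_
    have : 0 ≤ 2 / κ * N * (l⁻¹ * (1 + l / 2)) := by positivity
    nlinarith
  · refine hn2.trans ?_
    have : 0 ≤ 2 / κ * N := by positivity
    nlinarith

/-! ### Local `L^p` bounds and the sup norm -/

theorem toReal_eLpNorm_one {f : ℝ → ℝ} {μ : Measure ℝ} (hf : AEStronglyMeasurable f μ) :
    (eLpNorm f 1 μ).toReal = ∫ x, |f x| ∂μ := by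
  rw [eLpNorm_one_eq_lintegral_enorm, ← integral_norm_eq_lintegral_enorm hf]
  simp

/-- On intervals of unit length the `L¹` norm is bounded by any `L^p` norm. -/
theorem integral_abs_le_eLpNorm {f : ℝ → ℝ} {p : ℝ≥0∞} (hp : 1 ≤ p) (hf : MemLp f p volume)
    (x : ℝ) : ∫ t in x..x + 1, |f t| ≤ (eLpNorm f p volume).toReal := by
  rw [intervalIntegral.integral_of_le (by linarith),
    ← toReal_eLpNorm_one hf.aestronglyMeasurable.restrict]
  refine ENNReal.toReal_mono hf.eLpNorm_ne_top ?_
  have : IsProbabilityMeasure (volume.restrict (Set.Ioc x (x + 1))) :=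
    ⟨by simp⟩
  exact (eLpNorm_le_eLpNorm_of_exponent_le hp hf.aestronglyMeasurable.restrict).trans
    (eLpNorm_mono_measure f Measure.restrict_le_self)

theorem IsPrimitive.abs_le_integral {F f : ℝ → ℝ} (h : IsPrimitive F f) (x : ℝ) :
    |F x| ≤ (∫ t in x..x + 1, |F t|) + ∫ t in x..x + 1, |f t| := by
  have hx : x ≤ x + 1 := by linarith
  have h1 : ∀ y ∈ Set.Icc x (x + 1), |F x| ≤ |F y| + ∫ t in x..x + 1, |f t| := by
    intro y hy
    have e := h.integral_eq x y
    have i1 : |∫ t in x..y, f t| ≤ ∫ t in x..y, |f t| :=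
      intervalIntegral.abs_integral_le_integral_abs hy.1
    have i2 : ∫ t in x..y, |f t| ≤ ∫ t in x..x + 1, |f t| :=
      intervalIntegral.integral_mono_interval le_rfl hy.1 hy.2
        (Eventually.of_forall fun t => abs_nonneg _) (h.locInt.interval x (x + 1)).abs
    have : F x = F y - ∫ t in x..y, f t := by linarith
    rw [this]
    exact (abs_sub _ _).trans (by linarith)
  have h2 := intervalIntegral.integral_mono_on hx
    (intervalIntegrable_const (c := |F x|) (μ := volume))
    ((h.continuous.abs.intervalIntegrable x (x + 1)).add
      (intervalIntegrable_const (c := ∫ t in x..x + 1, |f t|))) h1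
  rw [intervalIntegral.integral_add (h.continuous.abs.intervalIntegrable x (x + 1))
    intervalIntegrable_const] at h2
  simpa using h2

theorem IsPrimitive.abs_le_eLpNorm {F f : ℝ → ℝ} (h : IsPrimitive F f) {p q : ℝ≥0∞}
    (hp : 1 ≤ p) (hq : 1 ≤ q) (hF : MemLp F p volume) (hf : MemLp f q volume) (x : ℝ) :
    |F x| ≤ (eLpNorm F p volume).toReal + (eLpNorm f q volume).toReal :=
  (h.abs_le_integral x).trans
    (add_le_add (integral_abs_le_eLpNorm hp hF x) (integral_abs_le_eLpNorm hq hf x))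

/-! ### The first order system and its uniqueness -/

/-- `U' = α V - f` and `V' = β U - g`. With `α = 1 / b`, `β = a`, `f = φ / b` and `g = ψ` this says
that `U` solves `a U - (b U')' = ψ + φ'` and that `V = b U' + φ`. The system is symmetric under the
exchange of `(U, α, f)` and `(V, β, g)`. -/
def IsSystemSol (α β f g U V : ℝ → ℝ) : Prop :=
  IsPrimitive U (fun x => α x * V x - f x) ∧ IsPrimitive V (fun x => β x * U x - g x)

namespace IsSystemSol

variable {α β f g U V f' g' U' V' : ℝ → ℝ} {l L K : ℝ}

theorem swap (h : IsSystemSol α β f g U V) : IsSystemSol β α g f V U := ⟨h.2, h.1⟩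

theorem sub (h : IsSystemSol α β f g U V) (h' : IsSystemSol α β f' g' U' V') :
    IsSystemSol α β (fun x => f x - f' x) (fun x => g x - g' x) (fun x => U x - U' x)
      (fun x => V x - V' x) := by
  refine ⟨?_, ?_⟩
  · convert! h.1.sub h'.1 using 2; ring
  · convert! h.2.sub h'.2 using 2; ring

/-- The derivative is `e^{cx} (α V² + β U² + c U V)`, and the quadratic form is nonnegative. -/
theorem monotone_exp_mul (hα : ∀ x, l ≤ α x) (hβ : ∀ x, l ≤ β x)
    (h : IsSystemSol α β 0 0 U V) {c : ℝ} (hc : |c| ≤ 2 * l) :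
    Monotone fun x => Real.exp (c * x) * (U x * V x) := by
  have hE : IsPrimitive (fun x => Real.exp (c * x)) (fun x => c * Real.exp (c * x)) := by
    have : ContDiff ℝ 1 fun x : ℝ => Real.exp (c * x) := by fun_prop
    refine (IsPrimitive.of_contDiff this).congr_right (Eventually.of_forall fun x => ?_)
    have := ((hasDerivAt_id x).const_mul c).exp.deriv
    simp only [id, mul_one] at this
    rw [this]; ring
  refine (hE.mul (h.1.mul h.2)).monotone (Eventually.of_forall fun x => ?_)
  have e : c * Real.exp (c * x) * (U x * V x) + Real.exp (c * x) *
      ((α x * V x - (0 : ℝ → ℝ) x) * V x + U x * (β x * U x - (0 : ℝ → ℝ) x))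
      = Real.exp (c * x) * (α x * V x ^ 2 + β x * U x ^ 2 + c * (U x * V x)) := by
    simp only [Pi.zero_apply]; ring
  rw [e]
  refine mul_nonneg (Real.exp_pos _).le ?_
  have h1 : l * V x ^ 2 ≤ α x * V x ^ 2 := mul_le_mul_of_nonneg_right (hα x) (sq_nonneg _)
  have h2 : l * U x ^ 2 ≤ β x * U x ^ 2 := mul_le_mul_of_nonneg_right (hβ x) (sq_nonneg _)
  obtain ⟨c1, c2⟩ := abs_le.1 hc
  nlinarith [mul_nonneg (by linarith : 0 ≤ 2 * l + c) (sq_nonneg (U x + V x)),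
    mul_nonneg (by linarith : 0 ≤ 2 * l - c) (sq_nonneg (U x - V x))]

theorem tendsto_exp_mul_zero {F : ℝ → ℝ} {c : ℝ} (hc : 0 < c) {n : ℕ}
    (hF : ∀ x, |F x| ≤ K * (1 + |x|) ^ n) :
    Tendsto (fun x => Real.exp (-c * x) * F x) atTop (𝓝 0) := by
  have h1 := (Real.tendsto_pow_mul_exp_neg_atTop_nhds_zero n).comp
    (tendsto_id.const_mul_atTop hc)
  have h2 : Tendsto (fun x => (K * (1 + x) ^ n) * Real.exp (-c * x)) atTop (𝓝 0) := by
    have h3 := (Real.tendsto_pow_mul_exp_neg_atTop_nhds_zero n).comp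
      ((tendsto_atTop_add_const_left atTop (1 : ℝ) tendsto_id).const_mul_atTop hc)
    have h4 := h3.const_mul (K * (c ^ n)⁻¹ * Real.exp c)
    rw [mul_zero] at h4
    refine h4.congr fun x => ?_
    simp only [Function.comp, id, mul_pow]
    have : Real.exp (-(c * (1 + x))) = Real.exp (-c * x) * (Real.exp c)⁻¹ := by
      rw [← Real.exp_neg, ← Real.exp_add]; ring_nf
    rw [this]
    have := (Real.exp_pos c).ne'
    field_simp
  refine squeeze_zero_norm' ?_ h2
  filter_upwards [eventually_ge_atTop 0] with x hx
  rw [norm_mul, Real.norm_of_nonneg (Real.exp_pos _).le, mul_comm]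
  refine mul_le_mul_of_nonneg_right ?_ (Real.exp_pos _).le
  have := hF x
  rwa [abs_of_nonneg hx] at this

/-- For a solution of the homogeneous system `e^{-2lx} U V` increases to `0` at `+∞`, and `e^{2lx} U V`
increases from `0` at `-∞`. Hence `U V = 0`, so that its derivative `α V² + β U²` vanishes too. -/
theorem eq_zero (hl : 0 < l) (hα : ∀ x, l ≤ α x) (hβ : ∀ x, l ≤ β x)
    (hβ2 : ∀ x, β x ≤ L) (h : IsSystemSol α β 0 0 U V) (hU : ∀ x, |U x| ≤ K * (1 + |x|) ^ 2) :
    ∀ x, U x = 0 ∧ V x = 0 := by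
  have hK : 0 ≤ K := by
    have := hU 0
    simp at this
    exact (abs_nonneg _).trans this
  have hL : 0 < L := hl.trans_le ((hβ 0).trans (hβ2 0))
  have hV : ∀ x, |V x| ≤ (|V 0| + L * K) * (1 + |x|) ^ 3 := by
    intro x
    have e := h.2.eq_add 0 x
    have h1 : |∫ t in (0 : ℝ)..x, (β t * U t - (0 : ℝ → ℝ) t)|
        ≤ L * (K * (1 + |x|) ^ 2) * |x - 0| := by
      rw [← Real.norm_eq_abs]
      refine intervalIntegral.norm_integral_le_of_norm_le_const fun t ht => ?_
      have ht' : |t| ≤ |x| := by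
        rcases le_total 0 x with hx | hx
        · rw [Set.uIoc_of_le hx] at ht
          rw [abs_of_pos ht.1, abs_of_nonneg hx]; exact ht.2
        · rw [Set.uIoc_of_ge hx] at ht
          rw [abs_of_nonpos ht.2, abs_of_nonpos hx]; linarith [ht.1]
      simp only [Pi.zero_apply, sub_zero, norm_mul, Real.norm_eq_abs]
      rw [abs_of_pos (hl.trans_le (hβ t))]
      gcongr
      · exact hβ2 t
      · refine (hU t).trans ?_
        gcongr
    rw [e]
    refine (abs_add_le _ _).trans ?_
    rw [sub_zero] at h1
    have h2 : |V 0| ≤ |V 0| * (1 + |x|) ^ 3 :=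
      le_mul_of_one_le_right (abs_nonneg _) (one_le_pow₀ (by linarith [abs_nonneg x]))
    have h3 : L * (K * (1 + |x|) ^ 2) * |x| ≤ L * K * (1 + |x|) ^ 3 := by
      have : L * K * (1 + |x|) ^ 3 - L * (K * (1 + |x|) ^ 2) * |x| = L * K * (1 + |x|) ^ 2 := by
        ring
      have : 0 ≤ L * K * (1 + |x|) ^ 2 := by positivity
      linarith
    linarith
  have hF : ∀ x, |U x * V x| ≤ (K * (|V 0| + L * K)) * (1 + |x|) ^ 5 := by
    intro x
    rw [abs_mul]
    calc |U x| * |V x| ≤ (K * (1 + |x|) ^ 2) * ((|V 0| + L * K) * (1 + |x|) ^ 3) := by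
          gcongr
          · exact hU x
          · exact hV x
      _ = _ := by ring
  have hneg : ∀ x, U x * V x ≤ 0 := by
    intro x
    have hm := h.monotone_exp_mul hα hβ (c := -(2 * l))
      (by rw [abs_neg, abs_of_pos (by linarith)])
    have ht := tendsto_exp_mul_zero (c := 2 * l) (by linarith) hF
    have := hm.ge_of_tendsto ht x
    exact nonpos_of_mul_nonpos_right this (Real.exp_pos _)
  have hpos : ∀ x, 0 ≤ U x * V x := by
    intro x
    have hm := h.monotone_exp_mul hα hβ (c := 2 * l) (by rw [abs_of_pos (by linarith)])
    have ht := tendsto_exp_mul_zero (c := 2 * l) (F := fun x => U (-x) * V (-x))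
      (by linarith) (fun x => by simpa using hF (-x))
    have ht' : Tendsto (fun x => Real.exp (2 * l * x) * (U x * V x)) atBot (𝓝 0) := by
      refine (ht.comp tendsto_neg_atBot_atTop).congr fun x => ?_
      simp
    have := hm.le_of_tendsto ht' x
    exact nonneg_of_mul_nonneg_right this (Real.exp_pos _)
  have h0 : ∀ x, U x * V x = 0 := fun x => le_antisymm (hneg x) (hpos x)
  have hd := (h.1.mul h.2).ae_unique (g := fun _ => 0)
    (by simp only [h0]; exact IsPrimitive.const 0)
  have hUV : ∀ᵐ x, U x = 0 ∧ V x = 0 := by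
    filter_upwards [hd] with x hx
    simp only [Pi.zero_apply] at hx
    have h1 : l * V x ^ 2 ≤ α x * V x ^ 2 := mul_le_mul_of_nonneg_right (hα x) (sq_nonneg _)
    have h2 : l * U x ^ 2 ≤ β x * U x ^ 2 := mul_le_mul_of_nonneg_right (hβ x) (sq_nonneg _)
    have h3 : 0 ≤ l * V x ^ 2 := by positivity
    have h4 : 0 ≤ l * U x ^ 2 := by positivity
    constructor
    · have : l * U x ^ 2 = 0 := by nlinarith
      simpa [hl.ne'] using this
    · have : l * V x ^ 2 = 0 := by nlinarith
      simpa [hl.ne'] using this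
  have hU0 : U = fun _ => 0 := (h.1.continuous.ae_eq_iff_eq volume continuous_const).1 (by
    filter_upwards [hUV] with x hx using hx.1)
  have hV0 : V = fun _ => 0 := (h.2.continuous.ae_eq_iff_eq volume continuous_const).1 (by
    filter_upwards [hUV] with x hx using hx.2)
  exact fun x => ⟨congrFun hU0 x, congrFun hV0 x⟩

/-- Solutions of at most quadratic growth are unique. -/
theorem unique (hl : 0 < l) (hα : ∀ x, l ≤ α x) (hβ : ∀ x, l ≤ β x)
    (hβ2 : ∀ x, β x ≤ L) (h : IsSystemSol α β f g U V) (h' : IsSystemSol α β f g U' V')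
    {K' : ℝ} (hU : ∀ x, |U x| ≤ K * (1 + |x|) ^ 2) (hU' : ∀ x, |U' x| ≤ K' * (1 + |x|) ^ 2) :
    U = U' ∧ V = V' := by
  have hs := h.sub h'
  simp only [sub_self] at hs
  have := eq_zero hl hα hβ hβ2 (K := K + K') hs fun x => by
    refine (abs_sub _ _).trans ?_
    rw [add_mul]
    exact add_le_add (hU x) (hU' x)
  exact ⟨funext fun x => sub_eq_zero.1 (this x).1, funext fun x => sub_eq_zero.1 (this x).2⟩

end IsSystemSol

/-! ### Existence of solutions of the first order system -/

theorem abs_integral_mul_le_eLpNorm {f g : ℝ → ℝ} {p q : ℝ≥0∞} [hpq : ENNReal.HolderConjugate p q]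
    (hf : MemLp f p volume) (hg : MemLp g q volume) :
    Integrable (fun x => f x * g x) ∧
      |∫ x, f x * g x| ≤ (eLpNorm f p volume).toReal * (eLpNorm g q volume).toReal := by
  have hi : Integrable (fun x => f x * g x) := hf.integrable_mul hg
  refine ⟨hi, ?_⟩
  have h1 : |∫ x, f x * g x| ≤ ∫ x, |f x * g x| := abs_integral_le_integral_abs
  rw [← toReal_eLpNorm_one hi.aestronglyMeasurable] at h1
  refine h1.trans ?_
  rw [← ENNReal.toReal_mul]
  refine ENNReal.toReal_mono (ENNReal.mul_ne_top hf.eLpNorm_ne_top hg.eLpNorm_ne_top) ?_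
  have h2 : eLpNorm (f • g) 1 volume ≤ eLpNorm f p volume * eLpNorm g q volume :=
    eLpNorm_smul_le_mul_eLpNorm hg.1 hf.1
  exact h2

/-- Solutions of the system with `f = 0` in the weighted space of the functions `U` with
`U / E ∈ L²`, where `E x = 1 + ε² (x - x₀)²`. For `ε ≠ 0` the pointwise bounds are useful near `x₀`. -/
theorem IsSystemSol.exists_weight {l L : ℝ} (hl : 0 < l) (hlL : l ≤ L) :
    ∃ C > 0, ∀ α β : ℝ → ℝ, Continuous α → Continuous β →
      (∀ x, l ≤ α x) → (∀ x, α x ≤ L) → (∀ x, l ≤ β x) → (∀ x, β x ≤ L) →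
      ∀ ε x₀ : ℝ, 0 ≤ ε → ε ≤ l / 2 → ∀ g : ℝ → ℝ, LocallyIntegrable g → ∀ N : ℝ, 0 ≤ N →
      (∀ P r, IsPrimitive P r → MemLp P 2 volume → MemLp r 2 volume →
        Integrable (fun x => g x / (1 + ε ^ 2 * (x - x₀) ^ 2) * P x) ∧
        |∫ x, g x / (1 + ε ^ 2 * (x - x₀) ^ 2) * P x|
          ≤ N * ((eLpNorm P 2 volume).toReal + (eLpNorm r 2 volume).toReal)) →
      ∃ U V, IsSystemSol α β 0 g U V ∧
        (∀ x, |U x| ≤ C * N * (1 + ε ^ 2 * (x - x₀) ^ 2)) ∧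
        (∀ x, |V x| ≤ (C * N + ∫ t in x..x + 1, |g t / (1 + ε ^ 2 * (t - x₀) ^ 2)|)
          * (1 + ε ^ 2 * (x - x₀) ^ 2)) ∧
        MemLp (fun x => U x / (1 + ε ^ 2 * (x - x₀) ^ 2)) 2 volume ∧
        MemLp (fun x => V x / (1 + ε ^ 2 * (x - x₀) ^ 2)) 2 volume ∧
        (eLpNorm (fun x => U x / (1 + ε ^ 2 * (x - x₀) ^ 2)) 2 volume).toReal ≤ C * N ∧
        (eLpNorm (fun x => V x / (1 + ε ^ 2 * (x - x₀) ^ 2)) 2 volume).toReal ≤ C * N := by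
  obtain ⟨C₀, hC₀, hex⟩ := exists_weighted_solution hl hlL
  have hL : 0 < L := hl.trans_le hlL
  refine ⟨C₀ * (1 + L + l / 2), by positivity, ?_⟩
  intro α β cα cβ hα1 hα2 hβ1 hβ2 ε x₀ hε0 hε g hg N hN hdual
  set E : ℝ → ℝ := fun x => 1 + ε ^ 2 * (x - x₀) ^ 2 with hE
  have hE0 : ∀ x, 0 < E x := fun x => by simp only [hE]; positivity
  have cE : ContDiff ℝ 1 E := by simp only [hE]; fun_prop
  have hdE : ∀ x, HasDerivAt E (2 * ε ^ 2 * (x - x₀)) x := fun x => by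
    have := ((((hasDerivAt_id x).sub_const x₀).pow 2).const_mul (ε ^ 2)).const_add 1
    convert! this using 1
    simp; ring
  have hEP : IsPrimitive E (fun x => 2 * ε ^ 2 * (x - x₀)) :=
    (IsPrimitive.of_contDiff cE).congr_right (Eventually.of_forall fun x => (hdE x).deriv)
  set σ : ℝ → ℝ := fun x => 2 * ε ^ 2 * (x - x₀) / E x with hσd
  have cσ : Continuous σ :=
    Continuous.div (by fun_prop) cE.continuous fun x => (hE0 x).ne'
  -- `|E'| ≤ ε E` because `2 |ε (x - x₀)| ≤ 1 + ε² (x - x₀)²`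
  have hσ : ∀ x, |σ x| ≤ l / 2 := fun x => by
    refine le_trans ?_ hε
    simp only [hσd]
    rw [abs_div, abs_of_pos (hE0 x), div_le_iff₀ (hE0 x)]
    simp only [hE]
    rw [abs_le]
    constructor <;> nlinarith [mul_nonneg hε0 (sq_nonneg (ε * (x - x₀) + 1)),
      mul_nonneg hε0 (sq_nonneg (ε * (x - x₀) - 1))]
  have hgE : LocallyIntegrable (fun x => g x / E x) := by
    simp only [div_eq_mul_inv]
    exact LocallyIntegrable.mul_continuous (cE.continuous.inv₀ fun x => (hE0 x).ne') hg
  obtain ⟨p, q, hp, hq, hp2, hq2, hpn, hqn⟩ :=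
    hex α β σ (fun x => g x / E x) cα cβ cσ hα1 hα2 hβ1 hβ2 hσ hgE N hN hdual
  have hpE : (fun x => E x * p x / E x) = p := by
    funext x; exact mul_div_cancel_left₀ _ (hE0 x).ne'
  have hqE : (fun x => E x * q x / E x) = q := by
    funext x; exact mul_div_cancel_left₀ _ (hE0 x).ne'
  have hIp := fun x => integral_abs_le_eLpNorm one_le_two hp2 x
  have hIq := fun x => integral_abs_le_eLpNorm one_le_two hq2 x
  have ip := fun x : ℝ => hp.continuous.abs.intervalIntegrable (μ := volume) x (x + 1)
  have iq := fun x : ℝ => hq.continuous.abs.intervalIntegrable (μ := volume) x (x + 1)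
  have hαa : ∀ x, |α x| ≤ L := fun x => by rw [abs_of_pos (hl.trans_le (hα1 x))]; exact hα2 x
  have hβa : ∀ x, |β x| ≤ L := fun x => by rw [abs_of_pos (hl.trans_le (hβ1 x))]; exact hβ2 x
  have hCN : 0 ≤ C₀ * N := by positivity
  -- the pointwise bounds come from the equations on an interval of unit length
  have hpx : ∀ x, |p x| ≤ C₀ * (1 + L + l / 2) * N := fun x => by
    have h1 := hp.abs_le_integral x
    have h2 : ∫ t in x..x + 1, |α t * q t - σ t * p t|
        ≤ ∫ t in x..x + 1, (L * |q t| + l / 2 * |p t|) := by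
      refine intervalIntegral.integral_mono_on (by linarith) (hp.locInt.interval _ _).abs
        (((iq x).const_mul L).add ((ip x).const_mul (l / 2))) fun t _ => ?_
      refine (abs_sub _ _).trans ?_
      rw [abs_mul, abs_mul]
      gcongr
      · exact hαa t
      · exact hσ t
    rw [intervalIntegral.integral_add ((iq x).const_mul L) ((ip x).const_mul (l / 2)),
      intervalIntegral.integral_const_mul, intervalIntegral.integral_const_mul] at h2
    have h3 := mul_le_mul_of_nonneg_left ((hIq x).trans hqn) hL.le
    have h4 := mul_le_mul_of_nonneg_left ((hIp x).trans hpn) (half_pos hl).le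
    have h5 := (hIp x).trans hpn
    linarith
  have hqx : ∀ x, |q x| ≤ C₀ * (1 + L + l / 2) * N + ∫ t in x..x + 1, |g t / E t| := fun x => by
    have h1 := hq.abs_le_integral x
    have ig := (hgE.interval x (x + 1)).abs
    have h2 : ∫ t in x..x + 1, |β t * p t - σ t * q t - g t / E t|
        ≤ ∫ t in x..x + 1, (L * |p t| + l / 2 * |q t| + |g t / E t|) := by
      refine intervalIntegral.integral_mono_on (by linarith) (hq.locInt.interval _ _).abs
        ((((ip x).const_mul L).add ((iq x).const_mul (l / 2))).add ig) fun t _ => ?_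
      refine (abs_sub _ _).trans (add_le_add_left ((abs_sub _ _).trans ?_) _)
      rw [abs_mul, abs_mul]
      gcongr
      · exact hβa t
      · exact hσ t
    rw [intervalIntegral.integral_add (((ip x).const_mul L).add ((iq x).const_mul (l / 2))) ig,
      intervalIntegral.integral_add ((ip x).const_mul L) ((iq x).const_mul (l / 2)),
      intervalIntegral.integral_const_mul, intervalIntegral.integral_const_mul] at h2
    have h3 := mul_le_mul_of_nonneg_left ((hIp x).trans hpn) hL.le
    have h4 := mul_le_mul_of_nonneg_left ((hIq x).trans hqn) (half_pos hl).le
    have h5 := (hIq x).trans hqn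
    linarith
  have hC1 : C₀ * N ≤ C₀ * (1 + L + l / 2) * N := by
    have : 0 ≤ C₀ * N * (L + l / 2) := by positivity
    linarith
  refine ⟨fun x => E x * p x, fun x => E x * q x, ⟨?_, ?_⟩, ?_, ?_, ?_, ?_, ?_, ?_⟩
  · refine (hEP.mul hp).congr_right (Eventually.of_forall fun x => ?_)
    have := (hE0 x).ne'
    simp only [hσd, Pi.zero_apply]
    field_simp
    ring
  · refine (hEP.mul hq).congr_right (Eventually.of_forall fun x => ?_)
    have := (hE0 x).ne'
    simp only [hσd]
    field_simp
    ring
  · intro x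
    rw [abs_mul, abs_of_pos (hE0 x), mul_comm]
    exact mul_le_mul_of_nonneg_right (hpx x) (hE0 x).le
  · intro x
    rw [abs_mul, abs_of_pos (hE0 x), mul_comm]
    exact mul_le_mul_of_nonneg_right (hqx x) (hE0 x).le
  · change MemLp (fun x => E x * p x / E x) 2 volume
    rwa [hpE]
  · change MemLp (fun x => E x * q x / E x) 2 volume
    rwa [hqE]
  · change (eLpNorm (fun x => E x * p x / E x) 2 volume).toReal ≤ _
    rw [hpE]; exact hpn.trans hC1
  · change (eLpNorm (fun x => E x * q x / E x) 2 volume).toReal ≤ _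
    rw [hqE]; exact hqn.trans hC1

/-- The solution of the system with `f = 0` for `g ∈ L¹` or `g ∈ L²`. -/
theorem IsSystemSol.exists_of_memLp {l L : ℝ} (hl : 0 < l) (hlL : l ≤ L) :
    ∃ C > 0, ∀ α β : ℝ → ℝ, Continuous α → Continuous β →
      (∀ x, l ≤ α x) → (∀ x, α x ≤ L) → (∀ x, l ≤ β x) → (∀ x, β x ≤ L) →
      ∀ p : ℝ≥0∞, (p = 1 ∨ p = 2) → ∀ g : ℝ → ℝ, MemLp g p volume →
      ∃ U V, IsSystemSol α β 0 g U V ∧ MemLp U 2 volume ∧ MemLp V 2 volume ∧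
        (eLpNorm U 2 volume).toReal ≤ C * (eLpNorm g p volume).toReal ∧
        (eLpNorm V 2 volume).toReal ≤ C * (eLpNorm g p volume).toReal ∧
        (∀ x, |U x| ≤ C * (eLpNorm g p volume).toReal) ∧
        ∀ x, |V x| ≤ C * (eLpNorm g p volume).toReal := by
  obtain ⟨C, hC, hex⟩ := IsSystemSol.exists_weight hl hlL
  refine ⟨C + 1, by positivity, ?_⟩
  intro α β cα cβ hα1 hα2 hβ1 hβ2 p hp g hg
  have hp1 : 1 ≤ p := by rcases hp with rfl | rfl <;> norm_num
  set N := (eLpNorm g p volume).toReal with hN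
  have hN0 : 0 ≤ N := ENNReal.toReal_nonneg
  obtain ⟨U, V, hUV, h1, h2, h3, h4, h5, h6⟩ := hex α β cα cβ hα1 hα2 hβ1 hβ2 0 0 le_rfl
    (by positivity) g (hg.locallyIntegrable hp1) N hN0 (by
      intro P r hP hP2 hr2
      simp only [ne_eq, OfNat.ofNat_ne_zero, not_false_eq_true, zero_pow, zero_mul, add_zero,
        div_one]
      rcases hp with rfl | rfl
      · have hb := hP.abs_le_eLpNorm one_le_two one_le_two hP2 hr2
        have hPt : MemLp P ⊤ volume := memLp_top_of_continuous hP.continuous hb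
        obtain ⟨k1, k2⟩ := abs_integral_mul_le_eLpNorm hg hPt
        refine ⟨k1, k2.trans ?_⟩
        gcongr
        refine ENNReal.toReal_le_of_le_ofReal (by positivity) ?_
        rw [eLpNorm_exponent_top]
        refine eLpNormEssSup_le_of_ae_bound (Eventually.of_forall hb)
      · obtain ⟨k1, k2⟩ := abs_integral_mul_le_eLpNorm hg hP2
        refine ⟨k1, k2.trans ?_⟩
        gcongr
        exact le_add_of_nonneg_right ENNReal.toReal_nonneg)
  simp only [ne_eq, OfNat.ofNat_ne_zero, not_false_eq_true, zero_pow, zero_mul, add_zero,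
    div_one, mul_one] at h1 h2 h3 h4 h5 h6
  refine ⟨U, V, hUV, h3, h4, h5.trans (by linarith), h6.trans (by linarith),
    fun x => (h1 x).trans (by linarith), fun x => (h2 x).trans ?_⟩
  have := integral_abs_le_eLpNorm hp1 hg x
  linarith

theorem memLp_inv_one_add_sq {ε : ℝ} (hε : 0 < ε) :
    MemLp (fun x : ℝ => 1 / (1 + ε ^ 2 * x ^ 2)) 2 volume := by
  have hc : Continuous fun x : ℝ => 1 / (1 + ε ^ 2 * x ^ 2) :=
    continuous_const.div (by fun_prop) fun x => by positivity
  rw [memLp_two_iff_integrable_sq hc.aestronglyMeasurable]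
  refine (integrable_inv_one_add_sq.comp_mul_left' hε.ne').mono'
    (hc.pow 2).aestronglyMeasurable (Eventually.of_forall fun x => ?_)
  rw [Real.norm_of_nonneg (by positivity), one_div, mul_pow, inv_pow]
  refine inv_anti₀ (by positivity) ?_
  exact le_self_pow₀ (by nlinarith [sq_nonneg (ε * x)]) two_ne_zero

/-- The solution of the system with `f = 0` for a bounded function `g`. Its value at a point depends
essentially on the values of `g` near that point only. -/
theorem IsSystemSol.exists_of_bounded {l L : ℝ} (hl : 0 < l) (hlL : l ≤ L) :
    ∃ C > 0, ∀ α β : ℝ → ℝ, Continuous α → Continuous β →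
      (∀ x, l ≤ α x) → (∀ x, α x ≤ L) → (∀ x, l ≤ β x) → (∀ x, β x ≤ L) →
      ∀ g : ℝ → ℝ, Continuous g → ∀ M : ℝ, (∀ x, |g x| ≤ M) →
      ∃ U V, IsSystemSol α β 0 g U V ∧ (∀ x, |U x| ≤ C * M) ∧ (∀ x, |V x| ≤ C * M) ∧
        ∀ x, |U x| ≤ C * (eLpNorm (fun y => g (y + x) * (1 / (1 + (l / 2) ^ 2 * y ^ 2)))
          2 volume).toReal := by
  obtain ⟨C, hC, hex⟩ := IsSystemSol.exists_weight hl hlL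
  set w : ℝ → ℝ := fun x => 1 / (1 + (l / 2) ^ 2 * x ^ 2) with hw
  have hw2 : MemLp w 2 volume := memLp_inv_one_add_sq (half_pos hl)
  set W := (eLpNorm w 2 volume).toReal with hW
  have hW0 : 0 ≤ W := ENNReal.toReal_nonneg
  refine ⟨C + C * W + 1, by positivity, ?_⟩
  intro α β cα cβ hα1 hα2 hβ1 hβ2 g cg M hM
  have hM0 : 0 ≤ M := (abs_nonneg _).trans (hM 0)
  -- the weighted norms of `g`
  have hgw : ∀ x₀, MemLp (fun y => g (y + x₀) * w y) 2 volume ∧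
      (eLpNorm (fun y => g (y + x₀) * w y) 2 volume).toReal ≤ M * W := by
    intro x₀
    have hle : ∀ y, ‖g (y + x₀) * w y‖ ≤ M * ‖w y‖ := fun y => by
      rw [norm_mul]; gcongr; exact hM _
    have hm : AEStronglyMeasurable (fun y => g (y + x₀) * w y) volume :=
      (by fun_prop : Continuous fun y => g (y + x₀)).aestronglyMeasurable.mul hw2.1
    refine ⟨hw2.of_le_mul hm (Eventually.of_forall hle), ?_⟩
    have h1 := eLpNorm_le_mul_eLpNorm_of_ae_le_mul (Eventually.of_forall hle) (2 : ℝ≥0∞)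
      (μ := volume)
    have h2 := ENNReal.toReal_mono (ENNReal.mul_ne_top ENNReal.ofReal_ne_top hw2.eLpNorm_ne_top) h1
    rwa [ENNReal.toReal_mul, ENNReal.toReal_ofReal hM0] at h2
  have htr : ∀ x₀, MemLp (fun x => g x / (1 + (l / 2) ^ 2 * (x - x₀) ^ 2)) 2 volume ∧
      eLpNorm (fun x => g x / (1 + (l / 2) ^ 2 * (x - x₀) ^ 2)) 2 volume
        = eLpNorm (fun y => g (y + x₀) * w y) 2 volume := by
    intro x₀
    have e : (fun x => g x / (1 + (l / 2) ^ 2 * (x - x₀) ^ 2))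
        = (fun y => g (y + x₀) * w y) ∘ fun x => x - x₀ := by
      funext x
      simp only [hw, Function.comp, sub_add_cancel]
      ring
    have mp := measurePreserving_sub_right (volume : Measure ℝ) x₀
    rw [e]
    exact ⟨(hgw x₀).1.comp_measurePreserving mp,
      eLpNorm_comp_measurePreserving (hgw x₀).1.1 mp⟩
  have hsol : ∀ x₀, ∃ U V, IsSystemSol α β 0 g U V ∧
      (∃ K, ∀ x, |U x| ≤ K * (1 + |x|) ^ 2) ∧
      |U x₀| ≤ C * (eLpNorm (fun y => g (y + x₀) * w y) 2 volume).toReal ∧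
      |V x₀| ≤ C * (M * W) + M := by
    intro x₀
    obtain ⟨U, V, hUV, h1, h2, -⟩ := hex α β cα cβ hα1 hα2 hβ1 hβ2 (l / 2) x₀ (by positivity)
      le_rfl g cg.locallyIntegrable _ ENNReal.toReal_nonneg (by
        intro P r hP hP2 hr2
        obtain ⟨k1, k2⟩ := abs_integral_mul_le_eLpNorm (htr x₀).1 hP2
        refine ⟨k1, k2.trans ?_⟩
        rw [(htr x₀).2]
        gcongr
        exact le_add_of_nonneg_right ENNReal.toReal_nonneg)
    set N := (eLpNorm (fun y => g (y + x₀) * w y) 2 volume).toReal with hN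
    have hN0 : 0 ≤ N := ENNReal.toReal_nonneg
    refine ⟨U, V, hUV, ⟨C * N * (1 + (l / 2) ^ 2 * (1 + |x₀|) ^ 2), fun x => (h1 x).trans ?_⟩,
      by simpa using h1 x₀, ?_⟩
    · rw [mul_assoc (C * N)]
      gcongr
      have h3 : |x - x₀| ≤ (1 + |x₀|) * (1 + |x|) := by
        refine (abs_sub _ _).trans ?_
        nlinarith [abs_nonneg x, abs_nonneg x₀, mul_nonneg (abs_nonneg x) (abs_nonneg x₀)]
      have h4 : (x - x₀) ^ 2 ≤ (1 + |x₀|) ^ 2 * (1 + |x|) ^ 2 := by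
        rw [← mul_pow, ← sq_abs]; gcongr
      have h5 : 1 ≤ (1 + |x|) ^ 2 := one_le_pow₀ (by linarith [abs_nonneg x])
      nlinarith [mul_le_mul_of_nonneg_left h4 (sq_nonneg (l / 2))]
    · have h3 := h2 x₀
      simp only [sub_self, ne_eq, OfNat.ofNat_ne_zero, not_false_eq_true, zero_pow, mul_zero,
        add_zero, mul_one] at h3
      have h4 : ∫ t in x₀..x₀ + 1, |g t / (1 + (l / 2) ^ 2 * (t - x₀) ^ 2)| ≤ M := by
        have h5 : ∀ t ∈ Set.uIoc x₀ (x₀ + 1),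
            ‖|g t / (1 + (l / 2) ^ 2 * (t - x₀) ^ 2)|‖ ≤ M := fun t _ => by
          have hp : 1 ≤ 1 + (l / 2) ^ 2 * (t - x₀) ^ 2 := by nlinarith [sq_nonneg (l / 2 * (t - x₀))]
          rw [norm_abs_eq_norm, norm_div, Real.norm_eq_abs,
            Real.norm_of_nonneg (by linarith)]
          exact (div_le_self (abs_nonneg _) hp).trans (hM t)
        have := intervalIntegral.norm_integral_le_of_norm_le_const h5
        simp only [add_sub_cancel_left, abs_one, mul_one] at this
        exact (le_abs_self _).trans this
      have h6 : C * N ≤ C * (M * W) := by gcongr; exact (hgw x₀).2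
      linarith
  -- the solutions centred at different points coincide
  obtain ⟨U, V, hUV, ⟨K, hK⟩, -⟩ := hsol 0
  have hall : ∀ x₀, |U x₀| ≤ C * (eLpNorm (fun y => g (y + x₀) * w y) 2 volume).toReal ∧
      |V x₀| ≤ C * (M * W) + M := by
    intro x₀
    obtain ⟨U', V', hUV', ⟨K', hK'⟩, hb⟩ := hsol x₀
    obtain ⟨rfl, rfl⟩ := hUV.unique hl hα1 hβ1 hβ2 hUV' hK hK'
    exact hb
  have hMW : 0 ≤ M * W := by positivity
  refine ⟨U, V, hUV, fun x => (hall x).1.trans ?_, fun x => (hall x).2.trans ?_,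
    fun x => (hall x).1.trans ?_⟩
  · have := mul_le_mul_of_nonneg_left (hgw x).2 hC.le
    have : 0 ≤ C * M := by positivity
    linarith
  · have : 0 ≤ C * M := by positivity
    linarith
  · gcongr
    have : 0 ≤ C * W := by positivity
    linarith

/-! ### Sobolev norms through primitives -/

theorem weakDiff_zero (f : ℝ → ℝ) : WeakDiff 0 f := fun _ hj => absurd hj (Nat.not_lt_zero _)

theorem weakDiff_succ_iff {k : ℕ} {f : ℝ → ℝ} :
    WeakDiff (k + 1) f ↔ HasWeakDeriv f (wderiv f) ∧ WeakDiff k (wderiv f) := by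
  constructor
  · intro h
    exact ⟨h 0 (Nat.succ_pos k), fun j hj => h (j + 1) (Nat.succ_lt_succ hj)⟩
  · rintro ⟨h0, h⟩ j hj
    cases j with
    | zero => exact h0
    | succ j => exact h j (Nat.lt_of_succ_lt_succ hj)

theorem weakDiff_congr {k : ℕ} {f g : ℝ → ℝ} (h : f =ᵐ[volume] g) :
    WeakDiff k f ↔ WeakDiff k g := by
  cases k with
  | zero => exact ⟨fun _ => weakDiff_zero g, fun _ => weakDiff_zero f⟩
  | succ k => rw [weakDiff_succ_iff, weakDiff_succ_iff, wderiv_congr h, hasWeakDeriv_congr_iff h]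

theorem sobNorm_zero (p : ℝ≥0∞) (f : ℝ → ℝ) : sobNorm 0 p f = eLpNorm f p volume := by
  rw [sobNorm, if_pos (weakDiff_zero f)]
  simp

theorem sobNorm_succ {k : ℕ} {p : ℝ≥0∞} {f : ℝ → ℝ} (h : HasWeakDeriv f (wderiv f)) :
    sobNorm (k + 1) p f = eLpNorm f p volume + sobNorm k p (wderiv f) := by
  unfold sobNorm
  by_cases hk : WeakDiff k (wderiv f)
  · rw [if_pos hk, if_pos (weakDiff_succ_iff.2 ⟨h, hk⟩), Finset.sum_range_succ' _ (k + 1), add_comm]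
    rfl
  · rw [if_neg hk, if_neg fun H => hk (weakDiff_succ_iff.1 H).2, add_top]

theorem sobNorm_congr {k : ℕ} {p : ℝ≥0∞} {f g : ℝ → ℝ} (h : f =ᵐ[volume] g) :
    sobNorm k p f = sobNorm k p g := by
  cases k with
  | zero => rw [sobNorm_zero, sobNorm_zero, eLpNorm_congr_ae h]
  | succ k =>
    by_cases hf : HasWeakDeriv f (wderiv f)
    · have hg : HasWeakDeriv g (wderiv g) := by
        rw [← wderiv_congr h]; exact (hasWeakDeriv_congr_iff h _).1 hf
      rw [sobNorm_succ hf, sobNorm_succ hg, wderiv_congr h, eLpNorm_congr_ae h]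
    · have hg : ¬ HasWeakDeriv g (wderiv g) := by
        rw [← wderiv_congr h]; exact fun H => hf ((hasWeakDeriv_congr_iff h _).2 H)
      unfold sobNorm
      rw [if_neg fun H => hf (weakDiff_succ_iff.1 H).1, if_neg fun H => hg (weakDiff_succ_iff.1 H).1]

namespace IsPrimitive

variable {U p q r u : ℝ → ℝ} {P : ℝ≥0∞}

theorem sobNorm_succ (h : IsPrimitive U p) (k : ℕ) :
    sobNorm (k + 1) P U = eLpNorm U P volume + sobNorm k P p := by
  rw [_root_.sobNorm_succ h.hasWeakDeriv.wderiv, sobNorm_congr (h.wderiv_ae .rfl)]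

theorem sobNorm_one (h : IsPrimitive U p) :
    sobNorm 1 P U = eLpNorm U P volume + eLpNorm p P volume := by
  rw [h.sobNorm_succ, sobNorm_zero]

theorem sobNorm_two (h : IsPrimitive U p) (h' : IsPrimitive p q) :
    sobNorm 2 P U = eLpNorm U P volume + (eLpNorm p P volume + eLpNorm q P volume) := by
  rw [h.sobNorm_succ, h'.sobNorm_one]

theorem sobNorm_three (h : IsPrimitive U p) (h' : IsPrimitive p q) (h'' : IsPrimitive q r) :
    sobNorm 3 P U = eLpNorm U P volume +
      (eLpNorm p P volume + (eLpNorm q P volume + eLpNorm r P volume)) := by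
  rw [h.sobNorm_succ, h'.sobNorm_two h'']

theorem weakDiff_succ_iff (h : IsPrimitive U p) (k : ℕ) : WeakDiff (k + 1) U ↔ WeakDiff k p := by
  rw [_root_.weakDiff_succ_iff, and_iff_right h.hasWeakDeriv.wderiv,
    weakDiff_congr (h.wderiv_ae .rfl)]

end IsPrimitive

theorem MemSob.exists_isPrimitive_succ {k : ℕ} {P : ℝ≥0∞} {f : ℝ → ℝ} (h : MemSob (k + 1) P f) :
    ∃ F f', F =ᵐ[volume] f ∧ IsPrimitive F f' ∧ MemLp F P volume ∧ MemSob k P f' ∧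
      sobNorm (k + 1) P f = eLpNorm F P volume + sobNorm k P f' := by
  have hw : WeakDiff (k + 1) f := by
    by_contra hn
    have := h.2
    rw [sobNorm, if_neg hn] at this
    exact lt_irrefl _ this
  have hd := (weakDiff_succ_iff.1 hw).1
  obtain ⟨F, hF, hP⟩ := hd.exists_isPrimitive
  have e : sobNorm (k + 1) P f = eLpNorm F P volume + sobNorm k P (wderiv f) := by
    rw [sobNorm_succ hd, eLpNorm_congr_ae hF]
  have hlt := h.2
  rw [e, ENNReal.add_lt_top] at hlt
  exact ⟨F, wderiv f, hF, hP, ⟨hP.continuous.aestronglyMeasurable, hlt.1⟩,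
    ⟨hd.2.1.aestronglyMeasurable, hlt.2⟩, e⟩

theorem MemSob.exists_one {P : ℝ≥0∞} {f : ℝ → ℝ} (h : MemSob 1 P f) :
    ∃ F f', F =ᵐ[volume] f ∧ IsPrimitive F f' ∧ MemLp F P volume ∧ MemLp f' P volume ∧
      sobNorm 1 P f = eLpNorm F P volume + eLpNorm f' P volume := by
  obtain ⟨F, f', h1, h2, h3, h4, h5⟩ := h.exists_isPrimitive_succ
  rw [sobNorm_zero] at h5
  exact ⟨F, f', h1, h2, h3, ⟨h4.1, by simpa [sobNorm_zero] using h4.2⟩, h5⟩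

theorem MemSob.exists_two {P : ℝ≥0∞} {f : ℝ → ℝ} (h : MemSob 2 P f) :
    ∃ F f' f'', F =ᵐ[volume] f ∧ IsPrimitive F f' ∧ IsPrimitive f' f'' ∧ MemLp F P volume ∧
      MemLp f' P volume ∧ MemLp f'' P volume ∧
      sobNorm 2 P f = eLpNorm F P volume + (eLpNorm f' P volume + eLpNorm f'' P volume) := by
  obtain ⟨F, f₁, h1, h2, h3, h4, h5⟩ := h.exists_isPrimitive_succ
  obtain ⟨f', f'', k1, k2, k3, k4, k5⟩ := h4.exists_one
  exact ⟨F, f', f'', h1, h2.congr_right k1.symm, k2, h3, k3, k4, by rw [h5, k5]⟩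

/-- A square integrable function is small somewhere on every set of infinite measure. -/
theorem exists_sq_lt {F : ℝ → ℝ} (hF : MemLp F 2 volume) {s : Set ℝ} (hs : MeasurableSet s)
    (hsv : volume s = ⊤) {ε : ℝ} (hε : 0 < ε) : ∃ y ∈ s, F y ^ 2 < ε := by
  by_contra! hcon
  have h1 : IntegrableOn (fun _ => ε) s := by
    refine Integrable.mono' (hF.integrable_sq.integrableOn (s := s)) (by fun_prop) ?_
    refine (ae_restrict_iff' hs).2 (Eventually.of_forall fun t ht => ?_)
    rw [Real.norm_of_nonneg hε.le]
    exact hcon t ht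
  rw [integrableOn_const_iff] at h1
  rcases h1 with h1 | h1
  · exact hε.ne' (by simpa using h1)
  · exact absurd hsv h1.ne

/-- The embedding of `H¹(ℝ)` into `L^∞(ℝ)` with its sharp constant. -/
theorem IsPrimitive.two_mul_abs_le {F f : ℝ → ℝ} (h : IsPrimitive F f) (hF : MemLp F 2 volume)
    (hf : MemLp f 2 volume) (x : ℝ) :
    2 * |F x| ≤ (eLpNorm F 2 volume).toReal + (eLpNorm f 2 volume).toReal := by
  set a := (eLpNorm F 2 volume).toReal
  set b := (eLpNorm f 2 volume).toReal
  have ha : 0 ≤ a := ENNReal.toReal_nonneg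
  have hb : 0 ≤ b := ENNReal.toReal_nonneg
  have hi : Integrable (fun t => |F t * f t|) := (hF.integrable_mul hf).abs
  have hab : ∫ t, |F t * f t| ≤ a * b := by
    have hi' : Integrable (fun t => F t * f t) := hF.integrable_mul hf
    rw [← toReal_eLpNorm_one hi'.aestronglyMeasurable, ← ENNReal.toReal_mul]
    refine ENNReal.toReal_mono (ENNReal.mul_ne_top hF.eLpNorm_ne_top hf.eLpNorm_ne_top) ?_
    have : eLpNorm (F • f) 1 volume ≤ eLpNorm F 2 volume * eLpNorm f 2 volume :=
      eLpNorm_smul_le_mul_eLpNorm hf.1 hF.1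
    exact this
  have hsq : F x ^ 2 ≤ a * b := by
    refine le_of_forall_pos_le_add fun ε hε => ?_
    obtain ⟨y, hy, hyε⟩ := exists_sq_lt hF measurableSet_Iic (Real.volume_Iic (a := x)) hε
    obtain ⟨z, hz, hzε⟩ := exists_sq_lt hF measurableSet_Ici (Real.volume_Ici (a := x)) hε
    have hP := h.mul h
    have e1 := hP.integral_eq y x
    have e2 := hP.integral_eq x z
    have hI : ∀ s t, IntervalIntegrable (fun t => |F t * f t|) volume s t := fun s t =>
      hi.intervalIntegrable
    have i0 : ∀ s t, s ≤ t → |∫ t in s..t, (f t * F t + F t * f t)|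
        ≤ 2 * ∫ t in s..t, |F t * f t| := by
      intro s t hst
      refine (intervalIntegral.abs_integral_le_integral_abs hst).trans ?_
      rw [← intervalIntegral.integral_const_mul]
      refine intervalIntegral.integral_mono_on hst (hP.locInt.interval _ _).abs
        ((hI s t).const_mul 2) fun r _ => ?_
      rw [mul_comm (f r), ← two_mul, abs_mul, abs_two]
    have i1 := i0 y x hy
    have i2 := i0 x z hz
    have i3 := intervalIntegral.integral_add_adjacent_intervals (hI y x) (hI x z)
    have i4 : ∫ t in y..z, |F t * f t| ≤ ∫ t, |F t * f t| := by
      rw [intervalIntegral.integral_of_le (le_trans hy hz)]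
      exact setIntegral_le_integral hi (Eventually.of_forall fun t => abs_nonneg _)
    rw [e1] at i1
    rw [e2] at i2
    have i5 := (abs_le.1 i1).2
    have i6 := (abs_le.1 i2).1
    nlinarith
  have h4 : (2 * |F x|) ^ 2 ≤ (a + b) ^ 2 := by
    rw [mul_pow, sq_abs]
    nlinarith [sq_nonneg (a - b)]
  exact (sq_le_sq₀ (by positivity) (by positivity)).1 h4

theorem eLpNorm_top_le_of_forall {F : ℝ → ℝ} {M : ℝ} (h : ∀ x, |F x| ≤ M) :
    eLpNorm F ⊤ volume ≤ ENNReal.ofReal M := by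
  rw [eLpNorm_exponent_top]
  exact eLpNormEssSup_le_of_ae_bound (Eventually.of_forall h)

theorem IsPrimitive.two_mul_eLpNorm_top_le {F f : ℝ → ℝ} (h : IsPrimitive F f)
    (hF : MemLp F 2 volume) (hf : MemLp f 2 volume) :
    2 * eLpNorm F ⊤ volume ≤ eLpNorm F 2 volume + eLpNorm f 2 volume := by
  have h1 := eLpNorm_top_le_of_forall (F := F)
    (M := ((eLpNorm F 2 volume).toReal + (eLpNorm f 2 volume).toReal) / 2)
    fun x => by linarith [h.two_mul_abs_le hF hf x]
  rw [← ENNReal.toReal_add hF.eLpNorm_ne_top hf.eLpNorm_ne_top] at h1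
  calc 2 * eLpNorm F ⊤ volume
      ≤ 2 * ENNReal.ofReal ((eLpNorm F 2 volume + eLpNorm f 2 volume).toReal / 2) := by gcongr
    _ = ENNReal.ofReal (eLpNorm F 2 volume + eLpNorm f 2 volume).toReal := by
        rw [show (2 : ℝ≥0∞) = ENNReal.ofReal 2 by simp, ← ENNReal.ofReal_mul (by norm_num)]
        congr 1; ring
    _ = _ := ENNReal.ofReal_toReal (ENNReal.add_ne_top.2 ⟨hF.eLpNorm_ne_top, hf.eLpNorm_ne_top⟩)

/-! ### Bounded weak solutions and the first order system -/

theorem Continuous.abs_le_of_ae {U : ℝ → ℝ} (hU : Continuous U) {K : ℝ}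
    (h : ∀ᵐ x, |U x| ≤ K) (x : ℝ) : |U x| ≤ K := by
  have : (fun x => max |U x| K) = fun _ => K :=
    ((hU.abs.max continuous_const).ae_eq_iff_eq volume continuous_const).1 (by
      filter_upwards [h] with x hx using max_eq_right hx)
  rw [← congrFun this x]
  exact le_max_left _ _

/-- The coefficients `a`, `b` agree a.e. with `β` and `1 / α`, where `α` and `β` are continuous
with values in `[l, L]`. -/
structure SystemCoeff (l L : ℝ) (a b α β : ℝ → ℝ) : Prop where
  pos : 0 < l
  contα : Continuous α
  contβ : Continuous β
  leα : ∀ x, l ≤ α x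
  αle : ∀ x, α x ≤ L
  leβ : ∀ x, l ≤ β x
  βle : ∀ x, β x ≤ L
  a_ae : a =ᵐ[volume] β
  b_ae : b =ᵐ[volume] fun x => (α x)⁻¹

namespace SystemCoeff

variable {l L : ℝ} {a b α β ψ φ u U V : ℝ → ℝ}

theorem exists_systemSol (hc : SystemCoeff l L a b α β)
    (hψ : LocallyIntegrable ψ) (hφ : LocallyIntegrable φ) (h : IsWeakSol a b ψ φ u) :
    ∃ U V, U =ᵐ[volume] u ∧ IsSystemSol α β (fun x => α x * φ x) ψ U V := by
  obtain ⟨-, hd, hint⟩ := h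
  have hαp : ∀ x, 0 < α x := fun x => hc.pos.trans_le (hc.leα x)
  have cα' : Continuous fun x => (α x)⁻¹ := hc.contα.inv₀ fun x => (hαp x).ne'
  have l1 : LocallyIntegrable (fun x => (α x)⁻¹ * wderiv u x) := hd.2.1.continuous_mul cα'
  have l2 : LocallyIntegrable (fun x => β x * u x) := hd.1.continuous_mul hc.contβ
  have hw : HasWeakDeriv (fun x => (α x)⁻¹ * wderiv u x + φ x) (fun x => β x * u x - ψ x) := by
    refine ⟨l1.add hφ, l2.sub hψ, fun θ hθ => ?_⟩
    have e := hint θ hθ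
    have e1 : ∫ x, (a x * u x * θ x + b x * wderiv u x * deriv θ x)
        = (∫ x, β x * u x * θ x) + ∫ x, (α x)⁻¹ * wderiv u x * deriv θ x := by
      rw [← integral_add (hθ.integrable_mul l2) (hθ.deriv.integrable_mul l1)]
      refine integral_congr_ae ?_
      filter_upwards [hc.a_ae, hc.b_ae] with x h1 h2
      rw [h1, h2]
    have e2 := integral_sub (hθ.integrable_mul hψ) (hθ.deriv.integrable_mul hφ)
    have e3 := integral_add (hθ.deriv.integrable_mul l1) (hθ.deriv.integrable_mul hφ)
    have e4 := integral_sub (hθ.integrable_mul l2) (hθ.integrable_mul hψ)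
    simp only [add_mul, sub_mul]
    rw [e1, e2] at e
    rw [e3, e4]
    linarith
  obtain ⟨U, hU, hUP⟩ := hd.exists_isPrimitive
  obtain ⟨V, hV, hVP⟩ := hw.exists_isPrimitive
  refine ⟨U, V, hU, hUP.congr_right ?_, hVP.congr_right ?_⟩
  · filter_upwards [hV] with x hx
    have := (hαp x).ne'
    rw [hx]
    field_simp
    ring
  · filter_upwards [hU] with x hx
    rw [hx]

theorem isWeakSol (hc : SystemCoeff l L a b α β)
    (hψ : LocallyIntegrable ψ) (hφ : LocallyIntegrable φ) {K : ℝ} (hK : ∀ x, |U x| ≤ K)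
    (h : IsSystemSol α β (fun x => α x * φ x) ψ U V) : IsWeakSol a b ψ φ U := by
  refine ⟨memLp_top_of_continuous h.1.continuous hK, h.1.hasWeakDeriv.wderiv, fun θ hθ => ?_⟩
  have hV := h.2.hasWeakDeriv.2.2 θ hθ
  have l2 : LocallyIntegrable (fun x => β x * U x) :=
    h.1.continuous.locallyIntegrable.continuous_mul hc.contβ
  have lV := h.2.continuous.locallyIntegrable (μ := volume)
  have e1 : ∫ x, (a x * U x * θ x + b x * wderiv U x * deriv θ x)
      = ∫ x, (β x * U x * θ x + (V x * deriv θ x - φ x * deriv θ x)) := by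
    refine integral_congr_ae ?_
    filter_upwards [hc.a_ae, hc.b_ae, h.1.wderiv_ae .rfl] with x h1 h2 h3
    have := (hc.pos.trans_le (hc.leα x)).ne'
    rw [h1, h2, h3]
    field_simp
  have e4 := integral_sub (hθ.integrable_mul l2) (hθ.integrable_mul hψ)
  have e5 := integral_sub (hθ.deriv.integrable_mul lV) (hθ.deriv.integrable_mul hφ)
  have e6 := integral_add (hθ.integrable_mul l2)
    ((hθ.deriv.integrable_mul lV).sub (hθ.deriv.integrable_mul hφ))
  simp only [Pi.sub_apply] at e6
  simp only [sub_mul] at hV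
  rw [e1, e6, integral_sub (hθ.integrable_mul hψ) (hθ.deriv.integrable_mul hφ), e5]
  linarith

/-- Bounded weak solutions are unique. -/
theorem ae_unique (hc : SystemCoeff l L a b α β)
    (hψ : LocallyIntegrable ψ) (hφ : LocallyIntegrable φ) {v : ℝ → ℝ}
    (h : IsWeakSol a b ψ φ u) (h' : IsWeakSol a b ψ φ v) : u =ᵐ[volume] v := by
  obtain ⟨U, V, hU, hUV⟩ := hc.exists_systemSol hψ hφ h
  obtain ⟨U', V', hU', hUV'⟩ := hc.exists_systemSol hψ hφ h'
  have key : ∀ {w W : ℝ → ℝ}, MemLp w ⊤ volume → W =ᵐ[volume] w → Continuous W →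
      ∃ K, ∀ x, |W x| ≤ K * (1 + |x|) ^ 2 := by
    intro w W hw hW cW
    refine ⟨(eLpNorm w ⊤ volume).toReal, fun x => ?_⟩
    have h1 : ∀ᵐ x, |W x| ≤ (eLpNorm w ⊤ volume).toReal := by
      filter_upwards [ae_le_eLpNormEssSup (f := w) (μ := volume), hW] with x hx hx'
      rw [hx', ← Real.norm_eq_abs, ← toReal_enorm]
      exact ENNReal.toReal_mono hw.eLpNorm_ne_top (by rwa [eLpNorm_exponent_top])
    refine (cW.abs_le_of_ae h1 x).trans ?_
    exact le_mul_of_one_le_right ENNReal.toReal_nonneg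
      (one_le_pow₀ (by linarith [abs_nonneg x]))
  obtain ⟨K, hK⟩ := key h.1 hU hUV.1.continuous
  obtain ⟨K', hK'⟩ := key h'.1 hU' hUV'.1.continuous
  obtain ⟨rfl, -⟩ := hUV.unique hc.pos hc.leα hc.leβ hc.βle hUV' hK hK'
  exact hU.symm.trans hU'

/-- A bounded solution of the system is the solution chosen by `slInv`. -/
theorem wellDefined (hc : SystemCoeff l L a b α β)
    (hψ : LocallyIntegrable ψ) (hφ : LocallyIntegrable φ) {K : ℝ} (hK : ∀ x, |U x| ≤ K)
    (h : IsSystemSol α β (fun x => α x * φ x) ψ U V) :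
    WellDefined a b ψ φ ∧ slInv a b ψ φ =ᵐ[volume] U := by
  have hU := hc.isWeakSol hψ hφ hK h
  have hex : ∃ u, IsWeakSol a b ψ φ u := ⟨U, hU⟩
  have hs : IsWeakSol a b ψ φ (slInv a b ψ φ) := by
    rw [slInv, dif_pos hex]
    exact Classical.choose_spec hex
  exact ⟨⟨hψ, hφ, hs, fun v hv => hc.ae_unique hψ hφ hv hs⟩, hc.ae_unique hψ hφ hs hU⟩

end SystemCoeff

/-! ### Depth profiles -/

theorem IsPrimitive.comp_neg {F f : ℝ → ℝ} (h : IsPrimitive F f) :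
    IsPrimitive (fun x => F (-x)) (fun x => -f (-x)) := by
  have hi : ∀ a b, IntervalIntegrable (fun x => f (-x)) volume a b := fun a b => by
    simpa using (h.locInt.interval (-a) (-b)).comp_mul_left (c := (-1 : ℝ))
  refine ⟨LocallyIntegrable.neg (locallyIntegrable_iff_intervalIntegrable.2 hi), fun x y => ?_⟩
  rw [intervalIntegral.integral_neg, intervalIntegral.integral_comp_neg, h.integral_eq]
  ring

/-- Functions of `H¹(ℝ)` vanish at infinity. -/
theorem IsPrimitive.tendsto_atTop_zero {F f : ℝ → ℝ} (h : IsPrimitive F f)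
    (hF : MemLp F 2 volume) (hf : MemLp f 2 volume) : Tendsto F atTop (𝓝 0) := by
  have hP := h.mul h
  have hi : Integrable (fun t => f t * F t + F t * f t) :=
    (hf.integrable_mul hF).add (hF.integrable_mul hf)
  have h1 := intervalIntegral_tendsto_integral_Ioi 0 hi.integrableOn tendsto_id
  have h2 : Tendsto (fun x => F x ^ 2) atTop
      (𝓝 (F 0 * F 0 + ∫ t in Set.Ioi (0 : ℝ), (f t * F t + F t * f t))) := by
    refine (h1.const_add (F 0 * F 0)).congr fun x => ?_
    rw [← hP.eq_add 0, sq]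
    rfl
  set c := F 0 * F 0 + ∫ t in Set.Ioi (0 : ℝ), (f t * F t + F t * f t)
  have hc0 : 0 ≤ c := ge_of_tendsto' h2 fun x => sq_nonneg _
  have hc : c = 0 := by
    by_contra hne
    have hpos : 0 < c / 2 := by positivity
    obtain ⟨R, hR⟩ := eventually_atTop.1 (h2.eventually (lt_mem_nhds (by linarith : c / 2 < c)))
    obtain ⟨y, hy, hlt⟩ := exists_sq_lt hF measurableSet_Ici (Real.volume_Ici (a := R)) hpos
    exact absurd (hR y hy) (not_lt.2 hlt.le)
  rw [hc] at h2
  have h3 := (Real.continuous_sqrt.tendsto 0).comp h2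
  rw [Real.sqrt_zero] at h3
  refine (tendsto_zero_iff_abs_tendsto_zero F).2 (h3.congr fun x => ?_)
  exact Real.sqrt_sq_eq_abs _

theorem IsPrimitive.tendsto_atBot_zero {F f : ℝ → ℝ} (h : IsPrimitive F f)
    (hF : MemLp F 2 volume) (hf : MemLp f 2 volume) : Tendsto F atBot (𝓝 0) := by
  have mp := Measure.measurePreserving_neg (volume : Measure ℝ)
  have := h.comp_neg.tendsto_atTop_zero (hF.comp_measurePreserving mp)
    (hf.comp_measurePreserving mp).neg
  refine (this.comp tendsto_neg_atBot_atTop).congr fun x => ?_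
  simp

/-- `H` is the continuous representative of the depth `h`, with weak derivative `H₁`, and takes
its values in `[1 / K, K]`. -/
structure DepthRep (K hbar : ℝ) (h H H₁ : ℝ → ℝ) : Prop where
  one_le : 1 ≤ K
  ae_eq : H =ᵐ[volume] h
  prim : IsPrimitive H H₁
  memLp_sub : MemLp (fun x => H x - hbar) 2 volume
  memLp_deriv : MemLp H₁ 2 volume
  lower : ∀ x, K⁻¹ ≤ H x
  upper : ∀ x, H x ≤ K

theorem ae_abs_le_of_eLpNorm_top_le {f : ℝ → ℝ} {A : ℝ≥0} (h : eLpNorm f ⊤ volume ≤ A) :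
    ∀ᵐ x, |f x| ≤ A := by
  rw [eLpNorm_exponent_top] at h
  filter_upwards [ae_le_eLpNormEssSup (f := f) (μ := volume)] with x hx
  have := hx.trans h
  rw [enorm_le_coe] at this
  exact_mod_cast this

theorem IsDepth.exists_depthRep {hbar : ℝ} {h : ℝ → ℝ} (hd : IsDepth hbar h) {A B : ℝ≥0}
    (hA : eLpNorm (fun x => (h x)⁻¹) ⊤ volume ≤ A) (hB : eLpNorm h ⊤ volume ≤ B) :
    ∃ H H₁, DepthRep (max (max A B) 1 : ℝ≥0) hbar h H H₁ := by
  obtain ⟨F, f, hF, hP, hF2, hf2, -⟩ := hd.sub_mem.exists_one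
  set K : ℝ≥0 := max (max A B) 1 with hK
  have hK1 : (1 : ℝ) ≤ K := by exact_mod_cast le_max_right (max A B) 1
  have hAK : (A : ℝ) ≤ K := by exact_mod_cast (le_max_left A B).trans (le_max_left _ 1)
  have hBK : (B : ℝ) ≤ K := by exact_mod_cast (le_max_right A B).trans (le_max_left _ 1)
  have hK0 : (0 : ℝ) < K := by linarith
  have hH : (fun x => F x + hbar) =ᵐ[volume] h := by
    filter_upwards [hF] with x hx
    rw [hx]; ring
  have hPH : IsPrimitive (fun x => F x + hbar) f := by
    simpa using hP.add (IsPrimitive.const hbar)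
  -- the bounds hold almost everywhere, hence everywhere by continuity
  have hmid : ∀ᵐ x, |F x + hbar - ((K : ℝ) + (K : ℝ)⁻¹) / 2| ≤ ((K : ℝ) - (K : ℝ)⁻¹) / 2 := by
    filter_upwards [hH, hd.pos, ae_abs_le_of_eLpNorm_top_le hA, ae_abs_le_of_eLpNorm_top_le hB]
      with x h1 h2 h3 h4
    rw [h1]
    rw [abs_of_pos (inv_pos.2 h2)] at h3
    rw [abs_of_pos h2] at h4
    have h5 : (K : ℝ)⁻¹ ≤ h x := inv_le_of_inv_le₀ h2 (h3.trans hAK)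
    rw [abs_le]
    constructor <;> linarith
  have hall := Continuous.abs_le_of_ae (hPH.continuous.sub continuous_const) hmid
  refine ⟨fun x => F x + hbar, f, hK1, hH, hPH, by simpa using hF2, hf2, fun x => ?_, fun x => ?_⟩
  · have := (abs_le.1 (hall x)).1
    simp only [Pi.sub_apply] at this
    linarith
  · have := (abs_le.1 (hall x)).2
    simp only [Pi.sub_apply] at this
    linarith

theorem IsDepth.exists_bounds {hbar : ℝ} {h : ℝ → ℝ} (hd : IsDepth hbar h) :
    ∃ A B : ℝ≥0, eLpNorm (fun x => (h x)⁻¹) ⊤ volume ≤ A ∧ eLpNorm h ⊤ volume ≤ B := by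
  obtain ⟨F, f, hF, hP, hF2, hf2, -⟩ := hd.sub_mem.exists_one
  have hb := hP.abs_le_eLpNorm one_le_two one_le_two hF2 hf2
  have hH : h =ᵐ[volume] fun x => F x + hbar := by
    filter_upwards [hF] with x hx
    rw [hx]; ring
  have ht : MemLp h ⊤ volume := (memLp_congr_ae hH).2 (memLp_top_of_continuous
    (hP.continuous.add continuous_const) fun x =>
      (abs_add_le (F x) hbar).trans (add_le_add_left (hb x) _))
  exact ⟨_, _, (ENNReal.coe_toNNReal hd.inv_mem.eLpNorm_ne_top).ge,
    (ENNReal.coe_toNNReal ht.eLpNorm_ne_top).ge⟩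

namespace DepthRep

variable {K hbar : ℝ} {h H H₁ : ℝ → ℝ}

theorem K_pos (d : DepthRep K hbar h H H₁) : 0 < K := one_pos.trans_le d.one_le

theorem pos (d : DepthRep K hbar h H H₁) (x : ℝ) : 0 < H x :=
  (inv_pos.2 d.K_pos).trans_le (d.lower x)

theorem inv_le (d : DepthRep K hbar h H H₁) (x : ℝ) : (H x)⁻¹ ≤ K :=
  inv_le_of_inv_le₀ d.K_pos (d.lower x)

theorem le_inv (d : DepthRep K hbar h H H₁) (x : ℝ) : K⁻¹ ≤ (H x)⁻¹ :=
  inv_anti₀ (d.pos x) (d.upper x)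

theorem continuous (d : DepthRep K hbar h H H₁) : Continuous H := d.prim.continuous

theorem prim_inv (d : DepthRep K hbar h H H₁) :
    IsPrimitive (fun x => (H x)⁻¹) (fun x => -H₁ x / H x ^ 2) :=
  d.prim.inv (inv_pos.2 d.K_pos) d.lower

theorem wderiv_ae (d : DepthRep K hbar h H H₁) : wderiv h =ᵐ[volume] H₁ := d.prim.wderiv_ae d.ae_eq

theorem eLpNorm_wderiv (d : DepthRep K hbar h H H₁) (p : ℝ≥0∞) :
    eLpNorm (wderiv h) p volume = eLpNorm H₁ p volume := eLpNorm_congr_ae d.wderiv_ae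

/-- `1 / b` for the coefficient `b = h³ / 3`. -/
theorem prim_coeff (d : DepthRep K hbar h H H₁) :
    IsPrimitive (fun x => 3 * (H x)⁻¹ ^ 3) (fun x => -9 * (H x)⁻¹ ^ 4 * H₁ x) := by
  refine ((d.prim_inv.pow 3).const_mul 3).congr_right (Eventually.of_forall fun x => ?_)
  have := (d.pos x).ne'
  push_cast
  field_simp
  ring

theorem systemCoeff (d : DepthRep K hbar h H H₁) :
    SystemCoeff (K ^ 3)⁻¹ (3 * K ^ 3) h (cube3 h) (fun x => 3 * (H x)⁻¹ ^ 3) H := by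
  have hK := d.K_pos
  have h1 : K ≤ K ^ 3 := le_self_pow₀ d.one_le (by norm_num)
  have h2 : (K ^ 3)⁻¹ ≤ K⁻¹ := inv_anti₀ hK h1
  have h3 : ∀ x, (K ^ 3)⁻¹ ≤ (H x)⁻¹ ^ 3 := fun x => by
    rw [← inv_pow]
    exact pow_le_pow_left₀ (inv_pos.2 hK).le (d.le_inv x) 3
  have h4 : ∀ x, (H x)⁻¹ ^ 3 ≤ K ^ 3 := fun x =>
    pow_le_pow_left₀ (inv_pos.2 (d.pos x)).le (d.inv_le x) 3
  have h5 : ∀ x, 0 < (H x)⁻¹ ^ 3 := fun x => by have := d.pos x; positivity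
  refine ⟨by positivity, d.prim_coeff.continuous, d.continuous, fun x => ?_, fun x => ?_,
    fun x => h2.trans (d.lower x), fun x => (d.upper x).trans ?_, d.ae_eq.symm, ?_⟩
  · linarith [h3 x, h5 x]
  · linarith [h4 x]
  · nlinarith
  · filter_upwards [d.ae_eq] with x hx
    have := (d.pos x).ne'
    simp only [cube3]
    rw [← hx]
    field_simp

theorem tendsto_atTop (d : DepthRep K hbar h H H₁) : Tendsto H atTop (𝓝 hbar) := by
  have hP : IsPrimitive (fun x => H x - hbar) H₁ := by
    simpa using d.prim.sub (IsPrimitive.const hbar)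
  simpa using (hP.tendsto_atTop_zero d.memLp_sub d.memLp_deriv).add_const hbar

theorem tendsto_atBot (d : DepthRep K hbar h H H₁) : Tendsto H atBot (𝓝 hbar) := by
  have hP : IsPrimitive (fun x => H x - hbar) H₁ := by
    simpa using d.prim.sub (IsPrimitive.const hbar)
  simpa using (hP.tendsto_atBot_zero d.memLp_sub d.memLp_deriv).add_const hbar

theorem hbar_pos (d : DepthRep K hbar h H H₁) : 0 < hbar :=
  (inv_pos.2 d.K_pos).trans_le (ge_of_tendsto' d.tendsto_atTop d.lower)

end DepthRep

theorem MemClim.exists_bound {ψ : ℝ → ℝ} (hψ : MemClim ψ) : ∃ M, ∀ x, |ψ x| ≤ M := by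
  obtain ⟨hc, ⟨l, hl⟩, ⟨r, hr⟩⟩ := hψ
  obtain ⟨a, ha⟩ := eventually_atBot.1 (hl.abs.eventually (gt_mem_nhds (lt_add_one |l|)))
  obtain ⟨b, hb⟩ := eventually_atTop.1 (hr.abs.eventually (gt_mem_nhds (lt_add_one |r|)))
  obtain ⟨M, hM⟩ := (isCompact_Icc (a := a) (b := b)).exists_bound_of_continuousOn hc.continuousOn
  refine ⟨max M (max (|l| + 1) (|r| + 1)), fun x => ?_⟩
  rcases le_total x a with h1 | h1
  · exact (ha x h1).le.trans ((le_max_left _ _).trans (le_max_right _ _))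
  · rcases le_total b x with h2 | h2
    · exact (hb x h2).le.trans ((le_max_right _ _).trans (le_max_right _ _))
    · exact (hM x ⟨h1, h2⟩).trans (le_max_left _ _)

/-- A continuous bounded function is bounded by its `L^∞` norm everywhere. -/
theorem MemClim.abs_le {ψ : ℝ → ℝ} (hψ : MemClim ψ) :
    MemLp ψ ⊤ volume ∧ ∀ x, |ψ x| ≤ (eLpNorm ψ ⊤ volume).toReal := by
  obtain ⟨M, hM⟩ := hψ.exists_bound
  have ht : MemLp ψ ⊤ volume := memLp_top_of_continuous hψ.1 hM
  refine ⟨ht, fun x => hψ.1.abs_le_of_ae ?_ x⟩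
  exact ae_abs_le_of_eLpNorm_top_le (A := (eLpNorm ψ ⊤ volume).toNNReal)
    (ENNReal.coe_toNNReal ht.eLpNorm_ne_top).ge

theorem isWeakSol_congr {a b ψ ψ' φ φ' : ℝ → ℝ} (hψ : ψ =ᵐ[volume] ψ') (hφ : φ =ᵐ[volume] φ') :
    IsWeakSol a b ψ φ = IsWeakSol a b ψ' φ' := by
  funext u
  unfold IsWeakSol
  have : ∀ θ : ℝ → ℝ, ∫ x, (ψ x * θ x - φ x * deriv θ x)
      = ∫ x, (ψ' x * θ x - φ' x * deriv θ x) := fun θ => integral_congr_ae (by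
    filter_upwards [hψ, hφ] with x h1 h2
    rw [h1, h2])
  simp only [this]

theorem slInv_congr {a b ψ ψ' φ φ' : ℝ → ℝ} (hψ : ψ =ᵐ[volume] ψ') (hφ : φ =ᵐ[volume] φ') :
    slInv a b ψ φ = slInv a b ψ' φ' := by
  unfold slInv
  rw [isWeakSol_congr hψ hφ]

/-! ### The operators `Linv` and `LinvD` through the system -/

/-- A pointwise bound by a multiple of a sum of absolute values passes to the `L^p` norms. -/
theorem eLpNorm_le_mul_sum {n : ℕ} {F : ℝ → ℝ} {G : Fin n → ℝ → ℝ} {p : ℝ≥0∞} (hp : 1 ≤ p)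
    (k : ℝ≥0) (hG : ∀ i, AEStronglyMeasurable (G i) volume)
    (h : ∀ᵐ x, |F x| ≤ k * ∑ i, |G i x|) :
    eLpNorm F p volume ≤ k * ∑ i, eLpNorm (G i) p volume := by
  have h1 : eLpNorm F p volume ≤ k * eLpNorm (∑ i, fun x => |G i x|) p volume := by
    refine (eLpNorm_le_nnreal_smul_eLpNorm_of_ae_le_mul (c := k) ?_ p).trans_eq
      (by rw [ENNReal.smul_def, smul_eq_mul])
    filter_upwards [h] with x hx
    rw [← NNReal.coe_le_coe]
    push_cast
    rw [Finset.sum_apply, Real.norm_eq_abs, Real.norm_of_nonneg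
      (Finset.sum_nonneg fun i _ => abs_nonneg _)]
    exact hx
  refine h1.trans ?_
  gcongr
  refine (eLpNorm_sum_le (fun i _ => (hG i).norm) hp).trans_eq ?_
  exact Finset.sum_congr rfl fun i _ => eLpNorm_norm (G i)

/-- The bounds satisfied by the solutions of the system with data of norm `N`. -/
structure SystemBound (C : ℝ≥0) (N : ℝ≥0∞) (U V : ℝ → ℝ) : Prop where
  memLp_U : MemLp U 2 volume
  memLp_V : MemLp V 2 volume
  norm_U : eLpNorm U 2 volume ≤ C * N
  norm_V : eLpNorm V 2 volume ≤ C * N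
  sup_U : ∀ x, |U x| ≤ C * N.toReal
  sup_V : ∀ x, |V x| ≤ C * N.toReal

namespace SystemBound

variable {C : ℝ≥0} {N : ℝ≥0∞} {U V : ℝ → ℝ}

theorem swap (h : SystemBound C N U V) : SystemBound C N V U :=
  ⟨h.memLp_V, h.memLp_U, h.norm_V, h.norm_U, h.sup_V, h.sup_U⟩

theorem eLpNorm_top_U (h : SystemBound C N U V) (hN : N ≠ ⊤) : eLpNorm U ⊤ volume ≤ C * N := by
  refine (eLpNorm_top_le_of_forall h.sup_U).trans_eq ?_
  rw [ENNReal.ofReal_mul (by positivity), ENNReal.ofReal_toReal hN, ENNReal.ofReal_coe_nnreal]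

theorem eLpNorm_top_V (h : SystemBound C N U V) (hN : N ≠ ⊤) : eLpNorm V ⊤ volume ≤ C * N :=
  h.swap.eLpNorm_top_U hN

theorem mono {C' : ℝ≥0} {N' : ℝ≥0∞} (h : SystemBound C N U V) (hN' : N' ≠ ⊤)
    (hle : C * N ≤ C' * N') : SystemBound C' N' U V := by
  have hr : C * N.toReal ≤ C' * N'.toReal := by
    have := ENNReal.toReal_mono (ENNReal.mul_ne_top ENNReal.coe_ne_top hN') hle
    simpa using this
  exact ⟨h.memLp_U, h.memLp_V, h.norm_U.trans hle, h.norm_V.trans hle,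
    fun x => (h.sup_U x).trans hr, fun x => (h.sup_V x).trans hr⟩

end SystemBound

/-- Existence for data in `L¹` or `L²` in either equation, with a constant which depends only on the
bounds for the coefficients. -/
theorem SystemCoeff.exists_bound (l L : ℝ) :
    ∃ C : ℝ≥0, 1 ≤ C ∧ ∀ a b α β : ℝ → ℝ, SystemCoeff l L a b α β →
      ∀ p : ℝ≥0∞, (p = 1 ∨ p = 2) → ∀ g : ℝ → ℝ, MemLp g p volume →
        (∃ U V, IsSystemSol α β 0 g U V ∧ SystemBound C (eLpNorm g p volume) U V) ∧
        (∃ U V, IsSystemSol α β g 0 U V ∧ SystemBound C (eLpNorm g p volume) U V) := by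
  by_cases hlL : 0 < l ∧ l ≤ L
  · obtain ⟨C, hC, hex⟩ := IsSystemSol.exists_of_memLp hlL.1 hlL.2
    have key : ∀ α β : ℝ → ℝ, Continuous α → Continuous β →
      (∀ x, l ≤ α x) → (∀ x, α x ≤ L) → (∀ x, l ≤ β x) → (∀ x, β x ≤ L) →
      ∀ p : ℝ≥0∞, (p = 1 ∨ p = 2) → ∀ g : ℝ → ℝ, MemLp g p volume →
      ∃ U V, IsSystemSol α β 0 g U V ∧
        SystemBound (max C.toNNReal 1) (eLpNorm g p volume) U V := by
      intro α β h1 h2 h3 h4 h5 h6 p hp g hg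
      obtain ⟨U, V, hs, hU, hV, k1, k2, k3, k4⟩ := hex α β h1 h2 h3 h4 h5 h6 p hp g hg
      have hCle : C ≤ (max C.toNNReal 1 : ℝ≥0) := by
        rw [NNReal.coe_max]
        exact (Real.le_coe_toNNReal C).trans (le_max_left _ _)
      have hle : C * (eLpNorm g p volume).toReal
          ≤ (max C.toNNReal 1 : ℝ≥0) * (eLpNorm g p volume).toReal := by gcongr
      have hen : ∀ W : ℝ → ℝ, MemLp W 2 volume →
          (eLpNorm W 2 volume).toReal ≤ C * (eLpNorm g p volume).toReal →
          eLpNorm W 2 volume ≤ (max C.toNNReal 1 : ℝ≥0) * eLpNorm g p volume := by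
        intro W hW h
        rw [← ENNReal.toReal_le_toReal hW.eLpNorm_ne_top
          (ENNReal.mul_ne_top ENNReal.coe_ne_top hg.eLpNorm_ne_top), ENNReal.toReal_mul]
        exact h.trans hle
      exact ⟨U, V, hs, hU, hV, hen U hU k1, hen V hV k2, fun x => (k3 x).trans hle,
        fun x => (k4 x).trans hle⟩
    refine ⟨max C.toNNReal 1, le_max_right _ _, fun a b α β hc p hp g hg => ⟨?_, ?_⟩⟩
    · exact key α β hc.contα hc.contβ hc.leα hc.αle hc.leβ hc.βle p hp g hg
    · obtain ⟨V, U, hs, hb⟩ :=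
        key β α hc.contβ hc.contα hc.leβ hc.βle hc.leα hc.αle p hp g hg
      exact ⟨U, V, hs.swap, hb.swap⟩
  -- otherwise there are no such coefficients
  · refine ⟨1, le_rfl, fun a b α β hc => ?_⟩
    exact absurd ⟨hc.pos, (hc.leα 0).trans (hc.αle 0)⟩ hlL

namespace DepthRep

variable {K : ℝ≥0} {hbar : ℝ} {h H H₁ : ℝ → ℝ}

theorem abs_coeff_le (d : DepthRep K hbar h H H₁) (x : ℝ) : |3 * (H x)⁻¹ ^ 3| ≤ 3 * (K : ℝ) ^ 3 := by
  have := inv_pos.2 (d.pos x)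
  rw [abs_of_pos (by positivity)]
  have := d.inv_le x
  gcongr

theorem memLp_coeff_mul (d : DepthRep K hbar h H H₁) {p : ℝ≥0∞} {φ : ℝ → ℝ}
    (hφ : MemLp φ p volume) :
    MemLp (fun x => 3 * (H x)⁻¹ ^ 3 * φ x) p volume ∧
      eLpNorm (fun x => 3 * (H x)⁻¹ ^ 3 * φ x) p volume ≤ (3 * K ^ 3 : ℝ≥0) * eLpNorm φ p volume := by
  have hle : ∀ x, ‖3 * (H x)⁻¹ ^ 3 * φ x‖ ≤ (3 * K ^ 3 : ℝ≥0) * ‖φ x‖ := fun x => by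
    rw [norm_mul]
    refine mul_le_mul_of_nonneg_right ?_ (norm_nonneg _)
    push_cast
    exact d.abs_coeff_le x
  refine ⟨hφ.of_le_mul (d.prim_coeff.continuous.aestronglyMeasurable.mul hφ.1)
    (Eventually.of_forall hle), ?_⟩
  have := eLpNorm_le_mul_eLpNorm_of_ae_le_mul (Eventually.of_forall hle) p (μ := volume)
  rwa [ENNReal.ofReal_coe_nnreal] at this

theorem linv_of_system (d : DepthRep K hbar h H H₁) {ψ U V : ℝ → ℝ} (hψ : LocallyIntegrable ψ)
    (hs : IsSystemSol (fun x => 3 * (H x)⁻¹ ^ 3) H 0 ψ U V) {M : ℝ} (hU : ∀ x, |U x| ≤ M) :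
    WellDefined h (cube3 h) ψ 0 ∧ Linv h ψ =ᵐ[volume] U :=
  d.systemCoeff.wellDefined hψ locallyIntegrable_zero hU (V := V) (by
    convert! hs using 1
    funext x; simp)

theorem linvD_of_system (d : DepthRep K hbar h H H₁) {φ U V : ℝ → ℝ} (hφ : LocallyIntegrable φ)
    (hs : IsSystemSol (fun x => 3 * (H x)⁻¹ ^ 3) H (fun x => 3 * (H x)⁻¹ ^ 3 * φ x) 0 U V)
    {M : ℝ} (hU : ∀ x, |U x| ≤ M) :
    WellDefined h (cube3 h) 0 φ ∧ LinvD h φ =ᵐ[volume] U :=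
  d.systemCoeff.wellDefined locallyIntegrable_zero hφ hU hs

/-- The bounded weak solutions `𝓛_h⁻¹ g` and `𝓛_h⁻¹ ∂ₓ g` for data in `L¹` or `L²`, with their
companions `V = h³ u' / 3` and `V = h³ u' / 3 + g`. -/
theorem exists_linv (K : ℝ≥0) :
    ∃ C : ℝ≥0, 1 ≤ C ∧ ∀ (hbar : ℝ) (h H H₁ : ℝ → ℝ), DepthRep K hbar h H H₁ →
      ∀ p : ℝ≥0∞, (p = 1 ∨ p = 2) → ∀ g : ℝ → ℝ, MemLp g p volume →
        (∃ U V, IsSystemSol (fun x => 3 * (H x)⁻¹ ^ 3) H 0 g U V ∧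
          SystemBound C (eLpNorm g p volume) U V ∧ WellDefined h (cube3 h) g 0 ∧
          Linv h g =ᵐ[volume] U) ∧
        (∃ U V, IsSystemSol (fun x => 3 * (H x)⁻¹ ^ 3) H (fun x => 3 * (H x)⁻¹ ^ 3 * g x) 0 U V ∧
          SystemBound C (eLpNorm g p volume) U V ∧ WellDefined h (cube3 h) 0 g ∧
          LinvD h g =ᵐ[volume] U) := by
  obtain ⟨C, hC, hex⟩ := SystemCoeff.exists_bound ((K : ℝ) ^ 3)⁻¹ (3 * (K : ℝ) ^ 3)
  refine ⟨C * (3 * K ^ 3) + C, hC.trans le_add_self, ?_⟩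
  intro hbar h H H₁ d p hp g hg
  have hp1 : 1 ≤ p := by rcases hp with rfl | rfl <;> norm_num
  have hloc := hg.locallyIntegrable hp1
  constructor
  · obtain ⟨U, V, hs, hb⟩ := (hex _ _ _ _ d.systemCoeff p hp g hg).1
    obtain ⟨k1, k2⟩ := d.linv_of_system hloc hs hb.sup_U
    refine ⟨U, V, hs, hb.mono hg.eLpNorm_ne_top ?_, k1, k2⟩
    gcongr
    exact_mod_cast le_add_self
  · obtain ⟨hm, hn⟩ := d.memLp_coeff_mul hg
    obtain ⟨U, V, hs, hb⟩ := (hex _ _ _ _ d.systemCoeff p hp _ hm).2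
    obtain ⟨k1, k2⟩ := d.linvD_of_system hloc hs hb.sup_U
    refine ⟨U, V, hs, hb.mono hg.eLpNorm_ne_top ?_, k1, k2⟩
    refine (mul_le_mul_right hn _).trans ?_
    rw [← mul_assoc]
    gcongr
    exact_mod_cast le_self_add

/-- The solution for bounded continuous data, and its bound by a weighted norm of the data. -/
theorem exists_linv_bounded (K : ℝ≥0) :
    ∃ C : ℝ≥0, 1 ≤ C ∧ ∀ (hbar : ℝ) (h H H₁ : ℝ → ℝ), DepthRep K hbar h H H₁ →
      ∀ g : ℝ → ℝ, Continuous g → ∀ M : ℝ, (∀ x, |g x| ≤ M) →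
      ∃ U V, IsSystemSol (fun x => 3 * (H x)⁻¹ ^ 3) H 0 g U V ∧ (∀ x, |U x| ≤ C * M) ∧
        (∀ x, |V x| ≤ C * M) ∧ WellDefined h (cube3 h) g 0 ∧ Linv h g =ᵐ[volume] U ∧
        ∀ x, |U x| ≤ C * (eLpNorm (fun y => g (y + x) *
          (1 / (1 + (((K : ℝ) ^ 3)⁻¹ / 2) ^ 2 * y ^ 2))) 2 volume).toReal := by
  by_cases hK : (1 : ℝ) ≤ K
  · have hK0 : (0 : ℝ) < K := by linarith
    have h1 : (1 : ℝ) ≤ (K : ℝ) ^ 3 := one_le_pow₀ hK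
    have h2 : ((K : ℝ) ^ 3)⁻¹ ≤ 3 * (K : ℝ) ^ 3 := by
      have := inv_le_one_of_one_le₀ h1
      linarith
    obtain ⟨C, hC, hex⟩ := IsSystemSol.exists_of_bounded (l := ((K : ℝ) ^ 3)⁻¹)
      (L := 3 * (K : ℝ) ^ 3) (by positivity) h2
    refine ⟨max C.toNNReal 1, le_max_right _ _, ?_⟩
    have hCle : C ≤ (max C.toNNReal 1 : ℝ≥0) := by
      rw [NNReal.coe_max]
      exact (Real.le_coe_toNNReal C).trans (le_max_left _ _)
    intro hbar h H H₁ d g cg M hM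
    have hM0 : 0 ≤ M := (abs_nonneg _).trans (hM 0)
    have hc := d.systemCoeff
    obtain ⟨U, V, hs, k1, k2, k3⟩ :=
      hex _ _ hc.contα hc.contβ hc.leα hc.αle hc.leβ hc.βle g cg M hM
    obtain ⟨e1, e2⟩ := d.linv_of_system cg.locallyIntegrable hs k1
    exact ⟨U, V, hs, fun x => (k1 x).trans (by gcongr), fun x => (k2 x).trans (by gcongr), e1, e2,
      fun x => (k3 x).trans (by gcongr)⟩
  · exact ⟨1, le_rfl, fun _ _ _ _ d => absurd d.one_le hK⟩

end DepthRep

/-! ### Estimates for the inverse operators -/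

theorem eLpNorm_mul_le_top {f g : ℝ → ℝ} {p : ℝ≥0∞} (hg : AEStronglyMeasurable g volume) :
    eLpNorm (fun x => f x * g x) p volume ≤ eLpNorm f ⊤ volume * eLpNorm g p volume :=
  eLpNorm_smul_le_eLpNorm_top_mul_eLpNorm p hg f

theorem ENNReal.self_le_one_add_sq (D : ℝ≥0∞) : D ≤ 1 + D ^ 2 := by
  rcases le_total D 1 with h | h
  · exact h.trans le_self_add
  · refine le_trans ?_ le_add_self
    rw [sq]
    exact le_mul_of_one_le_left' h

theorem ENNReal.coe_mul_le_coe_mul {a b : ℝ≥0} (hab : a ≤ b) (x : ℝ≥0∞) :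
    (a : ℝ≥0∞) * x ≤ b * x :=
  mul_le_mul' (ENNReal.coe_le_coe.2 hab) le_rfl

theorem enorm_le_of_abs_le {y z t : ℝ} {C : ℝ≥0} {N : ℝ≥0∞} (hN : N ≠ ⊤)
    (h : |y| ≤ C * ((1 + |z|) * N.toReal + |t|)) : ‖y‖ₑ ≤ C * ((1 + ‖z‖ₑ) * N + ‖t‖ₑ) := by
  rw [← ofReal_norm, ← ofReal_norm, ← ofReal_norm]
  refine (ENNReal.ofReal_le_ofReal h).trans_eq ?_
  rw [ENNReal.ofReal_mul (by positivity), ENNReal.ofReal_add (by positivity) (by positivity),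
    ENNReal.ofReal_mul (by positivity), ENNReal.ofReal_add (by positivity) (by positivity),
    ENNReal.ofReal_toReal hN, ENNReal.ofReal_coe_nnreal, ENNReal.ofReal_one]
  rfl

namespace DepthRep

variable {K : ℝ≥0} {hbar : ℝ} {h H H₁ : ℝ → ℝ}

theorem prim_first (_ : DepthRep K hbar h H H₁) {ψ U V : ℝ → ℝ}
    (hs : IsSystemSol (fun x => 3 * (H x)⁻¹ ^ 3) H 0 ψ U V) :
    IsPrimitive U (fun x => 3 * (H x)⁻¹ ^ 3 * V x) := by
  simpa using hs.1

/-- The second derivative of the solution `u` of `h u - (h³ u' / 3)' = ψ`. -/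
theorem prim_second (d : DepthRep K hbar h H H₁) {f ψ U V : ℝ → ℝ}
    (hs : IsSystemSol (fun x => 3 * (H x)⁻¹ ^ 3) H f ψ U V) :
    IsPrimitive (fun x => 3 * (H x)⁻¹ ^ 3 * V x)
      (fun x => -9 * (H x)⁻¹ ^ 4 * H₁ x * V x + 3 * (H x)⁻¹ ^ 3 * (H x * U x - ψ x)) :=
  d.prim_coeff.mul hs.2

theorem abs_second_le (d : DepthRep K hbar h H H₁) (x u v s : ℝ) :
    |-9 * (H x)⁻¹ ^ 4 * H₁ x * v + 3 * (H x)⁻¹ ^ 3 * (H x * u - s)|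
      ≤ 9 * (K : ℝ) ^ 4 * (|H₁ x| * |v|) + 3 * (K : ℝ) ^ 3 * (K * |u| + |s|) := by
  have hi := inv_pos.2 (d.pos x)
  have h1 := d.inv_le x
  refine (abs_add_le _ _).trans (add_le_add ?_ ?_)
  · have e : -9 * (H x)⁻¹ ^ 4 * H₁ x * v = -(9 * (H x)⁻¹ ^ 4 * (H₁ x * v)) := by ring
    rw [e, abs_neg, abs_mul, abs_mul (H₁ x), abs_of_pos (by positivity : 0 < 9 * (H x)⁻¹ ^ 4)]
    gcongr
  · rw [abs_mul]
    refine mul_le_mul (d.abs_coeff_le x) ?_ (abs_nonneg _) (by positivity)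
    refine (abs_sub _ _).trans ?_
    rw [abs_mul, abs_of_pos (d.pos x)]
    gcongr
    exact d.upper x

/-- Estimates for data in `C_lim`: `u` and `V = h³ u' / 3` are bounded by the data, and
`u'' = -3 (h' / h) u' + 3 h⁻³ (h u - ψ)`. -/
theorem clim_estimates (K : ℝ≥0) :
    ∃ C : ℝ≥0, 0 < C ∧ ∀ (hbar : ℝ) (h H H₁ : ℝ → ℝ), DepthRep K hbar h H H₁ →
      ∀ ψ, MemClim ψ →
        sobNorm 1 ⊤ (Linv h ψ) ≤ C * eLpNorm ψ ⊤ volume ∧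
        WeakDiff 2 (Linv h ψ) ∧
        ∀ᵐ x, ‖wderiv (wderiv (Linv h ψ)) x‖ₑ
          ≤ C * (1 + ‖wderiv h x‖ₑ) * eLpNorm ψ ⊤ volume := by
  obtain ⟨C, hC, hex⟩ := exists_linv_bounded K
  refine ⟨C + 3 * K ^ 3 * C + (9 * K ^ 4 * C + 3 * K ^ 3 * (K * C + 1)),
    lt_of_lt_of_le (zero_lt_one.trans_le hC) (by rw [add_assoc]; exact le_self_add), ?_⟩
  intro hbar h H H₁ d ψ hψ
  obtain ⟨hψt, hψM⟩ := hψ.abs_le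
  set N := eLpNorm ψ ⊤ volume with hN
  have hNt : N ≠ ⊤ := hψt.eLpNorm_ne_top
  obtain ⟨U, V, hs, hU, hV, -, hae, -⟩ := hex hbar h H H₁ d ψ hψ.1 _ hψM
  have p1 := d.prim_first hs
  have p2 := d.prim_second hs
  have hN0 : 0 ≤ N.toReal := ENNReal.toReal_nonneg
  refine ⟨?_, ?_, ?_⟩
  · rw [sobNorm_congr hae, p1.sobNorm_one]
    have h1 : eLpNorm U ⊤ volume ≤ C * N := by
      refine (eLpNorm_top_le_of_forall hU).trans_eq ?_
      rw [ENNReal.ofReal_mul (by positivity), ENNReal.ofReal_toReal hNt, ENNReal.ofReal_coe_nnreal]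
    have h2 : eLpNorm (fun x => 3 * (H x)⁻¹ ^ 3 * V x) ⊤ volume ≤ (3 * K ^ 3 * C : ℝ≥0) * N := by
      refine (eLpNorm_top_le_of_forall (M := (3 * K ^ 3 * C : ℝ≥0) * N.toReal) fun x => ?_).trans_eq
        ?_
      · rw [abs_mul]
        push_cast
        rw [mul_assoc (3 * (K : ℝ) ^ 3)]
        exact mul_le_mul (d.abs_coeff_le x) (hV x) (abs_nonneg _) (by positivity)
      · rw [ENNReal.ofReal_mul (by positivity), ENNReal.ofReal_toReal hNt,
          ENNReal.ofReal_coe_nnreal]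
    refine (add_le_add h1 h2).trans ?_
    rw [← add_mul, ← ENNReal.coe_add]
    exact ENNReal.coe_mul_le_coe_mul le_self_add _
  · rw [weakDiff_congr hae, p1.weakDiff_succ_iff, p2.weakDiff_succ_iff]
    exact weakDiff_zero _
  · have e1 : wderiv (wderiv (Linv h ψ)) =ᵐ[volume] _ := p2.wderiv_ae (p1.wderiv_ae hae.symm).symm
    filter_upwards [e1, d.wderiv_ae] with x hx hx'
    rw [hx, hx']
    have key := enorm_le_of_abs_le (z := H₁ x) (t := 0) (C := C + 3 * K ^ 3 * C +
      (9 * K ^ 4 * C + 3 * K ^ 3 * (K * C + 1))) hNt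
      (y := -9 * (H x)⁻¹ ^ 4 * H₁ x * V x + 3 * (H x)⁻¹ ^ 3 * (H x * U x - ψ x)) (by
        refine (d.abs_second_le x _ _ _).trans ?_
        have k1 : 9 * (K : ℝ) ^ 4 * (|H₁ x| * |V x|) ≤ 9 * (K : ℝ) ^ 4 * (|H₁ x| * (C * N.toReal)) := by
          gcongr
          exact hV x
        have k2 : 3 * (K : ℝ) ^ 3 * (K * |U x| + |ψ x|)
            ≤ 3 * (K : ℝ) ^ 3 * (K * (C * N.toReal) + N.toReal) := by
          gcongr
          · exact hU x
          · exact hψM x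
        refine (add_le_add k1 k2).trans ?_
        rw [abs_zero, add_zero]
        push_cast
        have z1 : 0 ≤ (C : ℝ) * (1 + |H₁ x|) * N.toReal := by positivity
        have z2 : 0 ≤ 3 * (K : ℝ) ^ 3 * C * (1 + |H₁ x|) * N.toReal := by positivity
        have z3 : 0 ≤ 9 * (K : ℝ) ^ 4 * C * N.toReal := by positivity
        have z4 : 0 ≤ 3 * (K : ℝ) ^ 3 * (K * C + 1) * (|H₁ x| * N.toReal) := by positivity
        linarith)
    rwa [enorm_zero, add_zero, ← mul_assoc] at key

/-- Estimates for data in `L¹`. The last one is not the best: the factor with `h'` is not needed. -/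
theorem L1_estimates (K : ℝ≥0) :
    ∃ C : ℝ≥0, 0 < C ∧ ∀ (hbar : ℝ) (h H H₁ : ℝ → ℝ), DepthRep K hbar h H H₁ →
      ∀ ψ, MemLp ψ 1 volume →
        sobNorm 1 2 (Linv h ψ) ≤ C * eLpNorm ψ 1 volume ∧
        eLpNorm (LinvD h ψ) ⊤ volume ≤ C * eLpNorm ψ 1 volume ∧
        eLpNorm (wderiv (LinvD h ψ)) ⊤ volume
          ≤ C * (eLpNorm ψ 1 volume + eLpNorm ψ ⊤ volume) ∧
        eLpNorm (LinvD h ψ) 2 volume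
          ≤ C * eLpNorm ψ 1 volume * (eLpNorm (wderiv h) 2 volume + 1) := by
  obtain ⟨C, hC, hex⟩ := exists_linv K
  refine ⟨C + 3 * K ^ 3 * C + 3 * K ^ 3,
    lt_of_lt_of_le (zero_lt_one.trans_le hC) (by rw [add_assoc]; exact le_self_add), ?_⟩
  intro hbar h H H₁ d ψ hψ
  obtain ⟨⟨U, V, hs, hb, -, hae⟩, ⟨U', V', hs', hb', -, hae'⟩⟩ :=
    hex hbar h H H₁ d 1 (Or.inl rfl) ψ hψ
  have hC1 : (C : ℝ≥0∞) ≤ ((C + 3 * K ^ 3 * C + 3 * K ^ 3 : ℝ≥0) : ℝ≥0∞) := by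
    rw [add_assoc]; exact_mod_cast le_self_add
  refine ⟨?_, ?_, ?_, ?_⟩
  · have p1 := d.prim_first hs
    rw [sobNorm_congr hae, p1.sobNorm_one]
    refine (add_le_add hb.norm_U ((d.memLp_coeff_mul hb.memLp_V).2.trans
      (mul_le_mul_right hb.norm_V _))).trans ?_
    rw [← mul_assoc, ← add_mul, ← ENNReal.coe_mul, ← ENNReal.coe_add]
    exact ENNReal.coe_mul_le_coe_mul le_self_add _
  · rw [eLpNorm_congr_ae hae']
    refine (hb'.eLpNorm_top_U hψ.eLpNorm_ne_top).trans ?_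
    gcongr
  · rw [eLpNorm_congr_ae (hs'.1.wderiv_ae hae'.symm)]
    refine (eLpNorm_le_mul_sum (G := ![V', ψ]) le_top (3 * K ^ 3) ?_ ?_).trans ?_
    · intro i
      fin_cases i
      · exact hb'.memLp_V.1
      · exact hψ.1
    · refine Eventually.of_forall fun x => ?_
      simp only [Fin.sum_univ_two, Matrix.cons_val_zero, Matrix.cons_val_one]
      rw [← mul_sub, abs_mul]
      push_cast
      exact mul_le_mul (d.abs_coeff_le x) (abs_sub _ _) (abs_nonneg _) (by positivity)
    · simp only [Fin.sum_univ_two, Matrix.cons_val_zero, Matrix.cons_val_one]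
      rw [mul_add, mul_add]
      refine add_le_add ((mul_le_mul_right (hb'.eLpNorm_top_V hψ.eLpNorm_ne_top) _).trans ?_) ?_
      · rw [← mul_assoc, ← ENNReal.coe_mul]
        exact ENNReal.coe_mul_le_coe_mul (le_add_self.trans le_self_add) _
      · exact ENNReal.coe_mul_le_coe_mul le_add_self _
  · rw [eLpNorm_congr_ae hae']
    refine hb'.norm_U.trans ?_
    rw [mul_add, mul_one]
    refine le_trans ?_ le_add_self
    gcongr

/-- Estimates for data in `L²`. The term `h' u'` of `u''` is estimated by `‖h'‖_{L²} ‖u'‖_{L^∞}`. -/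
theorem L2_estimates (K : ℝ≥0) :
    ∃ C : ℝ≥0, 0 < C ∧ ∀ (hbar : ℝ) (h H H₁ : ℝ → ℝ), DepthRep K hbar h H H₁ →
      ∀ ψ, MemLp ψ 2 volume →
        sobNorm 1 2 (LinvD h ψ) + sobNorm 1 2 (Linv h ψ) ≤ C * eLpNorm ψ 2 volume ∧
        sobNorm 1 ⊤ (Linv h ψ) ≤ sobNorm 2 2 (Linv h ψ) ∧
        sobNorm 2 2 (Linv h ψ)
          ≤ C * (1 + eLpNorm (wderiv h) 2 volume ^ 2) * eLpNorm ψ 2 volume ∧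
        ∀ᵐ x, ‖wderiv (wderiv (Linv h ψ)) x‖ₑ
          ≤ C * ((1 + eLpNorm (wderiv h) 2 volume) * (1 + ‖wderiv h x‖ₑ) * eLpNorm ψ 2 volume
              + ‖ψ x‖ₑ) := by
  obtain ⟨C, hC, hex⟩ := exists_linv K
  -- `k` is the constant in `|u''| ≤ k (|h' V| + |u| + |ψ|)`
  set k : ℝ≥0 := 9 * K ^ 4 + 3 * K ^ 3 * (K + 1) with hk
  refine ⟨2 * C + 2 * (3 * K ^ 3) * C + 3 * K ^ 3 + k * (2 * C + 1),
    lt_of_lt_of_le (zero_lt_one.trans_le hC) ?_, ?_⟩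
  · rw [two_mul, add_assoc, add_assoc, add_assoc]; exact le_self_add
  set C' : ℝ≥0 := 2 * C + 2 * (3 * K ^ 3) * C + 3 * K ^ 3 + k * (2 * C + 1) with hC'
  intro hbar h H H₁ d ψ hψ
  obtain ⟨⟨U, V, hs, hb, -, hae⟩, ⟨U', V', hs', hb', -, hae'⟩⟩ :=
    hex hbar h H H₁ d 2 (Or.inr rfl) ψ hψ
  set N := eLpNorm ψ 2 volume with hN
  have hNt : N ≠ ⊤ := hψ.eLpNorm_ne_top
  have p1 := d.prim_first hs
  have p2 := d.prim_second hs
  set q : ℝ → ℝ :=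
    fun x => -9 * (H x)⁻¹ ^ 4 * H₁ x * V x + 3 * (H x)⁻¹ ^ 3 * (H x * U x - ψ x) with hq
  have n1 : sobNorm 1 2 (Linv h ψ) ≤ (C + 3 * K ^ 3 * C : ℝ≥0) * N := by
    rw [sobNorm_congr hae, p1.sobNorm_one]
    refine (add_le_add hb.norm_U ((d.memLp_coeff_mul hb.memLp_V).2.trans
      (mul_le_mul_right hb.norm_V _))).trans_eq ?_
    rw [← mul_assoc, ← add_mul, ← ENNReal.coe_mul, ← ENNReal.coe_add]
  have n2 : sobNorm 1 2 (LinvD h ψ) ≤ (C + 3 * K ^ 3 * C + 3 * K ^ 3 : ℝ≥0) * N := by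
    rw [sobNorm_congr hae', hs'.1.sobNorm_one]
    have i1 := eLpNorm_sub_le (d.memLp_coeff_mul hb'.memLp_V).1.1 (d.memLp_coeff_mul hψ).1.1
      one_le_two
    refine (add_le_add hb'.norm_U (i1.trans (add_le_add ((d.memLp_coeff_mul hb'.memLp_V).2.trans
      (mul_le_mul_right hb'.norm_V _)) (d.memLp_coeff_mul hψ).2))).trans_eq ?_
    push_cast
    ring
  have bq : ∀ x, |q x| ≤ k * (|H₁ x * V x| + |U x| + |ψ x|) := fun x => by
    refine (d.abs_second_le x _ _ _).trans ?_
    rw [abs_mul, hk]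
    push_cast
    have z1 : 0 ≤ 3 * (K : ℝ) ^ 3 * (K + 1) * (|H₁ x| * |V x|) := by positivity
    have z2 : 0 ≤ 9 * (K : ℝ) ^ 4 * |U x| := by positivity
    have z3 : 0 ≤ 9 * (K : ℝ) ^ 4 * |ψ x| := by positivity
    have z4 : 0 ≤ 3 * (K : ℝ) ^ 3 * |U x| := by positivity
    have z5 : 0 ≤ 3 * (K : ℝ) ^ 3 * K * |ψ x| := by positivity
    linarith
  have mHV : AEStronglyMeasurable (fun x => H₁ x * V x) volume :=
    d.memLp_deriv.1.mul hb.memLp_V.1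
  have nHV : eLpNorm (fun x => H₁ x * V x) 2 volume ≤ eLpNorm H₁ 2 volume * (C * N) := by
    have e : (fun x => H₁ x * V x) = fun x => V x * H₁ x := by funext x; ring
    rw [e, mul_comm]
    refine (eLpNorm_mul_le_top d.memLp_deriv.1).trans ?_
    gcongr
    exact hb.eLpNorm_top_V hNt
  have nq : eLpNorm q 2 volume ≤ k * (eLpNorm H₁ 2 volume * (C * N) + C * N + N) := by
    refine (eLpNorm_le_mul_sum (G := ![fun x => H₁ x * V x, U, ψ]) one_le_two k ?_
      (Eventually.of_forall fun x => ?_)).trans ?_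
    · intro i
      fin_cases i
      · exact mHV
      · exact hb.memLp_U.1
      · exact hψ.1
    · simpa [Fin.sum_univ_three] using bq x
    · simp only [Fin.sum_univ_three, Matrix.cons_val_zero, Matrix.cons_val_one, Matrix.cons_val]
      gcongr
      exact hb.norm_U
  have hqL : MemLp q 2 volume := by
    refine ⟨p2.locInt.aestronglyMeasurable, nq.trans_lt ?_⟩
    have := d.memLp_deriv.eLpNorm_ne_top
    finiteness
  have s2 : sobNorm 2 2 (Linv h ψ) = eLpNorm U 2 volume +
      (eLpNorm (fun x => 3 * (H x)⁻¹ ^ 3 * V x) 2 volume + eLpNorm q 2 volume) := by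
    rw [sobNorm_congr hae, p1.sobNorm_two p2]
  refine ⟨?_, ?_, ?_, ?_⟩
  · refine (add_le_add n2 n1).trans ?_
    rw [← add_mul, ← ENNReal.coe_add]
    refine ENNReal.coe_mul_le_coe_mul ?_ _
    rw [hC']
    calc C + 3 * K ^ 3 * C + 3 * K ^ 3 + (C + 3 * K ^ 3 * C)
        = 2 * C + 2 * (3 * K ^ 3) * C + 3 * K ^ 3 := by ring
      _ ≤ _ := le_self_add
  · rw [s2, sobNorm_congr hae, p1.sobNorm_one]
    have i1 := p1.two_mul_eLpNorm_top_le hb.memLp_U (d.memLp_coeff_mul hb.memLp_V).1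
    have i2 := p2.two_mul_eLpNorm_top_le (d.memLp_coeff_mul hb.memLp_V).1 hqL
    set x₁ := eLpNorm U 2 volume
    set x₂ := eLpNorm (fun x => 3 * (H x)⁻¹ ^ 3 * V x) 2 volume
    set x₃ := eLpNorm q 2 volume
    have i3 : 2 * (eLpNorm U ⊤ volume + eLpNorm (fun x => 3 * (H x)⁻¹ ^ 3 * V x) ⊤ volume)
        ≤ 2 * (x₁ + (x₂ + x₃)) := by
      rw [mul_add]
      calc _ ≤ (x₁ + x₂) + (x₂ + x₃) := add_le_add i1 i2
        _ ≤ (x₁ + x₂) + (x₂ + x₃) + (x₁ + x₃) := le_self_add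
        _ = _ := by ring
    exact (ENNReal.mul_le_mul_iff_right two_ne_zero ENNReal.ofNat_ne_top).1 i3
  · rw [s2, d.eLpNorm_wderiv, ← add_assoc]
    set D := eLpNorm H₁ 2 volume
    have hs1 : eLpNorm U 2 volume + eLpNorm (fun x => 3 * (H x)⁻¹ ^ 3 * V x) 2 volume
        ≤ (C + 3 * K ^ 3 * C : ℝ≥0) * N := by
      rw [← p1.sobNorm_one, ← sobNorm_congr hae]; exact n1
    have hD : D ≤ 1 + D ^ 2 := ENNReal.self_le_one_add_sq D
    have h1 : (1 : ℝ≥0∞) ≤ 1 + D ^ 2 := le_self_add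
    calc _ ≤ (C + 3 * K ^ 3 * C : ℝ≥0) * N + k * (D * (C * N) + C * N + N) := add_le_add hs1 nq
      _ ≤ (C + 3 * K ^ 3 * C : ℝ≥0) * (1 + D ^ 2) * N
          + k * ((1 + D ^ 2) * (C * N) + (1 + D ^ 2) * (C * N) + (1 + D ^ 2) * N) := by
          refine add_le_add (mul_le_mul' (le_mul_of_one_le_right' h1) le_rfl) (mul_le_mul' le_rfl
            (add_le_add (add_le_add (mul_le_mul' hD le_rfl) ?_) ?_)) <;>
          exact le_mul_of_one_le_left' h1
      _ = ((C + 3 * K ^ 3 * C + k * (2 * C + 1) : ℝ≥0) : ℝ≥0∞) * (1 + D ^ 2) * N := by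
          push_cast; ring
      _ ≤ _ := by
          refine mul_le_mul' (ENNReal.coe_mul_le_coe_mul ?_ _) le_rfl
          rw [hC']
          calc C + 3 * K ^ 3 * C + k * (2 * C + 1)
              ≤ C + 3 * K ^ 3 * C + k * (2 * C + 1) + (C + 3 * K ^ 3 * C + 3 * K ^ 3) := le_self_add
            _ = _ := by ring
  · have e1 : wderiv (wderiv (Linv h ψ)) =ᵐ[volume] _ := p2.wderiv_ae (p1.wderiv_ae hae.symm).symm
    filter_upwards [e1, d.wderiv_ae] with x hx hx'
    rw [hx, hx', d.eLpNorm_wderiv]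
    have key := enorm_le_of_abs_le (z := H₁ x) (t := ψ x) (C := C') hNt (y := q x) (by
      refine (bq x).trans ?_
      have k1 : (k : ℝ) * (|H₁ x * V x| + |U x| + |ψ x|)
          ≤ k * (|H₁ x| * (C * N.toReal) + C * N.toReal + |ψ x|) := by
        rw [abs_mul]
        gcongr
        · exact hb.sup_V x
        · exact hb.sup_U x
      refine k1.trans ?_
      have hkC : (k : ℝ) * C ≤ C' ∧ (k : ℝ) ≤ C' := by
        have : (C' : ℝ) = (2 * C + 2 * (3 * K ^ 3) * C + 3 * K ^ 3) + k * (2 * C + 1) := by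
          rw [hC']; push_cast; ring
        have z : (0 : ℝ) ≤ 2 * C + 2 * (3 * K ^ 3) * C + 3 * K ^ 3 := by positivity
        have z' : (0 : ℝ) ≤ k * C := by positivity
        have z'' : (0 : ℝ) ≤ k := k.2
        constructor <;> linarith
      have hN0 : 0 ≤ N.toReal := ENNReal.toReal_nonneg
      calc (k : ℝ) * (|H₁ x| * (C * N.toReal) + C * N.toReal + |ψ x|)
          = (k * C) * ((1 + |H₁ x|) * N.toReal) + k * |ψ x| := by ring
        _ ≤ C' * ((1 + |H₁ x|) * N.toReal) + C' * |ψ x| := by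
            gcongr
            · exact hkC.1
            · exact hkC.2
        _ = _ := by ring)
    refine key.trans ?_
    gcongr
    exact le_mul_of_one_le_left' le_self_add

end DepthRep

/-! ### The third order estimate -/

namespace DepthRep

variable {K : ℝ≥0} {hbar : ℝ} {h H H₁ : ℝ → ℝ}

/-- If `h - hbar` is in `H²`, then the derivative of the depth has itself a representative with a
square integrable weak derivative. -/
theorem exists_second (d : DepthRep K hbar h H H₁) (hh : MemSob 2 2 fun x => h x - hbar) :
    ∃ F₁ F₂, DepthRep K hbar h H F₁ ∧ IsPrimitive F₁ F₂ ∧ MemLp F₂ 2 volume ∧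
      eLpNorm F₂ 2 volume ≤ sobNorm 2 2 (fun x => h x - hbar) := by
  obtain ⟨F, F₁, F₂, hF, h1, h2, -, -, k2, hs⟩ := hh.exists_two
  have hP : IsPrimitive (fun x => H x - hbar) H₁ := by
    simpa using d.prim.sub (IsPrimitive.const hbar)
  have hFH : (fun x => H x - hbar) =ᵐ[volume] F := by
    filter_upwards [hF, d.ae_eq] with x e1 e2
    rw [e1, e2]
  have hae : H₁ =ᵐ[volume] F₁ := (hP.wderiv_ae hFH).symm.trans (h1.wderiv_ae .rfl)
  refine ⟨F₁, F₂, ⟨d.one_le, d.ae_eq, d.prim.congr_right hae, d.memLp_sub,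
    (memLp_congr_ae hae).1 d.memLp_deriv, d.lower, d.upper⟩, h2, k2, ?_⟩
  rw [hs]
  exact le_add_self.trans le_add_self

/-- A bound for the expression of `u''` in terms of `p = u'` and `u`. -/
theorem abs_second_le_sum (d : DepthRep K hbar h H H₁) (x p u s : ℝ) :
    |-3 * (H x)⁻¹ * (H₁ x * p) + 3 * (H x)⁻¹ ^ 3 * (H x * u - s)|
      ≤ 12 * (K : ℝ) ^ 5 * (|H₁ x * p| + |u| + |s|) := by
  have hi := inv_pos.2 (d.pos x)
  have h1 := d.inv_le x
  have hK := d.one_le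
  have e : -3 * (H x)⁻¹ * (H₁ x * p) + 3 * (H x)⁻¹ ^ 3 * (H x * u - s)
      = -(3 * (H x)⁻¹) * (H₁ x * p) + 3 * (H x)⁻¹ ^ 2 * u - 3 * (H x)⁻¹ ^ 3 * s := by
    have := (d.pos x).ne'
    field_simp
    ring
  have b1 : 3 * (H x)⁻¹ ≤ 12 * (K : ℝ) ^ 5 := by
    have : (K : ℝ) ≤ (K : ℝ) ^ 5 := le_self_pow₀ hK (by norm_num)
    linarith
  have b2 : 3 * (H x)⁻¹ ^ 2 ≤ 12 * (K : ℝ) ^ 5 := by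
    have a1 : (H x)⁻¹ ^ 2 ≤ (K : ℝ) ^ 2 := by gcongr
    have a2 : (K : ℝ) ^ 2 ≤ (K : ℝ) ^ 5 := pow_le_pow_right₀ hK (by norm_num)
    have : 0 < (H x)⁻¹ ^ 2 := by positivity
    linarith
  have b3 : 3 * (H x)⁻¹ ^ 3 ≤ 12 * (K : ℝ) ^ 5 := by
    have a1 : (H x)⁻¹ ^ 3 ≤ (K : ℝ) ^ 3 := by gcongr
    have a2 : (K : ℝ) ^ 3 ≤ (K : ℝ) ^ 5 := pow_le_pow_right₀ hK (by norm_num)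
    have : 0 < (H x)⁻¹ ^ 3 := by positivity
    linarith
  rw [e, mul_add, mul_add]
  refine (abs_sub _ _).trans (add_le_add ((abs_add_le _ _).trans (add_le_add ?_ ?_)) ?_)
  · rw [abs_mul, abs_neg, abs_of_pos (by positivity)]
    gcongr
  · rw [abs_mul, abs_of_pos (by positivity : 0 < 3 * (H x)⁻¹ ^ 2)]
    gcongr
  · rw [abs_mul, abs_of_pos (by positivity : 0 < 3 * (H x)⁻¹ ^ 3)]
    gcongr

/-- A bound for the derivative of the expression of `u''`, where `p = u'`, `q = u''` and `η = h''`. -/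
theorem abs_third_le_sum (d : DepthRep K hbar h H H₁) (x p q u s s₁ η : ℝ) :
    |-3 * (-H₁ x / H x ^ 2) * (H₁ x * p) + -3 * (H x)⁻¹ * (η * p + H₁ x * q)
        + (-9 * (H x)⁻¹ ^ 4 * H₁ x * (H x * u - s)
          + 3 * (H x)⁻¹ ^ 3 * (H₁ x * u + H x * p - s₁))|
      ≤ 12 * (K : ℝ) ^ 5 * (|H₁ x * (H₁ x * p)| + |η * p| + |H₁ x * q| + |H₁ x * u| + |H₁ x * s|
          + |p| + |s₁|) := by
  have hi := inv_pos.2 (d.pos x)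
  have h1 := d.inv_le x
  have hK := d.one_le
  set i := (H x)⁻¹ with hi_def
  have e : -3 * (-H₁ x / H x ^ 2) * (H₁ x * p) + -3 * i * (η * p + H₁ x * q)
        + (-9 * i ^ 4 * H₁ x * (H x * u - s) + 3 * i ^ 3 * (H₁ x * u + H x * p - s₁))
      = 3 * i ^ 2 * (H₁ x * (H₁ x * p)) + -(3 * i) * (η * p) + -(3 * i) * (H₁ x * q)
        + -(6 * i ^ 3) * (H₁ x * u) + 9 * i ^ 4 * (H₁ x * s) + 3 * i ^ 2 * p
        + -(3 * i ^ 3) * s₁ := by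
    have := (d.pos x).ne'
    rw [hi_def]
    field_simp
    ring
  have hpow : ∀ n, n ≤ 5 → i ^ n ≤ (K : ℝ) ^ 5 := fun n hn =>
    (pow_le_pow_left₀ hi.le h1 n).trans (pow_le_pow_right₀ hK hn)
  have key : ∀ (c z : ℝ) (n : ℕ), n ≤ 5 → 0 ≤ c → c ≤ 12 →
      |c * i ^ n * z| ≤ 12 * (K : ℝ) ^ 5 * |z| ∧ |-(c * i ^ n) * z| ≤ 12 * (K : ℝ) ^ 5 * |z| := by
    intro c z n hn h0 h12
    rw [abs_mul, abs_mul (-(c * i ^ n)), abs_neg, abs_of_nonneg (by positivity : 0 ≤ c * i ^ n)]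
    have := hpow n hn
    exact ⟨by gcongr, by gcongr⟩
  rw [e]
  simp only [mul_add]
  refine (abs_add_le _ _).trans (add_le_add ((abs_add_le _ _).trans (add_le_add
    ((abs_add_le _ _).trans (add_le_add ((abs_add_le _ _).trans (add_le_add
    ((abs_add_le _ _).trans (add_le_add ((abs_add_le _ _).trans (add_le_add ?_ ?_)) ?_)) ?_))
    ?_)) ?_)) ?_)
  · exact (key 3 _ 2 (by norm_num) (by norm_num) (by norm_num)).1
  · simpa using (key 3 (η * p) 1 (by norm_num) (by norm_num) (by norm_num)).2
  · simpa using (key 3 (H₁ x * q) 1 (by norm_num) (by norm_num) (by norm_num)).2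
  · exact (key 6 _ 3 (by norm_num) (by norm_num) (by norm_num)).2
  · exact (key 9 _ 4 (by norm_num) (by norm_num) (by norm_num)).1
  · exact (key 3 _ 2 (by norm_num) (by norm_num) (by norm_num)).1
  · exact (key 3 _ 3 (by norm_num) (by norm_num) (by norm_num)).2

/-- The equation `u'' = -3 (h' / h) u' + 3 h⁻³ (h u - G)`, differentiated once more, bounds three
derivatives of `u`. In `u'''` the term with `h''` is bounded by `‖h''‖_{L²} ‖u'‖_{L^∞}`, and the others
are at most quadratic in `h'`. -/
theorem sobNorm_three_le (d : DepthRep K hbar h H H₁) {H₂ U p G G₁ : ℝ → ℝ}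
    (hH : IsPrimitive H₁ H₂) (hH₂ : MemLp H₂ 2 volume) (hU : IsPrimitive U p)
    (hp : IsPrimitive p fun x =>
      -3 * (H x)⁻¹ * (H₁ x * p x) + 3 * (H x)⁻¹ ^ 3 * (H x * U x - G x))
    (hG : IsPrimitive G G₁) (mU : MemLp U 2 volume) (mp : MemLp p 2 volume)
    (mG : MemLp G 2 volume) (mG₁ : MemLp G₁ 2 volume) :
    sobNorm 3 2 U ≤ (1 + 7 * (12 * K ^ 5) + 2 * (12 * K ^ 5) ^ 2 : ℝ≥0) *
      ((1 + eLpNorm H₁ ⊤ volume ^ 2) *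
        (eLpNorm U 2 volume + eLpNorm p 2 volume + eLpNorm G 2 volume + eLpNorm G₁ 2 volume)
        + eLpNorm H₂ 2 volume * eLpNorm p ⊤ volume) := by
  set k : ℝ≥0 := 12 * K ^ 5 with hk
  have hkr : (k : ℝ) = 12 * (K : ℝ) ^ 5 := by rw [hk]; push_cast; ring
  set q : ℝ → ℝ := fun x =>
    -3 * (H x)⁻¹ * (H₁ x * p x) + 3 * (H x)⁻¹ ^ 3 * (H x * U x - G x) with hq
  have hr : IsPrimitive q fun x => -3 * (-H₁ x / H x ^ 2) * (H₁ x * p x)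
      + -3 * (H x)⁻¹ * (H₂ x * p x + H₁ x * q x)
      + (-9 * (H x)⁻¹ ^ 4 * H₁ x * (H x * U x - G x)
        + 3 * (H x)⁻¹ ^ 3 * (H₁ x * U x + H x * p x - G₁ x)) :=
    ((d.prim_inv.const_mul (-3)).mul (hH.mul hp)).add
      (d.prim_coeff.mul ((d.prim.mul hU).sub hG))
  rw [hU.sobNorm_three hp hr]
  have mH : AEStronglyMeasurable H₁ volume := hH.continuous.aestronglyMeasurable
  have mq : AEStronglyMeasurable q volume := hr.continuous.aestronglyMeasurable
  have mHp := mH.mul mp.1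
  set D := eLpNorm H₁ ⊤ volume with hD
  set a := eLpNorm U 2 volume
  set b := eLpNorm p 2 volume
  set c := eLpNorm G 2 volume
  set e := eLpNorm G₁ 2 volume
  set E := eLpNorm H₂ 2 volume * eLpNorm p ⊤ volume
  set X := a + b + c + e with hX
  have ha : a ≤ X := by rw [hX, add_assoc, add_assoc]; exact le_self_add
  have hb : b ≤ X := by rw [hX, add_assoc, add_comm a, add_right_comm, add_assoc]; exact le_self_add
  have hc : c ≤ X := by rw [hX, add_assoc, add_left_comm]; exact le_self_add
  have he : e ≤ X := le_add_self
  have hab : a + b ≤ X := by rw [hX, add_assoc (a + b)]; exact le_self_add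
  have hDD : D ≤ 1 + D ^ 2 := ENNReal.self_le_one_add_sq D
  have h1D : 1 ≤ 1 + D ^ 2 := le_self_add
  set Q := (1 + D ^ 2) * X with hQ
  have hXQ : X ≤ Q := le_mul_of_one_le_left' h1D
  have hDX : D * X ≤ Q := mul_le_mul' hDD le_rfl
  have hDDX : D * (D * X) ≤ Q := by
    rw [← mul_assoc, ← sq]; exact mul_le_mul' le_add_self le_rfl
  have nq : eLpNorm q 2 volume ≤ k * (D * b + a + c) := by
    refine (eLpNorm_le_mul_sum (G := ![fun x => H₁ x * p x, U, G]) one_le_two k ?_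
      (Eventually.of_forall fun x => ?_)).trans ?_
    · intro i
      fin_cases i
      · exact mHp
      · exact mU.1
      · exact mG.1
    · simp only [Fin.sum_univ_three, Matrix.cons_val_zero, Matrix.cons_val_one, Matrix.cons_val]
      rw [hkr]
      exact d.abs_second_le_sum x (p x) (U x) (G x)
    · simp only [Fin.sum_univ_three, Matrix.cons_val_zero, Matrix.cons_val_one, Matrix.cons_val]
      gcongr
      exact eLpNorm_mul_le_top mp.1
  have hacX : a + c ≤ X := by
    rw [hX, add_right_comm a b c, add_assoc (a + c)]; exact le_self_add
  have nq' : eLpNorm q 2 volume ≤ k * (D * X + X) := by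
    refine nq.trans (mul_le_mul' le_rfl ?_)
    rw [add_assoc]
    exact add_le_add (mul_le_mul' le_rfl hb) hacX
  -- the term `h' u''` of `u'''` is quadratic in `h'`
  have hDq : D * eLpNorm q 2 volume ≤ 2 * k * Q := by
    calc _ ≤ D * (k * (D * X + X)) := mul_le_mul' le_rfl nq'
      _ = k * (D * (D * X) + D * X) := by ring
      _ ≤ k * (Q + Q) := mul_le_mul' le_rfl (add_le_add hDDX hDX)
      _ = _ := by ring
  have nr : eLpNorm (fun x => -3 * (-H₁ x / H x ^ 2) * (H₁ x * p x)
      + -3 * (H x)⁻¹ * (H₂ x * p x + H₁ x * q x)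
      + (-9 * (H x)⁻¹ ^ 4 * H₁ x * (H x * U x - G x)
        + 3 * (H x)⁻¹ ^ 3 * (H₁ x * U x + H x * p x - G₁ x))) 2 volume
      ≤ k * (D * (D * b) + E + D * eLpNorm q 2 volume + D * a + D * c + b + e) := by
    refine (eLpNorm_le_mul_sum (G := ![fun x => H₁ x * (H₁ x * p x), fun x => H₂ x * p x,
      fun x => H₁ x * q x, fun x => H₁ x * U x, fun x => H₁ x * G x, p, G₁]) one_le_two k ?_
      (Eventually.of_forall fun x => ?_)).trans ?_
    · intro i
      fin_cases i
      · exact mH.mul mHp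
      · exact hH₂.1.mul mp.1
      · exact mH.mul mq
      · exact mH.mul mU.1
      · exact mH.mul mG.1
      · exact mp.1
      · exact mG₁.1
    · simp only [Fin.sum_univ_seven, Matrix.cons_val_zero, Matrix.cons_val_one, Matrix.cons_val]
      rw [hkr]
      exact d.abs_third_le_sum x (p x) (q x) (U x) (G x) (G₁ x) (H₂ x)
    · simp only [Fin.sum_univ_seven, Matrix.cons_val_zero, Matrix.cons_val_one, Matrix.cons_val]
      have e1 : eLpNorm (fun x => H₁ x * (H₁ x * p x)) 2 volume ≤ D * (D * b) :=
        (eLpNorm_mul_le_top mHp).trans (mul_le_mul' le_rfl (eLpNorm_mul_le_top mp.1))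
      have e2 : eLpNorm (fun x => H₂ x * p x) 2 volume ≤ E := by
        have : (fun x => H₂ x * p x) = fun x => p x * H₂ x := by funext x; ring
        rw [this]
        exact (eLpNorm_mul_le_top hH₂.1).trans_eq (mul_comm _ _)
      refine mul_le_mul' le_rfl ?_
      refine add_le_add (add_le_add (add_le_add (add_le_add (add_le_add (add_le_add e1 e2)
        (eLpNorm_mul_le_top mq)) (eLpNorm_mul_le_top mU.1)) (eLpNorm_mul_le_top mG.1)) le_rfl) le_rfl
  have nr' : k * (D * (D * b) + E + D * eLpNorm q 2 volume + D * a + D * c + b + e)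
      ≤ k * (Q + E + 2 * k * Q + Q + Q + Q + Q) := by
    refine mul_le_mul' le_rfl ?_
    refine add_le_add (add_le_add (add_le_add (add_le_add (add_le_add (add_le_add ?_ le_rfl) hDq)
      ?_) ?_) (hb.trans hXQ)) (he.trans hXQ)
    · exact (mul_le_mul' le_rfl (mul_le_mul' le_rfl hb)).trans hDDX
    · exact (mul_le_mul' le_rfl ha).trans hDX
    · exact (mul_le_mul' le_rfl hc).trans hDX
  calc a + (b + (eLpNorm q 2 volume + eLpNorm _ 2 volume))
      ≤ a + (b + (k * (Q + Q) + k * (Q + E + 2 * k * Q + Q + Q + Q + Q))) :=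
        add_le_add le_rfl (add_le_add le_rfl (add_le_add
          (nq'.trans (mul_le_mul' le_rfl (add_le_add hDX hXQ))) (nr.trans nr')))
    _ = (a + b) + (k * (Q + Q) + k * (Q + E + 2 * k * Q + Q + Q + Q + Q)) := by ring
    _ ≤ Q + (k * (Q + Q) + k * (Q + E + 2 * k * Q + Q + Q + Q + Q)) :=
        add_le_add (hab.trans hXQ) le_rfl
    _ ≤ Q + (k * (Q + Q) + k * (Q + E + 2 * k * Q + Q + Q + Q + Q))
        + (1 + 6 * k + 2 * k ^ 2) * E := le_self_add
    _ = ((1 + 7 * k + 2 * k ^ 2 : ℝ≥0) : ℝ≥0∞) * (Q + E) := by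
        push_cast
        ring

/-- Estimates in `H³` for data in `H²`: for `𝓛_h⁻¹ ∂ₓ φ`, the derivative of the data plays the role
which the data play for `𝓛_h⁻¹ φ`. -/
theorem H2_estimates (K : ℝ≥0) :
    ∃ C : ℝ≥0, 0 < C ∧ ∀ (hbar : ℝ) (h H H₁ : ℝ → ℝ), DepthRep K hbar h H H₁ →
      MemSob 2 2 (fun x => h x - hbar) → ∀ φ, MemSob 2 2 φ →
        sobNorm 3 2 (LinvD h φ)
          ≤ C * ((1 + eLpNorm (wderiv h) ⊤ volume ^ 2) * sobNorm 2 2 φ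
              + sobNorm 2 2 (fun x => h x - hbar) * sobNorm 1 ⊤ (LinvD h φ)) ∧
        sobNorm 3 2 (Linv h φ)
          ≤ C * ((1 + eLpNorm (wderiv h) ⊤ volume ^ 2) * sobNorm 2 2 φ
              + sobNorm 2 2 (fun x => h x - hbar) * sobNorm 1 ⊤ (Linv h φ)) := by
  obtain ⟨C₂, -, hL2⟩ := L2_estimates K
  obtain ⟨C₁, -, hex⟩ := exists_linv K
  set c : ℝ≥0 := 1 + 7 * (12 * K ^ 5) + 2 * (12 * K ^ 5) ^ 2 with hc
  refine ⟨c * (C₂ + 1), by positivity, ?_⟩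
  intro hbar h H H₀ d₀ hh φ hφ
  obtain ⟨H₁, H₂, d, hH, hH₂, hT⟩ := d₀.exists_second hh
  obtain ⟨Φ, Φ₁, Φ₂, hae, hΦ, hΦ₁, m0, m1, m2, hS⟩ := hφ.exists_two
  have i0 : Linv h φ = Linv h Φ := slInv_congr hae.symm .rfl
  have i1 : LinvD h φ = LinvD h Φ := slInv_congr .rfl hae.symm
  rw [i0, i1, d.eLpNorm_wderiv]
  obtain ⟨⟨U, V, hs, hb, -, hu⟩, ⟨U', V', hs', hb', -, hu'⟩⟩ :=
    hex hbar h H H₁ d 2 (Or.inr rfl) Φ m0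
  have hN := (hL2 hbar h H H₁ d Φ m0).1
  set S := sobNorm 2 2 φ
  set T := sobNorm 2 2 fun x => h x - hbar
  have hΦS : eLpNorm Φ 2 volume ≤ S := by rw [hS]; exact le_self_add
  -- both estimates follow from `sobNorm_three_le` in the same way
  have key : ∀ u W p G G₁ : ℝ → ℝ, u =ᵐ[volume] W → IsPrimitive W p →
      (IsPrimitive p fun x =>
        -3 * (H x)⁻¹ * (H₁ x * p x) + 3 * (H x)⁻¹ ^ 3 * (H x * W x - G x)) →
      IsPrimitive G G₁ → MemLp W 2 volume → MemLp p 2 volume → MemLp G 2 volume →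
      MemLp G₁ 2 volume → sobNorm 1 2 u ≤ C₂ * eLpNorm Φ 2 volume →
      eLpNorm G 2 volume + eLpNorm G₁ 2 volume ≤ S →
      sobNorm 3 2 u ≤ ((c * (C₂ + 1) : ℝ≥0) : ℝ≥0∞) *
        ((1 + eLpNorm H₁ ⊤ volume ^ 2) * S + T * sobNorm 1 ⊤ u) := by
    intro u W p G G₁ hu hW hp hG mW mp mG mG₁ h1 h2
    rw [sobNorm_congr hu, hW.sobNorm_one] at h1
    rw [sobNorm_congr hu, sobNorm_congr hu, hW.sobNorm_one]
    refine (d.sobNorm_three_le hH hH₂ hW hp hG mW mp mG mG₁).trans ?_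
    rw [← hc, ENNReal.coe_mul, mul_assoc]
    refine mul_le_mul' le_rfl ?_
    rw [mul_add ((C₂ + 1 : ℝ≥0) : ℝ≥0∞)]
    refine add_le_add ?_ ?_
    · rw [mul_left_comm]
      refine mul_le_mul' le_rfl ?_
      push_cast
      rw [add_assoc, add_mul, one_mul]
      exact add_le_add (h1.trans (mul_le_mul' le_rfl hΦS)) h2
    · push_cast
      calc _ ≤ T * (eLpNorm W ⊤ volume + eLpNorm p ⊤ volume) := mul_le_mul' hT le_add_self
        _ ≤ _ := le_mul_of_one_le_left' le_add_self
  constructor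
  · have hp := d.prim_coeff.mul (hs'.2.sub hΦ)
    refine key _ U' (fun x => 3 * (H x)⁻¹ ^ 3 * (V' x - Φ x)) Φ₁ Φ₂ hu'
      (hs'.1.congr_right (Eventually.of_forall fun x => ?_))
      (hp.congr_right (Eventually.of_forall fun x => ?_)) hΦ₁ hb'.memLp_U
      (d.memLp_coeff_mul (hb'.memLp_V.sub m0)).1 m1 m2 (le_self_add.trans hN) ?_
    · simp only
      ring
    · have := (d.pos x).ne'
      simp only [Pi.zero_apply]
      field_simp
      ring
    · rw [hS]; exact le_add_self
  · have hp := d.prim_second hs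
    refine key _ U (fun x => 3 * (H x)⁻¹ ^ 3 * V x) Φ Φ₁ hu (d.prim_first hs)
      (hp.congr_right (Eventually.of_forall fun x => ?_)) hΦ hb.memLp_U
      (d.memLp_coeff_mul hb.memLp_V).1 m0 m1 (le_add_self.trans hN) ?_
    · have := (d.pos x).ne'
      simp only
      field_simp
      ring
    · rw [hS, ← add_assoc]; exact le_self_add

end DepthRep

/-! ### The operator with constant coefficients -/

theorem eLpNorm_const_mul_sub_le {c g : ℝ} {f w : ℝ → ℝ} (hc : 0 ≤ c) (hg : 0 ≤ g)
    (hf : AEStronglyMeasurable f volume) (hw : AEStronglyMeasurable w volume) {M N : ℝ≥0∞}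
    (hM : eLpNorm f 2 volume ≤ M) (hN : eLpNorm w 2 volume ≤ N) :
    eLpNorm (fun x => c * (g * f x - w x)) 2 volume ≤ c.toNNReal * (g.toNNReal * M + N) := by
  have hsmul : ∀ {t : ℝ} (u : ℝ → ℝ), 0 ≤ t →
      eLpNorm (fun x => t * u x) 2 volume = t.toNNReal * eLpNorm u 2 volume := fun {t} u ht => by
    have := eLpNorm_const_smul t u 2 volume
    rw [Real.enorm_eq_ofReal ht] at this
    exact this
  rw [hsmul (fun x => g * f x - w x) hc]
  refine mul_le_mul' le_rfl ((eLpNorm_sub_le (hf.const_mul g) hw one_le_two).trans ?_)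
  rw [hsmul f hg]
  exact add_le_add (mul_le_mul' le_rfl hM) hN

theorem systemCoeff_const {g γ : ℝ} (hg : 0 < g) (hγ : 0 < γ) :
    SystemCoeff (min γ⁻¹ g) (max γ⁻¹ g) (fun _ => g) (fun _ => γ) (fun _ => γ⁻¹) (fun _ => g) :=
  ⟨lt_min (inv_pos.2 hγ) hg, continuous_const, continuous_const, fun _ => min_le_left _ _,
    fun _ => le_max_left _ _, fun _ => min_le_right _ _, fun _ => le_max_right _ _, .rfl,
    Eventually.of_forall fun _ => (inv_inv γ).symm⟩

/-- For `g w - γ w'' = ψ` the system has constant coefficients, and the derivatives of `w` are read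
off from `w'' = (g w - ψ) / γ`. -/
theorem helmholtz_estimates {g γ : ℝ} (hg : 0 < g) (hγ : 0 < γ) : ∃ C : ℝ≥0, 0 < C ∧
    (∀ ψ, MemSob 1 2 ψ → WellDefined (fun _ => g) (fun _ => γ) ψ 0 ∧
      sobNorm 3 2 (helmInv g γ ψ) ≤ C * sobNorm 1 2 ψ) ∧
    (∀ ψ, MemSob 2 2 ψ →
      sobNorm 3 2 (wderiv (helmInv g γ ψ)) ≤ C * sobNorm 2 2 ψ) := by
  obtain ⟨C, hC, hex⟩ := SystemCoeff.exists_bound (min γ⁻¹ g) (max γ⁻¹ g)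
  have hc := systemCoeff_const hg hγ
  have hi := (inv_pos.2 hγ).le
  set Γ : ℝ≥0 := γ⁻¹.toNNReal
  set a : ℝ≥0 := g.toNNReal
  have key : ∀ ψ Ψ Ψ₁ : ℝ → ℝ, Ψ =ᵐ[volume] ψ → IsPrimitive Ψ Ψ₁ → MemLp Ψ 2 volume →
      MemLp Ψ₁ 2 volume → ∀ S : ℝ≥0∞, eLpNorm Ψ 2 volume ≤ S → eLpNorm Ψ₁ 2 volume ≤ S →
      ∃ U p q r : ℝ → ℝ, WellDefined (fun _ => g) (fun _ => γ) ψ 0 ∧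
        helmInv g γ ψ =ᵐ[volume] U ∧ IsPrimitive U p ∧ IsPrimitive p q ∧ IsPrimitive q r ∧
        (∀ Ψ₂, IsPrimitive Ψ₁ Ψ₂ → IsPrimitive r fun x => γ⁻¹ * (g * q x - Ψ₂ x)) ∧
        eLpNorm U 2 volume ≤ C * S ∧ eLpNorm p 2 volume ≤ Γ * (C * S) ∧
        eLpNorm q 2 volume ≤ Γ * (a * (C * S) + S) ∧
        eLpNorm r 2 volume ≤ Γ * (a * (Γ * (C * S)) + S) := by
    intro ψ Ψ Ψ₁ hae hP m0 m1 S hS hS₁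
    obtain ⟨⟨U, V, hs, hb⟩, -⟩ := hex _ _ _ _ hc 2 (Or.inr rfl) Ψ m0
    obtain ⟨k1, k2⟩ := hc.wellDefined (φ := 0) hP.continuous.locallyIntegrable
      locallyIntegrable_zero hb.sup_U (V := V) (by convert! hs using 1; funext x; simp)
    have hp : IsPrimitive U fun x => γ⁻¹ * V x := by simpa using hs.1
    have hq : IsPrimitive (fun x => γ⁻¹ * V x) fun x => γ⁻¹ * (g * U x - Ψ x) :=
      hs.2.const_mul γ⁻¹
    have hr : IsPrimitive (fun x => γ⁻¹ * (g * U x - Ψ x))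
        fun x => γ⁻¹ * (g * (γ⁻¹ * V x) - Ψ₁ x) := ((hp.const_mul g).sub hP).const_mul γ⁻¹
    have hU : eLpNorm U 2 volume ≤ C * S := hb.norm_U.trans (mul_le_mul' le_rfl hS)
    have hV : eLpNorm V 2 volume ≤ C * S := hb.norm_V.trans (mul_le_mul' le_rfl hS)
    have np : eLpNorm (fun x => γ⁻¹ * V x) 2 volume ≤ Γ * (C * S) := by
      have := eLpNorm_const_smul γ⁻¹ V 2 volume
      rw [Real.enorm_eq_ofReal hi] at this
      exact this.trans_le (mul_le_mul' le_rfl hV)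
    have hWD : WellDefined (fun _ => g) (fun _ => γ) ψ 0 := by
      obtain ⟨-, w2, w3, w4⟩ := k1
      have e : IsWeakSol (fun _ => g) (fun _ => γ) Ψ 0 = IsWeakSol (fun _ => g) (fun _ => γ) ψ 0 :=
        isWeakSol_congr hae .rfl
      rw [e, slInv_congr hae .rfl] at w3
      rw [e, slInv_congr hae .rfl] at w4
      exact ⟨hP.continuous.locallyIntegrable.congr hae, w2, w3, w4⟩
    refine ⟨U, _, _, _, hWD, ?_, hp, hq, hr, fun Ψ₂ h2 => ((hq.const_mul g).sub h2).const_mul γ⁻¹,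
      hU, np, eLpNorm_const_mul_sub_le hi hg.le hb.memLp_U.1 m0.1 hU hS,
      eLpNorm_const_mul_sub_le hi hg.le hq.continuous.aestronglyMeasurable m1.1 np hS₁⟩
    rw [helmInv, slInv_congr hae.symm .rfl]
    exact k2
  refine ⟨C + Γ * C + Γ * (a * C + 1) + Γ * (a * (Γ * C) + 1) + Γ * (a * (Γ * (a * C + 1)) + 1),
    lt_of_lt_of_le (zero_lt_one.trans_le hC) ?_, fun ψ hψ => ?_, fun ψ hψ => ?_⟩
  · rw [add_assoc, add_assoc, add_assoc]
    exact le_self_add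
  · obtain ⟨Ψ, Ψ₁, hae, hP, m0, m1, hS⟩ := hψ.exists_one
    obtain ⟨U, p, q, r, hW, hu, hp, hq, hr, -, n0, n1, n2, n3⟩ := key ψ Ψ Ψ₁ hae hP m0 m1
      (sobNorm 1 2 ψ) (by rw [hS]; exact le_self_add) (by rw [hS]; exact le_add_self)
    refine ⟨hW, ?_⟩
    rw [sobNorm_congr hu, hp.sobNorm_three hq hr]
    refine (add_le_add n0 (add_le_add n1 (add_le_add n2 n3))).trans ?_
    refine le_trans (le_of_eq ?_) (ENNReal.coe_mul_le_coe_mul (le_self_add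
      (a := C + Γ * C + Γ * (a * C + 1) + Γ * (a * (Γ * C) + 1))) _)
    push_cast
    ring
  · obtain ⟨Ψ, Ψ₁, Ψ₂, hae, hP, hP₁, m0, m1, m2, hS⟩ := hψ.exists_two
    have s0 : eLpNorm Ψ 2 volume ≤ sobNorm 2 2 ψ := by rw [hS]; exact le_self_add
    have s1 : eLpNorm Ψ₁ 2 volume ≤ sobNorm 2 2 ψ := by
      rw [hS]; exact le_self_add.trans le_add_self
    have s2 : eLpNorm Ψ₂ 2 volume ≤ sobNorm 2 2 ψ := by
      rw [hS]; exact le_add_self.trans le_add_self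
    obtain ⟨U, p, q, r, -, hu, hp, hq, hr, h4, n0, n1, n2, n3⟩ := key ψ Ψ Ψ₁ hae hP m0 m1
      (sobNorm 2 2 ψ) s0 s1
    rw [sobNorm_congr (hp.wderiv_ae hu.symm), hq.sobNorm_three hr (h4 Ψ₂ hP₁)]
    have n4 := eLpNorm_const_mul_sub_le hi hg.le hr.continuous.aestronglyMeasurable
      m2.1 n2 s2
    refine (add_le_add n1 (add_le_add n2 (add_le_add n3 n4))).trans ?_
    calc _ ≤ Γ * (C * sobNorm 2 2 ψ) + (Γ * (a * (C * sobNorm 2 2 ψ) + sobNorm 2 2 ψ)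
          + (Γ * (a * (Γ * (C * sobNorm 2 2 ψ)) + sobNorm 2 2 ψ)
          + Γ * (a * (Γ * (a * (C * sobNorm 2 2 ψ) + sobNorm 2 2 ψ)) + sobNorm 2 2 ψ)))
          + C * sobNorm 2 2 ψ := le_self_add
      _ = _ := by
        push_cast
        ring

/-! ### The isomorphism from `H²` onto `L²` -/

namespace DepthRep

variable {K : ℝ≥0} {hbar : ℝ} {h H H₁ : ℝ → ℝ}

/-- The weak derivative of `h³ u'`. -/
theorem prim_flux (d : DepthRep K hbar h H H₁) {p q : ℝ → ℝ} (hp : IsPrimitive p q) :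
    IsPrimitive (fun x => H x ^ 3 * p x) (fun x => 3 * H x ^ 2 * H₁ x * p x + H x ^ 3 * q x) := by
  simpa using (d.prim.pow 3).mul hp

theorem flux_ae (d : DepthRep K hbar h H H₁) {u U p : ℝ → ℝ} (hu : U =ᵐ[volume] u)
    (hU : IsPrimitive U p) :
    (fun x => H x ^ 3 * p x) =ᵐ[volume] fun x => h x ^ 3 * wderiv u x := by
  filter_upwards [d.ae_eq, hU.wderiv_ae hu] with x h1 h2
  rw [h1, h2]

theorem weakDiff_flux (d : DepthRep K hbar h H H₁) {u U p q : ℝ → ℝ} (hu : U =ᵐ[volume] u)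
    (hU : IsPrimitive U p) (hp : IsPrimitive p q) :
    WeakDiff 1 (fun x => h x ^ 3 * wderiv u x) := by
  rw [← weakDiff_congr (d.flux_ae hu hU), (d.prim_flux hp).weakDiff_succ_iff]
  exact weakDiff_zero _

/-- `𝓛_h u` in terms of representatives, with `p = u'` and `q = u''`. -/
theorem lop_ae (d : DepthRep K hbar h H H₁) {u U p q : ℝ → ℝ} (hu : U =ᵐ[volume] u)
    (hU : IsPrimitive U p) (hp : IsPrimitive p q) :
    Lop h u =ᵐ[volume] fun x =>
      H x * U x - 1 / 3 * (3 * H x ^ 2 * H₁ x * p x + H x ^ 3 * q x) := by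
  filter_upwards [d.ae_eq, hu, (d.prim_flux hp).wderiv_ae (d.flux_ae hu hU)] with x h1 h2 h3
  rw [Lop, h3, h1, h2]

/-- `𝓛_h` maps `H²` to `L²`: the product `h' u'` is square integrable because `u'` is bounded. -/
theorem lop_bound (d : DepthRep K hbar h H H₁) {u : ℝ → ℝ} (hu : MemSob 2 2 u) :
    MemLp (Lop h u) 2 volume ∧ eLpNorm (Lop h u) 2 volume
      ≤ (K ^ 3 * ((eLpNorm H₁ 2 volume).toNNReal + 2) : ℝ≥0) * sobNorm 2 2 u := by
  obtain ⟨U, p, q, hae, hU, hp, m0, m1, m2, hS⟩ := hu.exists_two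
  have hL := d.lop_ae hae hU hp
  have hDt := d.memLp_deriv.eLpNorm_ne_top
  have mp : AEStronglyMeasurable (fun x => H₁ x * p x) volume := d.memLp_deriv.1.mul m1.1
  have hle : eLpNorm (fun x => H x * U x - 1 / 3 * (3 * H x ^ 2 * H₁ x * p x + H x ^ 3 * q x)) 2
      volume ≤ (K ^ 3 * ((eLpNorm H₁ 2 volume).toNNReal + 2) : ℝ≥0) * sobNorm 2 2 u := by
    refine (eLpNorm_le_mul_sum (G := ![fun x => H₁ x * p x, U, q]) one_le_two (K ^ 3) ?_
      (Eventually.of_forall fun x => ?_)).trans ?_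
    · intro i
      fin_cases i
      · exact mp
      · exact m0.1
      · exact m2.1
    · simp only [Fin.sum_univ_three, Matrix.cons_val_zero, Matrix.cons_val_one, Matrix.cons_val]
      have e : H x * U x - 1 / 3 * (3 * H x ^ 2 * H₁ x * p x + H x ^ 3 * q x)
          = -(H x ^ 2) * (H₁ x * p x) + H x * U x + -(1 / 3 * H x ^ 3) * q x := by ring
      have hp0 := d.pos x
      have hK := d.one_le
      have hpow : ∀ n, n ≤ 3 → H x ^ n ≤ (K : ℝ) ^ 3 := fun n hn =>
        (pow_le_pow_left₀ hp0.le (d.upper x) n).trans (pow_le_pow_right₀ hK hn)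
      rw [e, mul_add, mul_add]
      push_cast
      refine (abs_add_le _ _).trans (add_le_add ((abs_add_le _ _).trans (add_le_add ?_ ?_)) ?_)
      · rw [abs_mul, abs_neg, abs_of_pos (by positivity : 0 < H x ^ 2)]
        exact mul_le_mul_of_nonneg_right (hpow 2 (by norm_num)) (abs_nonneg _)
      · rw [abs_mul, abs_of_pos hp0]
        exact mul_le_mul_of_nonneg_right (by simpa using hpow 1 (by norm_num)) (abs_nonneg _)
      · rw [abs_mul, abs_neg, abs_of_pos (by positivity : 0 < 1 / 3 * H x ^ 3)]
        refine mul_le_mul_of_nonneg_right ?_ (abs_nonneg _)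
        have := hpow 3 le_rfl
        have : 0 < H x ^ 3 := by positivity
        linarith
    · simp only [Fin.sum_univ_three, Matrix.cons_val_zero, Matrix.cons_val_one, Matrix.cons_val]
      rw [ENNReal.coe_mul, mul_assoc]
      refine mul_le_mul' le_rfl ?_
      have hsup : eLpNorm p ⊤ volume ≤ sobNorm 2 2 u := by
        have h1 := hp.two_mul_eLpNorm_top_le m1 m2
        have h2 : eLpNorm p ⊤ volume ≤ 2 * eLpNorm p ⊤ volume :=
          le_mul_of_one_le_left' one_le_two
        rw [hS]
        exact (h2.trans h1).trans le_add_self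
      have hHp : eLpNorm (fun x => H₁ x * p x) 2 volume
          ≤ eLpNorm H₁ 2 volume * sobNorm 2 2 u := by
        have e : (fun x => H₁ x * p x) = fun x => p x * H₁ x := by funext x; ring
        rw [e, mul_comm]
        exact (eLpNorm_mul_le_top d.memLp_deriv.1).trans (mul_le_mul' hsup le_rfl)
      rw [ENNReal.coe_add, ENNReal.coe_toNNReal hDt, add_mul, add_assoc]
      refine add_le_add hHp ?_
      rw [ENNReal.coe_ofNat, two_mul]
      refine add_le_add ?_ ?_
      · rw [hS]; exact le_self_add
      · rw [hS]; exact le_add_self.trans le_add_self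
  rw [eLpNorm_congr_ae hL]
  refine ⟨(memLp_congr_ae hL).2 ⟨?_, hle.trans_lt ?_⟩, hle⟩
  · have hmH : AEStronglyMeasurable H volume := d.continuous.aestronglyMeasurable
    exact (hmH.mul m0.1).sub (((d.prim_flux hp).locInt.aestronglyMeasurable).const_mul _)
  · exact ENNReal.mul_lt_top ENNReal.coe_lt_top hu.2

/-- For `u ∈ H²`, the pair of `u` and `V = h³ u' / 3` is a bounded solution of the system with data
`𝓛_h u`. -/
theorem linv_lop (d : DepthRep K hbar h H H₁) {u : ℝ → ℝ} (hu : MemSob 2 2 u) :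
    Linv h (Lop h u) =ᵐ[volume] u := by
  obtain ⟨U, p, q, hae, hU, hp, m0, m1, m2, hS⟩ := hu.exists_two
  refine EventuallyEq.trans (d.linv_of_system (V := fun x => 1 / 3 * (H x ^ 3 * p x))
    ((d.lop_bound hu).1.locallyIntegrable one_le_two) ⟨?_, ?_⟩
    (M := ((eLpNorm U 2 volume).toReal + (eLpNorm p 2 volume).toReal) / 2) fun x => ?_).2 hae
  · refine hU.congr_right (Eventually.of_forall fun x => ?_)
    have := (d.pos x).ne'
    simp only [Pi.zero_apply]
    field_simp
    ring
  · refine ((d.prim_flux hp).const_mul (1 / 3)).congr_right ?_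
    filter_upwards [d.lop_ae hae hU hp] with x hx
    rw [hx]
    ring
  · linarith [hU.two_mul_abs_le m0 m1 x]

theorem lop_linv (d : DepthRep K hbar h H H₁) {ψ : ℝ → ℝ} (hψ : MemLp ψ 2 volume) :
    MemSob 2 2 (Linv h ψ) ∧ Lop h (Linv h ψ) =ᵐ[volume] ψ := by
  obtain ⟨C, -, hex⟩ := exists_linv K
  obtain ⟨C', -, hest⟩ := L2_estimates K
  obtain ⟨⟨U, V, hs, -, -, hae⟩, -⟩ := hex hbar h H H₁ d 2 (Or.inr rfl) ψ hψ
  have p1 := d.prim_first hs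
  have p2 := d.prim_second hs
  refine ⟨⟨p1.continuous.aestronglyMeasurable.congr hae.symm, ?_⟩, ?_⟩
  · refine (hest hbar h H H₁ d ψ hψ).2.2.1.trans_lt ?_
    rw [d.eLpNorm_wderiv]
    have h1 := d.memLp_deriv.eLpNorm_ne_top
    have h2 := hψ.eLpNorm_ne_top
    finiteness
  · refine (d.lop_ae hae.symm p1 p2).trans (Eventually.of_forall fun x => ?_)
    have := (d.pos x).ne'
    simp only
    field_simp
    ring

theorem isIsoH2L2 (d : DepthRep K hbar h H H₁) : IsIsoH2L2 (Lop h) := by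
  have hcongr : ∀ u v, u =ᵐ[volume] v → Lop h u =ᵐ[volume] Lop h v := fun u v huv => by
    filter_upwards [huv] with x hx
    rw [Lop, Lop, wderiv_congr huv, hx]
  refine ⟨fun u v _ => hcongr u v, fun u v hu hv => ?_, fun c u hu => ?_,
    fun u hu => (d.lop_bound hu).1, ⟨_, fun u hu => (d.lop_bound hu).2⟩, fun u hu h0 => ?_,
    fun f hf => ⟨_, d.lop_linv hf⟩, ?_⟩
  · obtain ⟨U, p, q, hae, hU, hp, -⟩ := hu.exists_two
    obtain ⟨U', p', q', hae', hU', hp', -⟩ := hv.exists_two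
    filter_upwards [d.lop_ae (hae.add hae') (hU.add hU') (hp.add hp'), d.lop_ae hae hU hp,
      d.lop_ae hae' hU' hp'] with x h1 h2 h3
    rw [h1, Pi.add_apply, Pi.add_apply, h2, h3]
    ring
  · obtain ⟨U, p, q, hae, hU, hp, -⟩ := hu.exists_two
    filter_upwards [d.lop_ae (hae.const_smul c) (hU.const_mul c) (hp.const_mul c),
      d.lop_ae hae hU hp] with x h1 h2
    rw [h1, Pi.smul_apply, Pi.smul_apply, h2, smul_eq_mul, smul_eq_mul]
    ring
  · have hz : IsPrimitive (0 : ℝ → ℝ) 0 := IsPrimitive.const 0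
    have h1 : Linv h 0 =ᵐ[volume] 0 := (d.linv_of_system (U := 0) (V := 0) locallyIntegrable_zero
      ⟨hz.congr_right (Eventually.of_forall fun x => by simp),
        hz.congr_right (Eventually.of_forall fun x => by simp)⟩ (M := 0) fun x => by simp).2
    have h2 := d.linv_lop hu
    rw [Linv, slInv_congr h0 .rfl] at h2
    exact h2.symm.trans h1
  · obtain ⟨C, -, hest⟩ := L2_estimates K
    refine ⟨C * (1 + (eLpNorm H₁ 2 volume).toNNReal ^ 2), fun u hu => ?_⟩
    have := (hest hbar h H H₁ d _ (d.lop_bound hu).1).2.2.1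
    rw [sobNorm_congr (d.linv_lop hu), d.eLpNorm_wderiv] at this
    refine this.trans_eq ?_
    push_cast
    rw [ENNReal.coe_toNNReal d.memLp_deriv.eLpNorm_ne_top]

end DepthRep

/-! ### Limits at infinity -/

/-- The weighted local norm of a bounded function which vanishes at infinity vanishes there. -/
theorem tendsto_weighted_norm {F : Filter ℝ} [F.IsCountablyGenerated]
    (hF : ∀ y, Tendsto (fun x => y + x) F F) {g w : ℝ → ℝ} (cg : Continuous g) {M : ℝ}
    (hM : ∀ x, |g x| ≤ M) (hg : Tendsto g F (𝓝 0)) (hw : MemLp w 2 volume) :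
    Tendsto (fun x => (eLpNorm (fun y => g (y + x) * w y) 2 volume).toReal) F (𝓝 0) := by
  have h2 : (2 : ℝ≥0∞) ≠ 0 := two_ne_zero
  have hD : Tendsto (fun x => ∫⁻ y, ‖g (y + x) * w y‖ₑ ^ (2 : ℝ≥0∞).toReal) F
      (𝓝 (∫⁻ _ : ℝ, 0)) := by
    refine tendsto_lintegral_filter_of_dominated_convergence'
      (fun y => ‖M * w y‖ₑ ^ (2 : ℝ≥0∞).toReal) (Eventually.of_forall fun x => ?_)
      (Eventually.of_forall fun x => Eventually.of_forall fun y => ?_) ?_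
      (Eventually.of_forall fun y => ?_)
    · have : Continuous fun y => g (y + x) := by fun_prop
      exact (this.aestronglyMeasurable.mul hw.1).enorm.pow_const _
    · refine ENNReal.rpow_le_rpow ?_ (by simp)
      rw [enorm_mul, enorm_mul]
      refine mul_le_mul' (enorm_le_iff_norm_le.2 ?_) le_rfl
      exact (hM _).trans (le_abs_self M)
    · exact (lintegral_rpow_enorm_lt_top_of_eLpNorm_lt_top h2 ENNReal.ofNat_ne_top
        (hw.const_mul M).2).ne
    · have h1 : Tendsto (fun x => g (y + x) * w y) F (𝓝 (0 * w y)) :=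
        (hg.comp (hF y)).mul_const _
      have h3 := (h1.enorm.ennrpow_const (2 : ℝ≥0∞).toReal)
      simpa using h3
  rw [lintegral_zero] at hD
  have h3 := hD.ennrpow_const (1 / (2 : ℝ≥0∞).toReal)
  rw [ENNReal.zero_rpow_of_pos (by simp)] at h3
  have h4 := (ENNReal.tendsto_toReal ENNReal.zero_ne_top).comp h3
  rw [ENNReal.toReal_zero] at h4
  refine h4.congr fun x => ?_
  rw [eLpNorm_eq_lintegral_rpow_enorm_toReal h2 ENNReal.ofNat_ne_top]
  rfl

namespace DepthRep

variable {K : ℝ≥0} {hbar : ℝ} {h H H₁ : ℝ → ℝ}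

/-- The constant `c = l / hbar` solves the equation with data `c h`, so that `u - c` is the solution
for data which tend to zero. -/
theorem linv_limits (d : DepthRep K hbar h H H₁) {ψ : ℝ → ℝ} (hψ : MemClim ψ) :
    WellDefined h (cube3 h) ψ 0 ∧ ∃ U : ℝ → ℝ, Continuous U ∧ U =ᵐ[volume] Linv h ψ ∧
      (∀ l : ℝ, Tendsto ψ atBot (𝓝 l) → Tendsto U atBot (𝓝 (l / hbar))) ∧
      (∀ l : ℝ, Tendsto ψ atTop (𝓝 l) → Tendsto U atTop (𝓝 (l / hbar))) := by
  obtain ⟨C, -, hex⟩ := exists_linv_bounded K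
  obtain ⟨M, hM⟩ := hψ.exists_bound
  obtain ⟨U, V, hs, hU, -, hW, hae, -⟩ := hex hbar h H H₁ d ψ hψ.1 M hM
  have hlim : ∀ F : Filter ℝ, F.IsCountablyGenerated → (∀ y, Tendsto (fun x => y + x) F F) →
      Tendsto H F (𝓝 hbar) → ∀ l, Tendsto ψ F (𝓝 l) → Tendsto U F (𝓝 (l / hbar)) := by
    intro F _ hF hH l hl
    set c := l / hbar with hc
    have hgb : ∀ x, |ψ x - H x * c| ≤ M + K * |c| := fun x => by
      refine (abs_sub _ _).trans (add_le_add (hM x) ?_)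
      rw [abs_mul, abs_of_pos (d.pos x)]
      exact mul_le_mul_of_nonneg_right (d.upper x) (abs_nonneg c)
    have cg : Continuous fun x => ψ x - H x * c := hψ.1.sub (d.continuous.mul continuous_const)
    have hg : Tendsto (fun x => ψ x - H x * c) F (𝓝 0) := by
      have := hl.sub (hH.mul_const c)
      rwa [hc, mul_div_cancel₀ l d.hbar_pos.ne', sub_self, ← hc] at this
    obtain ⟨U', V', hs', hU', -, -, -, hloc⟩ := hex hbar h H H₁ d _ cg _ hgb
    have hsc : IsSystemSol (fun x => 3 * (H x)⁻¹ ^ 3) H 0 (fun x => ψ x - H x * c)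
        (fun x => U x - c) V := by
      refine ⟨?_, hs.2.congr_right (Eventually.of_forall fun x => ?_)⟩
      · simpa using hs.1.sub (IsPrimitive.const c)
      · simp only
        ring
    have hgrow : ∀ x t : ℝ, 0 ≤ t → t ≤ t * (1 + |x|) ^ 2 := fun x t ht => by
      refine le_mul_of_one_le_right ht ?_
      have := abs_nonneg x
      exact one_le_pow₀ (by linarith)
    have hsys := d.systemCoeff
    have hM0 : 0 ≤ M := (abs_nonneg _).trans (hM 0)
    have heq := (IsSystemSol.unique hsys.pos hsys.leα hsys.leβ hsys.βle hsc hs'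
      (K := C * M + |c|) (K' := C * (M + K * |c|)) (fun x => ?_) fun x => ?_).1
    · have h0 := (tendsto_weighted_norm hF cg hgb hg (memLp_inv_one_add_sq
        (half_pos (hsys.pos)))).const_mul (C : ℝ)
      rw [mul_zero] at h0
      have h1 : Tendsto (fun x => U x - c) F (𝓝 0) := by
        rw [heq]
        exact squeeze_zero_norm hloc h0
      simpa using h1.add_const c
    · refine ((abs_sub _ _).trans (add_le_add (hU x) le_rfl)).trans (hgrow x _ (by positivity))
    · exact (hU' x).trans (hgrow x _ (by positivity))
  exact ⟨hW, U, hs.1.continuous, hae.symm,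
    hlim atBot inferInstance (fun y => tendsto_atBot_add_const_left _ y tendsto_id) d.tendsto_atBot,
    hlim atTop inferInstance (fun y => tendsto_atTop_add_const_left _ y tendsto_id) d.tendsto_atTop⟩

end DepthRep

/-! ### Boundedness properties of `𝓛_h⁻¹` and of `(g - γ ∂ₓ²)⁻¹` -/

theorem lemma5p2 :
    -- isomorphism, and the spaces on which the inverse is defined
    (∀ (hbar : ℝ) (h : ℝ → ℝ), IsDepth hbar h →
      (∀ u, MemSob 2 2 u → WeakDiff 1 (fun x => h x ^ 3 * wderiv u x)) ∧
      IsIsoH2L2 (Lop h) ∧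
      (∀ u, MemSob 2 2 u → Linv h (Lop h u) =ᵐ[volume] u) ∧
      (∀ ψ, MemLp ψ 2 volume →
        MemSob 2 2 (Linv h ψ) ∧ Lop h (Linv h ψ) =ᵐ[volume] ψ) ∧
      (∀ ψ, (MemClim ψ ∨ MemLp ψ 1 volume ∨ MemLp ψ 2 volume) →
        WellDefined h (cube3 h) ψ 0) ∧
      (∀ φ, (MemLp φ 1 volume ∨ MemLp φ 2 volume) → WellDefined h (cube3 h) 0 φ) ∧
      (∀ ψ, MemClim ψ → ∃ U : ℝ → ℝ, Continuous U ∧ U =ᵐ[volume] Linv h ψ ∧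
        (∀ l : ℝ, Tendsto ψ atBot (𝓝 l) → Tendsto U atBot (𝓝 (l / hbar))) ∧
        (∀ l : ℝ, Tendsto ψ atTop (𝓝 l) → Tendsto U atTop (𝓝 (l / hbar))))) ∧
    -- estimates, with a constant depending only on the bounds for `h⁻¹` and `h`
    (∀ A B : ℝ≥0, ∃ C : ℝ≥0, 0 < C ∧ ∀ (hbar : ℝ) (h : ℝ → ℝ), IsDepth hbar h →
      eLpNorm (fun x => (h x)⁻¹) ⊤ volume ≤ A → eLpNorm h ⊤ volume ≤ B →
      (∀ ψ, MemClim ψ →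
        sobNorm 1 ⊤ (Linv h ψ) ≤ C * eLpNorm ψ ⊤ volume ∧
        WeakDiff 2 (Linv h ψ) ∧
        ∀ᵐ x, ‖wderiv (wderiv (Linv h ψ)) x‖ₑ
          ≤ C * (1 + ‖wderiv h x‖ₑ) * eLpNorm ψ ⊤ volume) ∧
      (∀ ψ, MemLp ψ 1 volume →
        sobNorm 1 2 (Linv h ψ) ≤ C * eLpNorm ψ 1 volume ∧
        eLpNorm (LinvD h ψ) ⊤ volume ≤ C * eLpNorm ψ 1 volume ∧
        eLpNorm (wderiv (LinvD h ψ)) ⊤ volume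
          ≤ C * (eLpNorm ψ 1 volume + eLpNorm ψ ⊤ volume) ∧
        eLpNorm (LinvD h ψ) 2 volume
          ≤ C * eLpNorm ψ 1 volume * (eLpNorm (wderiv h) 2 volume + 1)) ∧
      (∀ ψ, MemLp ψ 2 volume →
        sobNorm 1 2 (LinvD h ψ) + sobNorm 1 2 (Linv h ψ) ≤ C * eLpNorm ψ 2 volume ∧
        sobNorm 1 ⊤ (Linv h ψ) ≤ sobNorm 2 2 (Linv h ψ) ∧
        sobNorm 2 2 (Linv h ψ)
          ≤ C * (1 + eLpNorm (wderiv h) 2 volume ^ 2) * eLpNorm ψ 2 volume ∧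
        ∀ᵐ x, ‖wderiv (wderiv (Linv h ψ)) x‖ₑ
          ≤ C * ((1 + eLpNorm (wderiv h) 2 volume) * (1 + ‖wderiv h x‖ₑ) * eLpNorm ψ 2 volume
              + ‖ψ x‖ₑ)) ∧
      (MemSob 2 2 (fun x => h x - hbar) → ∀ φ, MemSob 2 2 φ →
        sobNorm 3 2 (LinvD h φ)
          ≤ C * ((1 + eLpNorm (wderiv h) ⊤ volume ^ 2) * sobNorm 2 2 φ
              + sobNorm 2 2 (fun x => h x - hbar) * sobNorm 1 ⊤ (LinvD h φ)) ∧
        sobNorm 3 2 (Linv h φ)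
          ≤ C * ((1 + eLpNorm (wderiv h) ⊤ volume ^ 2) * sobNorm 2 2 φ
              + sobNorm 2 2 (fun x => h x - hbar) * sobNorm 1 ⊤ (Linv h φ)))) ∧
    -- the constant-coefficient operator
    (∀ g γ : ℝ, 0 < g → 0 < γ → ∃ C : ℝ≥0, 0 < C ∧
      (∀ ψ, MemSob 1 2 ψ → WellDefined (fun _ => g) (fun _ => γ) ψ 0 ∧
        sobNorm 3 2 (helmInv g γ ψ) ≤ C * sobNorm 1 2 ψ) ∧
      (∀ ψ, MemSob 2 2 ψ →
        sobNorm 3 2 (wderiv (helmInv g γ ψ)) ≤ C * sobNorm 2 2 ψ)) := by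
  refine ⟨fun hbar h hd => ?_, fun A B => ?_, fun g γ hg hγ => helmholtz_estimates hg hγ⟩
  · obtain ⟨A, B, hA, hB⟩ := hd.exists_bounds
    obtain ⟨H, H₁, d⟩ := hd.exists_depthRep hA hB
    obtain ⟨C, -, hex⟩ := DepthRep.exists_linv (max (max A B) 1)
    refine ⟨fun u hu => ?_, d.isIsoH2L2, fun u hu => d.linv_lop hu, fun ψ hψ => d.lop_linv hψ,
      fun ψ hψ => ?_, fun φ hφ => ?_, fun ψ hψ => (d.linv_limits hψ).2⟩
    · obtain ⟨U, p, q, hae, hU, hp, -⟩ := hu.exists_two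
      exact d.weakDiff_flux hae hU hp
    · rcases hψ with hψ | hψ | hψ
      · exact (d.linv_limits hψ).1
      · obtain ⟨⟨U, V, -, -, hW, -⟩, -⟩ := hex hbar h H H₁ d 1 (Or.inl rfl) ψ hψ
        exact hW
      · obtain ⟨⟨U, V, -, -, hW, -⟩, -⟩ := hex hbar h H H₁ d 2 (Or.inr rfl) ψ hψ
        exact hW
    · rcases hφ with hφ | hφ
      · obtain ⟨-, U, V, -, -, hW, -⟩ := hex hbar h H H₁ d 1 (Or.inl rfl) φ hφ
        exact hW
      · obtain ⟨-, U, V, -, -, hW, -⟩ := hex hbar h H H₁ d 2 (Or.inr rfl) φ hφ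
        exact hW
  · obtain ⟨C₁, p₁, e₁⟩ := DepthRep.clim_estimates (max (max A B) 1)
    obtain ⟨C₂, -, e₂⟩ := DepthRep.L1_estimates (max (max A B) 1)
    obtain ⟨C₃, -, e₃⟩ := DepthRep.L2_estimates (max (max A B) 1)
    obtain ⟨C₄, -, e₄⟩ := DepthRep.H2_estimates (max (max A B) 1)
    have l₁ : C₁ ≤ C₁ + C₂ + C₃ + C₄ := le_self_add.trans (le_self_add.trans le_self_add)
    have l₂ : C₂ ≤ C₁ + C₂ + C₃ + C₄ := le_add_self.trans (le_self_add.trans le_self_add)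
    have l₃ : C₃ ≤ C₁ + C₂ + C₃ + C₄ := le_add_self.trans le_self_add
    have l₄ : C₄ ≤ C₁ + C₂ + C₃ + C₄ := le_add_self
    set C : ℝ≥0 := C₁ + C₂ + C₃ + C₄
    refine ⟨C, p₁.trans_le l₁, fun hbar h hd hA hB => ?_⟩
    obtain ⟨H, H₁, d⟩ := hd.exists_depthRep hA hB
    refine ⟨fun ψ hψ => ?_, fun ψ hψ => ?_, fun ψ hψ => ?_, fun hh φ hφ => ?_⟩
    · obtain ⟨h1, h2, h3⟩ := e₁ hbar h H H₁ d ψ hψ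
      refine ⟨h1.trans (by gcongr), h2, ?_⟩
      filter_upwards [h3] with x hx
      exact hx.trans (by gcongr)
    · obtain ⟨h1, h2, h3, h4⟩ := e₂ hbar h H H₁ d ψ hψ
      exact ⟨h1.trans (by gcongr), h2.trans (by gcongr), h3.trans (by gcongr), h4.trans (by gcongr)⟩
    · obtain ⟨h1, h2, h3, h4⟩ := e₃ hbar h H H₁ d ψ hψ
      refine ⟨h1.trans (by gcongr), h2, h3.trans (by gcongr), ?_⟩
      filter_upwards [h4] with x hx
      exact hx.trans (by gcongr)
    · obtain ⟨h1, h2⟩ := e₄ hbar h H H₁ d hh φ hφ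
      exact ⟨h1.trans (by gcongr), h2.trans (by gcongr)⟩
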